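/- **Setting.** All Hilbert spaces are finite-dimensional and nonzero; a channel is a completely positive trace-preserving map; $\log$ is taken to any fixed base $b>1$. Let $\mathcal E$ be a channel from system $A$ to system $B$ and $0\le\epsilon\le1$. A superchannel is a map $\Theta(\mathcal L)=\mathcal P_{\rm post}\circ(\mathrm{id}\otimes\mathcal L)\circ\mathcal P_{\rm pre}$ with channels $\mathcal P_{\rm pre},\mathcal P_{\rm post}$ and a finite-dimensional memory. For each pair of systems consider three sets $\mathbb O$ of free channels: $\mathbb O_{\rm SEP}$ (channels whose Choi state is separable), $\mathbb O_{\rm PPT}$ (channels whose Choi state has positive partial transpose) and $\mathbb O_R$ (replacement channels $X\mapsto \mathrm{Tr}(X)\,\sigma$, $\sigma$ a state). The corresponding codes $\mathbb S_{\rm SEP},\mathbb S_{\rm PPT},\mathbb S_{\rm NS}$ (separability-preserving, PPT-preserving, no-signalling) are all superchannels mapping $\mathbb O$ on the input systems into $\mathbb O$ on the output systems. With $F(\rho,\sigma)=\|\sqrt\rho\sqrt\sigma\|_1^2$ and $F(\mathcal E_1,\mathcal E_2)=\inf_\rho F(\mathrm{id}\otimes\mathcal E_1(\rho),\mathrm{id}\otimes\mathcal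 E_2(\rho))$, where $\rho$ ranges over the states of the input and a reference copy of it, put, with $d\in\{1,2,\dots\}$, $$Q^\epsilon_{\mathbb S}(\mathcal E)=\max\{\log d:\exists\,\Theta\in\mathbb S,\ F(\Theta(\mathcal E),\mathrm{id}_d)\ge1-\epsilon\},\qquad C^\epsilon_{\mathbb S}(\mathcal E)=\min\{\log d:\exists\,\Theta\in\mathbb S,\ F(\Theta(\mathrm{id}_d),\mathcal E)\ge1-\epsilon\}.$$ **Resource measures.** (With values in $[0,\infty]$.) For a set $\mathbb O$ of channels and a set $\tilde{\mathbb O}\supseteq\mathbb O$ of channels, let $R_{\mathbb O;\tilde{\mathbb O}}(\mathcal E)=\inf\{1+r: r\ge0,\ \frac{\mathcal E+r\mathcal M}{1+r}\in\mathbb O,\ \mathcal M\in\tilde{\mathbb O}\}$, $R^\epsilon_{\mathbb O;\tilde{\mathbb O}}(\mathcal E)=\inf\{R_{\mathbb O;\tilde{\mathbb O}}(\mathcal E'):\mathcal E'\text{ a channel},\ F(\mathcal E',\mathcal E)\ge1-\epsilon\}$; $R_{s,\mathbb O}$ is the case $\tilde{\mathbb O}=\mathbb O$, and $R_{\max,\mathbb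 O}$ the case where $\tilde{\mathbb O}$ consists of all channels; likewise for $R^\epsilon_{s,\mathbb O}$, $R^\epsilon_{\max,\mathbb O}$. For a set $\mathbb X$ of channels, or the affine hull $\mathbb X={\rm aff}(\mathbb O)$ over $\mathbb R$ of such a set, let $$R^\epsilon_{H,\mathbb X}(\mathcal E)=\inf_{\mathcal M\in\mathbb X}\ \sup_\psi\ \sup_{0\le P\le 1,\ \mathrm{Tr}(P\,\mathrm{id}\otimes\mathcal E(\psi))\ge1-\epsilon}\big(\mathrm{Tr}(P\,\mathrm{id}\otimes\mathcal M(\psi))\big)^{-1},\qquad R_{\min,\mathbb X}(\mathcal E)=\sup_\psi\inf_{\mathcal M\in\mathbb X}\big(\mathrm{Tr}(\Pi_{\mathrm{id}\otimes\mathcal E(\psi)}\,\mathrm{id}\otimes\mathcal M(\psi))\big)^{-1},$$ where $\psi$ ranges over the pure states of the input and a reference copy of it, $\Pi_\rho$ is the projection onto the support of $\rho$, and $x^{-1}=\infty$ for $x\le0$. For real $x\ge1$ let $\lfloor x\rfloor_\square=\max\{d^2: d\ge1,\ d^2\le x\}$ and $\lceil x\rceil_\square=\min\{d^2: d\ge1,\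 d^2\ge x\}$ with $d$ ranging over integers. **Statement.** 1. For $\mathbb O=\mathbb O_{\rm SEP}$, $\mathbb S=\mathbb S_{\rm SEP}$, and likewise for $\mathbb O=\mathbb O_{\rm PPT}$, $\mathbb S=\mathbb S_{\rm PPT}$: $R_{\min,\mathbb O}(\mathrm{id}_d)=R_{s,\mathbb O}(\mathrm{id}_d)=d$ for every $d\ge1$, and $$Q^\epsilon_{\mathbb S}(\mathcal E)=\log\lfloor R^\epsilon_{H,\mathbb O}(\mathcal E)\rfloor\quad(\epsilon<1),\qquad C^\epsilon_{\mathbb S}(\mathcal E)=\log\lceil R^\epsilon_{s,\mathbb O}(\mathcal E)\rceil .$$ 2. $R_{\min,{\rm aff}(\mathbb O_R)}(\mathrm{id}_d)=R_{\max,\mathbb O_R}(\mathrm{id}_d)=d^2$ for every $d\ge1$, and $$Q^\epsilon_{\mathbb S_{\rm NS}}(\mathcal E)=\tfrac12\log\lfloor R^\epsilon_{H,{\rm aff}(\mathbb O_R)}(\mathcal E)\rfloor_\square\quad(\epsilon<1),\qquad C^\epsilon_{\mathbb S_{\rm NS}}(\mathcal E)=\tfrac12\log\lceil R^\epsilon_{\max,\mathbb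 O_R}(\mathcal E)\rceil_\square .$$ In all these formulas the maximum (for $\epsilon<1$) and the minimum defining $Q$ and $C$ are attained and the resource measures on the right-hand sides are finite. -/

import Mathlib

open scoped ENNReal ComplexOrder MatrixOrder Kronecker

namespace QComm

noncomputable section

/-- Linear maps taking operators on `ℂ^A` to operators on `ℂ^B`. -/
abbrev OpMap (A B : Type*) : Type _ := Matrix A A ℂ →ₗ[ℂ] Matrix B B ℂ

/-- The map `id ⊗ L`, acting as the identity on operators on the reference system `ℂ^R`. -/
def amplify (R : Type*) {A B : Type*} (L : OpMap A B) : OpMap (R × A) (R × B) where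
  toFun X := Matrix.of fun p q => L (Matrix.of fun a a' => X (p.1, a) (q.1, a')) p.2 q.2
  map_add' X Y := by
    ext p q
    have h : (Matrix.of fun a a' => (X + Y) (p.1, a) (q.1, a')) =
        (Matrix.of fun a a' => X (p.1, a) (q.1, a')) +
          (Matrix.of fun a a' => Y (p.1, a) (q.1, a')) := rfl
    rw [Matrix.of_apply, h, map_add]
    rfl
  map_smul' c X := by
    ext p q
    have h : (Matrix.of fun a a' => (c • X) (p.1, a) (q.1, a')) =
        c • (Matrix.of fun a a' => X (p.1, a) (q.1, a')) := rfl
    rw [Matrix.of_apply, h, map_smul]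
    rfl

section Channels

variable {A B : Type*} [Fintype A] [Fintype B]

/-- Complete positivity. -/
def IsCP (L : OpMap A B) : Prop :=
  ∀ (n : ℕ) (X : Matrix (Fin n × A) (Fin n × A) ℂ),
    X.PosSemidef → (amplify (Fin n) L X).PosSemidef

/-- Quantum channels: completely positive trace-preserving maps. -/
def IsChannel (L : OpMap A B) : Prop :=
  IsCP L ∧ ∀ X : Matrix A A ℂ, (L X).trace = X.trace

/-- The set of all quantum channels from `ℂ^A` to `ℂ^B`. -/
def allChannels (A B : Type*) [Fintype A] [Fintype B] : Set (OpMap A B) := {L | IsChannel L}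

/-- Density operators. -/
def IsState (ρ : Matrix A A ℂ) : Prop := ρ.PosSemidef ∧ ρ.trace = 1

/-- Unit vectors. -/
def IsUnitVec (v : A → ℂ) : Prop := ∑ i, ‖v i‖ ^ 2 = 1

/-- The rank-one operator `|v⟩⟨v|`. -/
def pureOp (v : A → ℂ) : Matrix A A ℂ := Matrix.vecMulVec v (star v)

end Channels

/-- The trace norm `‖X‖₁ = Tr √(X† X)`. -/
def traceNorm {A : Type*} [Fintype A] [DecidableEq A] (X : Matrix A A ℂ) : ℝ :=
  (CFC.sqrt (X.conjTranspose * X)).trace.re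

/-- The fidelity `F(ρ, σ) = ‖√ρ √σ‖₁²` of two states. -/
def fidelity {A : Type*} [Fintype A] [DecidableEq A] (ρ σ : Matrix A A ℂ) : ℝ :=
  traceNorm (CFC.sqrt ρ * CFC.sqrt σ) ^ 2

/-- The orthogonal projection onto the support of a Hermitian operator `ρ`
(functional calculus with the indicator function of `ℝ \ {0}`). -/
def supportProj {A : Type*} [Fintype A] [DecidableEq A] (ρ : Matrix A A ℂ) : Matrix A A ℂ :=
  cfc (fun x : ℝ => if x = 0 then (0 : ℝ) else 1) ρ

section Measures

variable {A B : Type*} [Fintype A] [DecidableEq A] [Fintype B] [DecidableEq B]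

/-- Worst-case fidelity of two channels, over all states of a reference copy of the input
together with the input. -/
def channelFidelity (E₁ E₂ : OpMap A B) : ℝ :=
  ⨅ ρ : {ρ : Matrix (A × A) (A × A) ℂ // IsState ρ},
    fidelity (amplify A E₁ ρ.1) (amplify A E₂ ρ.1)

/-- The robustness `R_{O;O'}(E) = inf {1 + r | r ≥ 0, (E + r M)/(1 + r) ∈ O, M ∈ O'}`,
with value `∞` if there is no such `r`. -/
def robustness (O O' : Set (OpMap A B)) (E : OpMap A B) : ℝ≥0∞ :=
  ⨅ (r : ℝ) (_ : 0 ≤ r ∧ ∃ M ∈ O', (1 + r)⁻¹ • (E + r • M) ∈ O), ENNReal.ofReal (1 + r)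

/-- The `ε`-smoothed robustness. -/
def smoothRobustness (ε : ℝ) (O O' : Set (OpMap A B)) (E : OpMap A B) : ℝ≥0∞ :=
  ⨅ (E' : OpMap A B) (_ : IsChannel E' ∧ 1 - ε ≤ channelFidelity E' E), robustness O O' E'

/-- Standard robustness `R_{s,O}`. -/
def stdRobustness (O : Set (OpMap A B)) (E : OpMap A B) : ℝ≥0∞ := robustness O O E

/-- Generalized robustness `R_{max,O}`. -/
def maxRobustness (O : Set (OpMap A B)) (E : OpMap A B) : ℝ≥0∞ :=
  robustness O (allChannels A B) E

/-- Smooth standard robustness `R_{s,O}^ε`. -/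
def smoothStdRobustness (ε : ℝ) (O : Set (OpMap A B)) (E : OpMap A B) : ℝ≥0∞ :=
  smoothRobustness ε O O E

/-- Smooth generalized robustness `R_{max,O}^ε`. -/
def smoothMaxRobustness (ε : ℝ) (O : Set (OpMap A B)) (E : OpMap A B) : ℝ≥0∞ :=
  smoothRobustness ε O (allChannels A B) E

/-- `R_H^ε(ρ‖σ) = sup {Tr(Pσ)⁻¹ | 0 ≤ P ≤ 1, Tr(Pρ) ≥ 1 - ε}`; here `σ` is Hermitian, and the
inverse of a number `≤ 0` is `∞`, so that `R_H^ε(ρ‖σ)⁻¹` is the positive part of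
the infimum of `Tr(Pσ)`. -/
def hypTestState {n : Type*} [Fintype n] [DecidableEq n] (ε : ℝ) (ρ σ : Matrix n n ℂ) : ℝ≥0∞ :=
  ⨆ (P : Matrix n n ℂ)
    (_ : P.PosSemidef ∧ (1 - P).PosSemidef ∧ 1 - ε ≤ (P * ρ).trace.re),
    (ENNReal.ofReal (P * σ).trace.re)⁻¹

/-- `R_{H,O}^ε(E) = inf_{M ∈ O} sup_ψ R_H^ε(id ⊗ E(ψ) ‖ id ⊗ M(ψ))`, with `ψ` ranging over the
pure states of a reference copy of the input together with the input. -/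
def hypTest (ε : ℝ) (O : Set (OpMap A B)) (E : OpMap A B) : ℝ≥0∞ :=
  ⨅ M ∈ O, ⨆ (v : A × A → ℂ) (_ : IsUnitVec v),
    hypTestState ε (amplify A E (pureOp v)) (amplify A M (pureOp v))

/-- The min-relative entropy measure: `R_{min,O}(E)⁻¹` is the infimum over pure `ψ` of the
supremum over `M ∈ O` of `Tr(Π_{id ⊗ E(ψ)} (id ⊗ M(ψ)))`. -/
def minMeasure (O : Set (OpMap A B)) (E : OpMap A B) : ℝ≥0∞ :=
  ⨆ (v : A × A → ℂ) (_ : IsUnitVec v), ⨅ M ∈ O,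
    (ENNReal.ofReal
      (supportProj (amplify A E (pureOp v)) * amplify A M (pureOp v)).trace.re)⁻¹

end Measures

/-- The affine hull `aff(O)`. -/
def aff {A B : Type*} (O : Set (OpMap A B)) : Set (OpMap A B) := (affineSpan ℝ O : Set (OpMap A B))

section FreeChannels

/-- The Choi state `(id ⊗ E)(ψ⁺)`, with `ψ⁺` the normalized maximally entangled state. -/
def choiState {A B : Type*} [Fintype A] [DecidableEq A] (E : OpMap A B) :
    Matrix (A × B) (A × B) ℂ :=
  Matrix.of fun p q => (Fintype.card A : ℂ)⁻¹ * E (Matrix.single p.1 q.1 1) p.2 q.2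

/-- Separable bipartite states: finite convex combinations of product states. -/
def IsSeparable {A B : Type*} [Fintype A] [Fintype B] (X : Matrix (A × B) (A × B) ℂ) : Prop :=
  ∃ (n : ℕ) (p : Fin n → ℝ) (α : Fin n → Matrix A A ℂ) (β : Fin n → Matrix B B ℂ),
    (∀ k, 0 ≤ p k) ∧ ∑ k, p k = 1 ∧ (∀ k, IsState (α k)) ∧ (∀ k, IsState (β k)) ∧
      X = ∑ k, p k • (α k ⊗ₖ β k)

/-- Partial transpose on the second system. -/
def partialTranspose {A B : Type*} (X : Matrix (A × B) (A × B) ℂ) : Matrix (A × B) (A × B) ℂ :=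
  Matrix.of fun p q => X (p.1, q.2) (q.1, p.2)

/-- Separable channels `O_SEP`: channels with separable Choi state. -/
def sepChannels (A B : Type*) [Fintype A] [DecidableEq A] [Fintype B] : Set (OpMap A B) :=
  {L | IsChannel L ∧ IsSeparable (choiState L)}

/-- PPT channels `O_PPT`: channels whose Choi state has a positive partial transpose. -/
def pptChannels (A B : Type*) [Fintype A] [DecidableEq A] [Fintype B] : Set (OpMap A B) :=
  {L | IsChannel L ∧ (partialTranspose (choiState L)).PosSemidef}

/-- Replacement channels `O_R`: the maps `X ↦ Tr(X) σ` with `σ` a state. -/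
def replacementChannels (A B : Type*) [Fintype A] [Fintype B] : Set (OpMap A B) :=
  {L | ∃ σ : Matrix B B ℂ, IsState σ ∧ ∀ X : Matrix A A ℂ, L X = X.trace • σ}

end FreeChannels

section Codes

/-- Quantum superchannels: `Θ(L) = post ∘ (id ⊗ L) ∘ pre` with channels `pre` and `post` and a
finite-dimensional memory. -/
def IsSuperchannel {A B A' B' : Type*} [Fintype A] [Fintype B] [Fintype A'] [Fintype B']
    (Θ : OpMap A B → OpMap A' B') : Prop :=
  ∃ (r : ℕ) (pre : OpMap A' (Fin r × A)) (post : OpMap (Fin r × B) B'),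
    IsChannel pre ∧ IsChannel post ∧ ∀ L, Θ L = post ∘ₗ amplify (Fin r) L ∘ₗ pre

/-- The free superchannels: all superchannels that map `O` into `O'`. -/
def freeSuperchannels {A B A' B' : Type*} [Fintype A] [Fintype B] [Fintype A'] [Fintype B']
    (O : Set (OpMap A B)) (O' : Set (OpMap A' B')) : Set (OpMap A B → OpMap A' B') :=
  {Θ | IsSuperchannel Θ ∧ ∀ M ∈ O, Θ M ∈ O'}

/-- Codes preserving separability, `S_SEP`. -/
def sepCodes (A B A' B' : Type*) [Fintype A] [DecidableEq A] [Fintype B] [Fintype A']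
    [DecidableEq A'] [Fintype B'] : Set (OpMap A B → OpMap A' B') :=
  freeSuperchannels (sepChannels A B) (sepChannels A' B')

/-- Codes preserving positivity of the partial transpose, `S_PPT`. -/
def pptCodes (A B A' B' : Type*) [Fintype A] [DecidableEq A] [Fintype B] [Fintype A']
    [DecidableEq A'] [Fintype B'] : Set (OpMap A B → OpMap A' B') :=
  freeSuperchannels (pptChannels A B) (pptChannels A' B')

/-- No-signalling codes, `S_NS`: the superchannels that map replacement channels to replacement
channels. With `Π` the bipartite operation with inputs `A'`, `B` and outputs `A`, `B'` that
implements `Θ`, the condition says that the reduced output of `Π` on `B'` does not depend on its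
input at `A'`; the opposite no-signalling condition holds for every superchannel. -/
def nsCodes (A B A' B' : Type*) [Fintype A] [Fintype B] [Fintype A'] [Fintype B'] :
    Set (OpMap A B → OpMap A' B') :=
  freeSuperchannels (replacementChannels A B) (replacementChannels A' B')

/-- The identity channel `id_d`. -/
def idCh (d : ℕ) : OpMap (Fin d) (Fin d) := LinearMap.id

variable {A B : Type*} [Fintype A] [DecidableEq A] [Fintype B] [DecidableEq B]

/-- The values `log d` such that some code in `S d` turns `E` into `id_d` with error at most `ε`
(logarithms in base `b`). -/
def capacityRates (b : ℝ) (S : (d : ℕ) → Set (OpMap A B → OpMap (Fin d) (Fin d))) (ε : ℝ)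
    (E : OpMap A B) : Set ℝ :=
  {x | ∃ d : ℕ, 1 ≤ d ∧ x = Real.logb b d ∧
    ∃ Θ ∈ S d, 1 - ε ≤ channelFidelity (Θ E) (idCh d)}

/-- The one-shot quantum capacity `Q_S^ε(E)`. -/
def oneShotCapacity (b : ℝ) (S : (d : ℕ) → Set (OpMap A B → OpMap (Fin d) (Fin d))) (ε : ℝ)
    (E : OpMap A B) : ℝ := sSup (capacityRates b S ε E)

/-- The values `log d` such that some code in `S d` turns `id_d` into `E` with error at most `ε`
(logarithms in base `b`). -/
def costRates (b : ℝ) (S : (d : ℕ) → Set (OpMap (Fin d) (Fin d) → OpMap A B)) (ε : ℝ)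
    (E : OpMap A B) : Set ℝ :=
  {x | ∃ d : ℕ, 1 ≤ d ∧ x = Real.logb b d ∧
    ∃ Θ ∈ S d, 1 - ε ≤ channelFidelity (Θ (idCh d)) E}

/-- The one-shot simulation cost `C_S^ε(E)`. -/
def oneShotCost (b : ℝ) (S : (d : ℕ) → Set (OpMap (Fin d) (Fin d) → OpMap A B)) (ε : ℝ)
    (E : OpMap A B) : ℝ := sInf (costRates b S ε E)

end Codes

/-- The largest value `d²`, `d ≥ 1`, that is at most `x`. -/
def squareFloor (x : ℝ) : ℝ := sSup {y | ∃ d : ℕ, 1 ≤ d ∧ y = (d : ℝ) ^ 2 ∧ y ≤ x}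

/-- The smallest value `d²`, `d ≥ 1`, that is at least `x`. -/
def squareCeil (x : ℝ) : ℝ := sInf {y | ∃ d : ℕ, 1 ≤ d ∧ y = (d : ℝ) ^ 2 ∧ x ≤ y}

end

end QComm

open QComm

open Matrix Filter Topology

namespace QComm

set_option linter.unusedSectionVars false

/-! One scheme covers the three theories. Call the weight of the maximally entangled state in the
Choi state of a channel its overlap. Each theory supplies a number k, namely d for SEP and PPT and
d² for replacement channels, with two properties. Free channels on ℂ^d have overlap at most 1/k
(`overlap_le_of_ppt`, `overlap_replacement`), and id + (k-1)N = kZ with Z free and N free, or merely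
a channel in the no-signalling case (`exists_sep_decomposition`, `exists_depol_decomposition`).
These two facts match and give the values of the measures on id.

Capacity. Testing the output of a code against the maximally entangled state is a test of the input
channel: it accepts E with probability at least 1-ε and every free M with probability at most 1/k
(`IsSuperchannel.le_hypTest`). Conversely, tests form a compact convex set, so by Sion's theorem one
test serves all free M at once (`exists_uniform_tester`). The code runs this test and applies id on
acceptance, N on rejection. A free M then becomes p id + (1-p)N = pk Z + (1-pk)N with p ≤ 1/k, which
is free (`mix_mem`). In the no-signalling case N is not available as a free channel and p has to
equal 1/k. A test bounded on the affine hull is constant there, and mixing some id into the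
rejection branch tunes p (`exists_nsCode_iff_le_hypTest`).

Cost. A code applied to id + (k-1)N = kZ yields a decomposition of its output on id, which bounds
the robustness. Conversely, from E' + (k-1)M = kZ' one builds the code that measures the overlap of
its channel and applies E' or M (`exists_code_of_decomposition`); the same mixing identity shows
that it is free. The smoothed infimum is attained because the relevant Choi matrices form compact
sets and the fidelity is continuous (`exists_of_smoothRobustness_le`). The thresholds in d so
obtained are the floors and ceilings. -/

noncomputable section

/-! ### Choi matrices, complete positivity and the link product. -/

section Choi

variable {A B C R : Type*} [Fintype A] [Fintype B] [Fintype C] [Fintype R]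

/-- The unnormalized Choi matrix. -/
def choi [DecidableEq A] (L : OpMap A B) : Matrix (A × B) (A × B) ℂ :=
  Matrix.of fun p q => L (Matrix.single p.1 q.1 1) p.2 q.2

/-- The linear map with a given Choi matrix. -/
def ofChoi (J : Matrix (A × B) (A × B) ℂ) : OpMap A B where
  toFun X := Matrix.of fun b b' => ∑ a, ∑ a', X a a' * J (a, b) (a', b')
  map_add' X Y := by
    ext b b'
    simp [add_mul, Finset.sum_add_distrib]
  map_smul' c X := by
    ext b b'
    simp [Finset.mul_sum, mul_assoc]

/-- The link product of two bipartite matrices along the shared system `A`. -/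
def link (X : Matrix (R × A) (R × A) ℂ) (J : Matrix (A × B) (A × B) ℂ) :
    Matrix (R × B) (R × B) ℂ :=
  Matrix.of fun p q => ∑ a, ∑ a', X (p.1, a) (q.1, a') * J (a, p.2) (a', q.2)

lemma ofChoi_apply (J : Matrix (A × B) (A × B) ℂ) (X : Matrix A A ℂ) (b b' : B) :
    ofChoi J X b b' = ∑ a, ∑ a', X a a' * J (a, b) (a', b') := rfl

lemma apply_eq_sum_choi [DecidableEq A] (L : OpMap A B) (X : Matrix A A ℂ) (b b' : B) :
    L X b b' = ∑ a, ∑ a', X a a' * choi L (a, b) (a', b') := by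
  conv_lhs => rw [Matrix.matrix_eq_sum_single X]
  simp only [map_sum, Matrix.sum_apply]
  refine Finset.sum_congr rfl fun a _ => Finset.sum_congr rfl fun a' _ => ?_
  have : Matrix.single a a' (X a a') = X a a' • Matrix.single a a' (1 : ℂ) := by simp
  rw [this, map_smul]
  rfl

lemma ofChoi_choi [DecidableEq A] (L : OpMap A B) : ofChoi (choi L) = L := by
  refine LinearMap.ext fun X => ?_
  ext b b'
  rw [ofChoi_apply, ← apply_eq_sum_choi]

lemma choi_ofChoi [DecidableEq A] (J : Matrix (A × B) (A × B) ℂ) : choi (ofChoi J) = J := by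
  ext ⟨a, b⟩ ⟨a', b'⟩
  simp only [choi, Matrix.of_apply, ofChoi_apply, Matrix.single_apply]
  rw [Finset.sum_eq_single a, Finset.sum_eq_single a'] <;> simp +contextual [eq_comm]

lemma choi_add [DecidableEq A] (L M : OpMap A B) : choi (L + M) = choi L + choi M := rfl

lemma choi_real_smul [DecidableEq A] (c : ℝ) (L : OpMap A B) : choi (c • L) = c • choi L := rfl

lemma choiState_eq [DecidableEq A] (L : OpMap A B) :
    choiState L = (Fintype.card A : ℂ)⁻¹ • choi L := rfl

lemma amplify_apply [DecidableEq A] (L : OpMap A B) (X : Matrix (R × A) (R × A) ℂ) :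
    amplify R L X = link X (choi L) := by
  ext p q
  exact apply_eq_sum_choi L _ _ _

/-- This is the compression V† M V, where V stacks one copy of the identity of C for each index in
A. -/
lemma posSemidef_sum_fst {M : Matrix (A × C) (A × C) ℂ} (hM : M.PosSemidef) :
    (Matrix.of fun c c' => ∑ a, ∑ a', M (a, c) (a', c')).PosSemidef := by
  classical
  convert hM.conjTranspose_mul_mul_same ((1 : Matrix C C ℂ).submatrix Prod.snd id) using 1
  ext c c'
  simp only [Matrix.mul_apply, Matrix.conjTranspose_apply, Matrix.submatrix_apply,
    Matrix.of_apply, Fintype.sum_prod_type, Matrix.one_apply, id]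
  simp only [apply_ite star, star_one, star_zero, ite_mul, one_mul, zero_mul, mul_ite, mul_one,
    mul_zero, Finset.sum_ite_eq', Finset.mem_univ, if_true]
  exact Finset.sum_comm

/-- In X ⊗ J, keep the indices whose two A-labels agree and sum these labels out; both operations
preserve positivity. -/
lemma link_posSemidef {X : Matrix (R × A) (R × A) ℂ} {J : Matrix (A × B) (A × B) ℂ}
    (hX : X.PosSemidef) (hJ : J.PosSemidef) : (link X J).PosSemidef := by
  classical
  have h := (hX.kronecker hJ).submatrix (fun p : A × (R × B) => ((p.2.1, p.1), (p.1, p.2.2)))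
  convert posSemidef_sum_fst h using 1
  ext p q
  rfl

/-- The Choi matrix is the image of an unnormalized maximally entangled vector. Its reference copy
of A is labelled by `Fin (card A)`, since `IsCP` only speaks of references `Fin n`. -/
lemma IsCP.choi_posSemidef [DecidableEq A] {L : OpMap A B} (hL : IsCP L) :
    (choi L).PosSemidef := by
  let e := Fintype.equivFin A
  let w : Fin (Fintype.card A) × A → ℂ := fun p => if e p.2 = p.1 then 1 else 0
  have h := (hL _ _ (Matrix.posSemidef_vecMulVec_self_star w)).submatrix
    (fun p : A × B => (e p.1, p.2))
  convert h using 1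
  rw [amplify_apply]
  ext ⟨a, b⟩ ⟨a', b'⟩
  simp only [link, Matrix.submatrix_apply, Matrix.of_apply, Matrix.vecMulVec_apply, w,
    Pi.star_apply, e.injective.eq_iff, apply_ite star, star_one, star_zero, ite_mul, mul_ite,
    one_mul, zero_mul, mul_one, mul_zero]
  rw [Finset.sum_eq_single a, Finset.sum_eq_single a'] <;> simp +contextual

lemma IsCP.amplify_posSemidef {L : OpMap A B} (hL : IsCP L) {X : Matrix (R × A) (R × A) ℂ}
    (hX : X.PosSemidef) : (amplify R L X).PosSemidef := by
  classical
  rw [amplify_apply]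
  exact link_posSemidef hX hL.choi_posSemidef

lemma isCP_of_choi [DecidableEq A] {L : OpMap A B} (hL : (choi L).PosSemidef) : IsCP L := by
  intro n X hX
  rw [amplify_apply]
  exact link_posSemidef hX hL

lemma isCP_iff_choi [DecidableEq A] {L : OpMap A B} : IsCP L ↔ (choi L).PosSemidef :=
  ⟨IsCP.choi_posSemidef, isCP_of_choi⟩

lemma IsCP.map_posSemidef {L : OpMap A B} (hL : IsCP L) {X : Matrix A A ℂ}
    (hX : X.PosSemidef) : (L X).PosSemidef :=
  (hL.amplify_posSemidef (R := Unit) (hX.submatrix Prod.snd)).submatrix (fun b => ((), b))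

lemma IsCP.comp {L : OpMap B C} {M : OpMap A B} (hL : IsCP L) (hM : IsCP M) : IsCP (L ∘ₗ M) :=
  fun n _ hX => hL n _ (hM n _ hX)

lemma IsCP.add {L M : OpMap A B} (hL : IsCP L) (hM : IsCP M) : IsCP (L + M) := by
  classical
  rw [isCP_iff_choi] at *
  exact hL.add hM

lemma IsCP.real_smul {L : OpMap A B} (hL : IsCP L) {c : ℝ} (hc : 0 ≤ c) : IsCP (c • L) := by
  classical
  rw [isCP_iff_choi] at *
  exact Matrix.PosSemidef.smul hL hc

lemma isCP_id : IsCP (LinearMap.id : OpMap A A) := fun _ _ hX => hX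

lemma IsCP.amplify {L : OpMap A B} (hL : IsCP L) : IsCP (amplify R L) := by
  intro n X hX
  exact (hL.amplify_posSemidef (R := Fin n × R)
    (hX.submatrix (Equiv.prodAssoc (Fin n) R A))).submatrix (Equiv.prodAssoc (Fin n) R B).symm

lemma IsChannel.comp {L : OpMap B C} {M : OpMap A B} (hL : IsChannel L) (hM : IsChannel M) :
    IsChannel (L ∘ₗ M) :=
  ⟨hL.1.comp hM.1, fun X => (hL.2 _).trans (hM.2 X)⟩

lemma isChannel_id : IsChannel (LinearMap.id : OpMap A A) := ⟨isCP_id, fun _ => rfl⟩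

lemma trace_amplify {L : OpMap A B} (hL : ∀ X, (L X).trace = X.trace)
    (X : Matrix (R × A) (R × A) ℂ) : (amplify R L X).trace = X.trace := by
  simp only [Matrix.trace, Fintype.sum_prod_type, Matrix.diag]
  exact Finset.sum_congr rfl fun r _ => hL (Matrix.of fun a a' => X (r, a) (r, a'))

lemma IsChannel.amplify {L : OpMap A B} (hL : IsChannel L) : IsChannel (amplify R L) :=
  ⟨hL.1.amplify, trace_amplify hL.2⟩

lemma IsChannel.map_isState {L : OpMap A B} (hL : IsChannel L) {ρ : Matrix A A ℂ}
    (hρ : IsState ρ) : IsState (L ρ) :=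
  ⟨hL.1.map_posSemidef hρ.1, (hL.2 _).trans hρ.2⟩

lemma IsChannel.convex_comb {L M : OpMap A B} (hL : IsChannel L) (hM : IsChannel M) {s t : ℝ}
    (hs : 0 ≤ s) (ht : 0 ≤ t) (hst : s + t = 1) : IsChannel (s • L + t • M) := by
  refine ⟨(hL.1.real_smul hs).add (hM.1.real_smul ht), fun X => ?_⟩
  simp only [LinearMap.add_apply, LinearMap.smul_apply, Matrix.trace_add, Matrix.trace_smul,
    hL.2, hM.2, ← add_smul, hst, one_smul]

lemma amplify_add (L M : OpMap A B) (X : Matrix (R × A) (R × A) ℂ) :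
    amplify R (L + M) X = amplify R L X + amplify R M X := rfl

lemma amplify_real_smul (c : ℝ) (L : OpMap A B) (X : Matrix (R × A) (R × A) ℂ) :
    amplify R (c • L) X = c • amplify R L X := rfl

lemma amplify_id (X : Matrix (R × A) (R × A) ℂ) :
    amplify R (LinearMap.id : OpMap A A) X = X := rfl

lemma amplify_comp (L : OpMap B C) (M : OpMap A B) :
    amplify R (L ∘ₗ M) = amplify R L ∘ₗ amplify R M := rfl

lemma pureOp_posSemidef (v : A → ℂ) : (pureOp v).PosSemidef :=
  Matrix.posSemidef_vecMulVec_self_star v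

lemma pureOp_trace {v : A → ℂ} (hv : IsUnitVec v) : (pureOp v).trace = 1 := by
  have h : ∀ i, v i * star (v i) = ((‖v i‖ ^ 2 : ℝ) : ℂ) := fun i => by
    rw [Complex.ofReal_pow, ← Complex.mul_conj']
    rfl
  simp only [pureOp, Matrix.trace, Matrix.diag, Matrix.vecMulVec_apply, Pi.star_apply, h]
  rw [← Complex.ofReal_sum, hv, Complex.ofReal_one]

lemma pureOp_isState {v : A → ℂ} (hv : IsUnitVec v) : IsState (pureOp v) :=
  ⟨pureOp_posSemidef v, pureOp_trace hv⟩

end Choi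

/-! ### Fidelity of states and channels. -/

section Fidelity

open scoped Matrix.Norms.L2Operator

variable {A B : Type*} [Fintype A] [DecidableEq A] [Fintype B] [DecidableEq B]

lemma sqrt_mono {X Y : Matrix A A ℂ} (h : X ≤ Y) : CFC.sqrt X ≤ CFC.sqrt Y :=
  CFC.monotone_sqrt h

lemma continuousOn_matrix_sqrt :
    ContinuousOn (CFC.sqrt : Matrix A A ℂ → Matrix A A ℂ) {X | X.PosSemidef} := by
  have h := CFC.continuousOn_sqrt (A := Matrix A A ℂ)
  simpa only [Matrix.nonneg_iff_posSemidef] using h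

end Fidelity

section Fidelity

variable {A B : Type*} [Fintype A] [DecidableEq A] [Fintype B] [DecidableEq B]

lemma sqrt_posSemidef (X : Matrix A A ℂ) : (CFC.sqrt X).PosSemidef :=
  Matrix.nonneg_iff_posSemidef.mp (CFC.sqrt_nonneg X)

lemma traceNorm_sqrt_mul_sqrt {ρ : Matrix A A ℂ} (hρ : ρ.PosSemidef) (σ : Matrix A A ℂ) :
    traceNorm (CFC.sqrt ρ * CFC.sqrt σ) =
      (CFC.sqrt (CFC.sqrt σ * ρ * CFC.sqrt σ)).trace.re := by
  have h : CFC.sqrt ρ * CFC.sqrt ρ = ρ := CFC.sqrt_mul_sqrt_self ρ hρ.nonneg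
  rw [traceNorm, Matrix.conjTranspose_mul, (sqrt_posSemidef ρ).1.eq, (sqrt_posSemidef σ).1.eq,
    Matrix.mul_assoc, ← Matrix.mul_assoc (CFC.sqrt ρ), h, Matrix.mul_assoc]

lemma re_trace_mono {X Y : Matrix A A ℂ} (h : X ≤ Y) : X.trace.re ≤ Y.trace.re := by
  have := (Matrix.le_iff.mp h).trace_nonneg
  rw [Matrix.trace_sub, Complex.nonneg_iff, Complex.sub_re] at this
  linarith [this.1]

lemma sqrt_smul_mul_self {σ : Matrix A A ℂ} (hσ : σ.PosSemidef) {p : ℝ} (hp : 0 ≤ p) :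
    CFC.sqrt (p • (σ * σ)) = Real.sqrt p • σ := by
  refine CFC.sqrt_unique ?_ ?_
  · rw [smul_mul_smul_comm, Real.mul_self_sqrt hp]
  · exact Matrix.nonneg_iff_posSemidef.mpr (hσ.smul (Real.sqrt_nonneg p))

/-- Sandwiching pσ ≤ ρ between roots of σ gives pσ² ≤ √σ ρ √σ. The square root is operator monotone,
so taking traces of roots gives √p ≤ ‖√ρ √σ‖₁. -/
lemma le_fidelity {ρ σ : Matrix A A ℂ} (hρ : ρ.PosSemidef) (hσ : IsState σ) {p : ℝ} (hp : 0 ≤ p)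
    (h : p • σ ≤ ρ) : p ≤ fidelity ρ σ := by
  have hs : CFC.sqrt σ * CFC.sqrt σ = σ := CFC.sqrt_mul_sqrt_self σ hσ.1.nonneg
  have h1 : p • (σ * σ) ≤ CFC.sqrt σ * ρ * CFC.sqrt σ := by
    have h2 := (Matrix.le_iff.mp h).conjTranspose_mul_mul_same (CFC.sqrt σ)
    rw [(sqrt_posSemidef σ).1.eq, Matrix.mul_sub, Matrix.sub_mul] at h2
    rw [Matrix.le_iff]
    convert h2 using 2
    rw [Matrix.mul_smul, Matrix.smul_mul]
    congr 1
    calc σ * σ = (CFC.sqrt σ * CFC.sqrt σ) * (CFC.sqrt σ * CFC.sqrt σ) := by rw [hs]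
      _ = CFC.sqrt σ * (CFC.sqrt σ * CFC.sqrt σ) * CFC.sqrt σ := by simp only [Matrix.mul_assoc]
      _ = CFC.sqrt σ * σ * CFC.sqrt σ := by rw [hs]
  have h3 := re_trace_mono (sqrt_mono h1)
  rw [sqrt_smul_mul_self hσ.1 hp, Matrix.trace_smul, hσ.2, ← traceNorm_sqrt_mul_sqrt hρ] at h3
  have h4 : Real.sqrt p ≤ traceNorm (CFC.sqrt ρ * CFC.sqrt σ) := by simpa using h3
  calc p = Real.sqrt p ^ 2 := (Real.sq_sqrt hp).symm
    _ ≤ _ := by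
      unfold fidelity
      gcongr

lemma pureOp_mul_mul_pureOp (v : A → ℂ) (X : Matrix A A ℂ) :
    pureOp v * X * pureOp v = (pureOp v * X).trace • pureOp v := by
  ext i j
  simp only [pureOp, Matrix.mul_apply, Matrix.smul_apply, Matrix.trace, Matrix.diag,
    Matrix.vecMulVec_apply, smul_eq_mul, Finset.sum_mul]
  refine Finset.sum_congr rfl fun _ _ => Finset.sum_congr rfl fun _ _ => by ring

lemma pureOp_mul_self {v : A → ℂ} (hv : IsUnitVec v) : pureOp v * pureOp v = pureOp v := by
  have h := pureOp_mul_mul_pureOp v 1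
  rwa [Matrix.mul_one, pureOp_trace hv, one_smul] at h

lemma trace_mul_nonneg {X Y : Matrix A A ℂ} (hX : X.PosSemidef) (hY : Y.PosSemidef) :
    0 ≤ (X * Y).trace := by
  have hs : CFC.sqrt X * CFC.sqrt X = X := CFC.sqrt_mul_sqrt_self X hX.nonneg
  have h := hY.conjTranspose_mul_mul_same (CFC.sqrt X)
  rw [(sqrt_posSemidef X).1.eq] at h
  have h2 := h.trace_nonneg
  rwa [Matrix.mul_assoc, Matrix.trace_mul_comm, Matrix.mul_assoc, hs, Matrix.trace_mul_comm] at h2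

/-- A rank-one projection is its own root, and sandwiching ρ with it gives a multiple of it. Against
a pure state, a fidelity bound is therefore a linear condition on ρ. -/
lemma fidelity_pureOp {ρ : Matrix A A ℂ} (hρ : ρ.PosSemidef) {v : A → ℂ} (hv : IsUnitVec v) :
    fidelity ρ (pureOp v) = (pureOp v * ρ).trace.re := by
  have hs : CFC.sqrt (pureOp v) = pureOp v :=
    CFC.sqrt_unique (pureOp_mul_self hv) (pureOp_posSemidef v).nonneg
  have h0 := Complex.nonneg_iff.mp (trace_mul_nonneg (pureOp_posSemidef v) hρ)
  have ht : (pureOp v * ρ).trace = (((pureOp v * ρ).trace.re : ℝ) : ℂ) :=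
    Complex.ext rfl (by simpa using h0.2.symm)
  have h1 : CFC.sqrt (pureOp v * ρ * pureOp v) =
      Real.sqrt (pureOp v * ρ).trace.re • pureOp v := by
    rw [← sqrt_smul_mul_self (pureOp_posSemidef v) h0.1, pureOp_mul_self hv,
      pureOp_mul_mul_pureOp, ht]
    congr 1
  rw [fidelity, traceNorm_sqrt_mul_sqrt hρ, hs, h1, Matrix.trace_smul, pureOp_trace hv]
  simp [Real.sq_sqrt h0.1]

lemma fidelity_nonneg (ρ σ : Matrix A A ℂ) : 0 ≤ fidelity ρ σ := sq_nonneg _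

lemma continuousOn_fidelity (σ : Matrix A A ℂ) :
    ContinuousOn (fun ρ => fidelity ρ σ) {ρ | ρ.PosSemidef} := by
  have h : ContinuousOn (fun ρ => (CFC.sqrt (CFC.sqrt σ * ρ * CFC.sqrt σ)).trace.re ^ 2)
      {ρ : Matrix A A ℂ | ρ.PosSemidef} := by
    refine ContinuousOn.pow (Complex.continuous_re.comp_continuousOn ?_) 2
    refine (continuous_id.matrix_trace).comp_continuousOn ?_
    refine continuousOn_matrix_sqrt.comp (by fun_prop) ?_
    intro ρ hρ
    have := Matrix.PosSemidef.conjTranspose_mul_mul_same hρ (CFC.sqrt σ)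
    rwa [(sqrt_posSemidef σ).1.eq] at this
  refine h.congr fun ρ hρ => ?_
  simp only [fidelity]
  rw [traceNorm_sqrt_mul_sqrt hρ]

lemma channelFidelity_le (L M : OpMap A B) {ρ : Matrix (A × A) (A × A) ℂ} (hρ : IsState ρ) :
    channelFidelity L M ≤ fidelity (amplify A L ρ) (amplify A M ρ) :=
  ciInf_le ⟨0, by rintro _ ⟨ρ, rfl⟩; exact fidelity_nonneg _ _⟩ (⟨ρ, hρ⟩ : {ρ // IsState ρ})

lemma exists_isUnitVec [Nonempty A] : ∃ v : A → ℂ, IsUnitVec v := by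
  refine ⟨Pi.single (Classical.arbitrary A) 1, ?_⟩
  unfold IsUnitVec
  rw [Finset.sum_eq_single (Classical.arbitrary A)] <;> simp +contextual

lemma le_channelFidelity [Nonempty A] {L M : OpMap A B} {c : ℝ}
    (h : ∀ ρ : Matrix (A × A) (A × A) ℂ, IsState ρ →
      c ≤ fidelity (amplify A L ρ) (amplify A M ρ)) : c ≤ channelFidelity L M := by
  obtain ⟨v, hv⟩ := exists_isUnitVec (A := A × A)
  have : Nonempty {ρ : Matrix (A × A) (A × A) ℂ // IsState ρ} := ⟨⟨_, pureOp_isState hv⟩⟩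
  exact le_ciInf fun ρ => h ρ.1 ρ.2

/-- A channel of the form `p M + (1 - p) N` has fidelity at least `p` with `M`. -/
lemma le_channelFidelity_mix [Nonempty A] {M N : OpMap A B} (hM : IsChannel M)
    (hN : IsChannel N) {p q : ℝ} (hp : 0 ≤ p) (hq : 0 ≤ q) :
    p ≤ channelFidelity (p • M + q • N) M := by
  refine le_channelFidelity fun ρ hρ => ?_
  have hMρ := hM.amplify (R := A) |>.map_isState hρ
  have hNρ := hN.amplify (R := A) |>.map_isState hρ
  rw [amplify_add, amplify_real_smul, amplify_real_smul]
  refine le_fidelity ((hMρ.1.smul hp).add (hNρ.1.smul hq)) hMρ hp ?_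
  rw [Matrix.le_iff, add_sub_cancel_left]
  exact hNρ.1.smul hq

lemma one_le_channelFidelity_self [Nonempty A] {M : OpMap A B} (hM : IsChannel M) :
    1 ≤ channelFidelity M M := by
  simpa using le_channelFidelity_mix hM hM zero_le_one le_rfl

end Fidelity

/-! ### Compactness of sets of positive operators. -/

section Compactness

variable {A B : Type*} [Fintype A] [DecidableEq A] [Fintype B] [DecidableEq B]

lemma PosSemidef.re_diag_nonneg {X : Matrix A A ℂ} (hX : X.PosSemidef) (i : A) :
    0 ≤ (X i i).re := (Complex.nonneg_iff.mp hX.diag_nonneg).1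

lemma PosSemidef.re_diag_le_trace {X : Matrix A A ℂ} (hX : X.PosSemidef) (i : A) :
    (X i i).re ≤ X.trace.re := by
  rw [Matrix.trace, Complex.re_sum]
  exact Finset.single_le_sum (f := fun i => (X i i).re)
    (fun j _ => PosSemidef.re_diag_nonneg hX j) (Finset.mem_univ i)

/-- With X = Y†Y, the inequality 2uv ≤ u² + v² in each summand bounds an entry by the mean of two
diagonal entries. -/
lemma PosSemidef.norm_apply_le_trace {X : Matrix A A ℂ} (hX : X.PosSemidef) (i j : A) :
    ‖X i j‖ ≤ X.trace.re := by
  set Y := CFC.sqrt X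
  have hY : Yᴴ * Y = X := by
    rw [(sqrt_posSemidef X).1.eq]
    exact CFC.sqrt_mul_sqrt_self X hX.nonneg
  have hd : ∀ i, (X i i).re = ∑ k, ‖Y k i‖ ^ 2 := fun i => by
    rw [← hY, Matrix.mul_apply, Complex.re_sum]
    refine Finset.sum_congr rfl fun k _ => ?_
    rw [Matrix.conjTranspose_apply, Complex.star_def, Complex.conj_mul']
    norm_cast
  have h1 : ‖X i j‖ ≤ ∑ k, ‖Y k i‖ * ‖Y k j‖ := by
    conv_lhs => rw [← hY, Matrix.mul_apply]
    refine (norm_sum_le _ _).trans (Finset.sum_le_sum fun k _ => ?_)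
    rw [Matrix.conjTranspose_apply, norm_mul, norm_star]
  have h2 : ∑ k, ‖Y k i‖ * ‖Y k j‖ ≤ ∑ k, (‖Y k i‖ ^ 2 + ‖Y k j‖ ^ 2) / 2 :=
    Finset.sum_le_sum fun k _ => by nlinarith [sq_nonneg (‖Y k i‖ - ‖Y k j‖)]
  rw [← Finset.sum_div, Finset.sum_add_distrib, ← hd, ← hd] at h2
  linarith [PosSemidef.re_diag_le_trace hX i, PosSemidef.re_diag_le_trace hX j]

lemma isClosed_posSemidef : IsClosed {X : Matrix A A ℂ | X.PosSemidef} := by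
  have : {X : Matrix A A ℂ | X.PosSemidef} =
      {X | Xᴴ = X} ∩ ⋂ x : A → ℂ, {X | 0 ≤ star x ⬝ᵥ (X *ᵥ x)} := by
    ext X
    simp [Matrix.posSemidef_iff_dotProduct_mulVec, Matrix.IsHermitian]
  rw [this]
  refine IsClosed.inter (isClosed_eq (by fun_prop) continuous_id) (isClosed_iInter fun x => ?_)
  exact isClosed_le continuous_const (by fun_prop)

lemma isCompact_posSemidef_trace_le (c : ℝ) :
    IsCompact {X : Matrix A A ℂ | X.PosSemidef ∧ X.trace.re ≤ c} := by
  have hK : IsCompact (Set.pi Set.univ fun _ : A => Set.pi Set.univ fun _ : A =>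
      Metric.closedBall (0 : ℂ) c) :=
    isCompact_univ_pi fun _ => isCompact_univ_pi fun _ => isCompact_closedBall _ _
  refine IsCompact.of_isClosed_subset hK ?_ ?_
  · exact isClosed_posSemidef.inter
      (isClosed_le (Complex.continuous_re.comp (by fun_prop)) continuous_const)
  · intro X hX i _ j _
    rw [mem_closedBall_zero_iff]
    exact (PosSemidef.norm_apply_le_trace hX.1 i j).trans hX.2

lemma isCompact_states : IsCompact {ρ : Matrix A A ℂ | IsState ρ} := by
  refine (isCompact_posSemidef_trace_le (A := A) 1).of_isClosed_subset ?_ ?_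
  · exact isClosed_posSemidef.inter (isClosed_eq (by fun_prop) continuous_const)
  · intro ρ hρ
    exact ⟨hρ.1, by simp [hρ.2]⟩

lemma isState_convex {ρ σ : Matrix A A ℂ} (hρ : IsState ρ) (hσ : IsState σ) {s t : ℝ}
    (hs : 0 ≤ s) (ht : 0 ≤ t) (hst : s + t = 1) : IsState (s • ρ + t • σ) := by
  refine ⟨(hρ.1.smul hs).add (hσ.1.smul ht), ?_⟩
  rw [Matrix.trace_add, Matrix.trace_smul, Matrix.trace_smul, hρ.2, hσ.2, ← add_smul, hst, one_smul]

end Compactness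

/-! ### Testers: tests of channels as operators paired with the Choi matrix. -/

section Testers

variable {A B R : Type*} [Fintype A] [DecidableEq A] [Fintype B] [DecidableEq B]
  [Fintype R] [DecidableEq R]

/-- Bounded operators `0 ≤ T ≤ σ ⊗ 1`, `σ` a state. Up to a transposition of the input, they
describe the tests that consist of preparing a state of a reference and the input and measuring
an effect on the reference and the output. -/
def IsTester (T : Matrix (A × B) (A × B) ℂ) : Prop :=
  ∃ σ : Matrix A A ℂ, IsState σ ∧ T.PosSemidef ∧ (σ ⊗ₖ (1 : Matrix B B ℂ) - T).PosSemidef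

/-- Testers that accept the Choi matrix `J` with probability at least `δ`. -/
def testers (J : Matrix (A × B) (A × B) ℂ) (δ : ℝ) : Set (Matrix (A × B) (A × B) ℂ) :=
  {T | IsTester T ∧ δ ≤ (T * J).trace.re}

lemma kronecker_one_convex (ρ σ : Matrix A A ℂ) (s t : ℝ) :
    (s • ρ + t • σ) ⊗ₖ (1 : Matrix B B ℂ) = s • (ρ ⊗ₖ (1 : Matrix B B ℂ)) + t • (σ ⊗ₖ 1) := by
  rw [Matrix.add_kronecker, Matrix.smul_kronecker, Matrix.smul_kronecker]

lemma re_trace_mul_convex (T U J : Matrix A A ℂ) (s t : ℝ) :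
    ((s • T + t • U) * J).trace.re = s * (T * J).trace.re + t * (U * J).trace.re := by
  simp [Matrix.add_mul, Matrix.trace_add, Matrix.trace_smul]

lemma re_trace_mul_convex' (T U J : Matrix A A ℂ) (s t : ℝ) :
    (J * (s • T + t • U)).trace.re = s * (J * T).trace.re + t * (J * U).trace.re := by
  simp [Matrix.mul_add, Matrix.trace_add, Matrix.trace_smul]

lemma convex_testers (J : Matrix (A × B) (A × B) ℂ) (δ : ℝ) : Convex ℝ (testers J δ) := by
  rintro T ⟨⟨σ, hσ, hT, hT'⟩, hTJ⟩ U ⟨⟨τ, hτ, hU, hU'⟩, hUJ⟩ s t hs ht hst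
  refine ⟨⟨s • σ + t • τ, isState_convex hσ hτ hs ht hst, (hT.smul hs).add (hU.smul ht), ?_⟩, ?_⟩
  · rw [kronecker_one_convex]
    convert (hT'.smul hs).add (hU'.smul ht) using 1
    module
  · rw [re_trace_mul_convex]
    calc δ = s * δ + t * δ := by rw [← add_mul, hst, one_mul]
      _ ≤ _ := by gcongr

/-- The set is the projection of a closed set of pairs (σ, T), bounded because Tr T ≤ Tr(σ ⊗ 1) =
|B|. -/
lemma isCompact_testers (J : Matrix (A × B) (A × B) ℂ) (δ : ℝ) : IsCompact (testers J δ) := by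
  have hK := (isCompact_states (A := A)).prod
    (isCompact_posSemidef_trace_le (A := A × B) (Fintype.card B))
  have hC : IsCompact {x : Matrix A A ℂ × Matrix (A × B) (A × B) ℂ |
      (IsState x.1 ∧ x.2.PosSemidef ∧ (x.1 ⊗ₖ (1 : Matrix B B ℂ) - x.2).PosSemidef) ∧
        δ ≤ (x.2 * J).trace.re} := by
    refine hK.of_isClosed_subset ?_ ?_
    · refine IsClosed.inter (IsClosed.inter ?_ (IsClosed.inter ?_ ?_)) ?_
      · exact isCompact_states.isClosed.preimage continuous_fst
      · exact isClosed_posSemidef.preimage continuous_snd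
      · refine isClosed_posSemidef.preimage (Continuous.sub ?_ continuous_snd)
        refine continuous_matrix fun p q => ?_
        simp only [Matrix.kroneckerMap_apply]
        fun_prop
      · exact isClosed_le continuous_const (Complex.continuous_re.comp (by fun_prop))
    · rintro ⟨σ, T⟩ ⟨⟨hσ, hT, hT'⟩, -⟩
      refine ⟨hσ, hT, ?_⟩
      have h := (Complex.nonneg_iff.mp hT'.trace_nonneg).1
      rw [Matrix.trace_sub, Matrix.trace_kronecker, hσ.2, Matrix.trace_one] at h
      simpa using h
  convert hC.image continuous_snd using 1
  ext T
  constructor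
  · rintro ⟨⟨σ, h⟩, hJ⟩
    exact ⟨(σ, T), ⟨h, hJ⟩, rfl⟩
  · rintro ⟨⟨σ, T⟩, ⟨h, hJ⟩, rfl⟩
    exact ⟨⟨σ, h⟩, hJ⟩

/-- The transpose of a state of `R × A`, with the two systems interchanged. -/
def swapTranspose (ρ : Matrix (R × A) (R × A) ℂ) : Matrix (A × R) (A × R) ℂ :=
  ρᵀ.submatrix Prod.swap Prod.swap

lemma trace_mul_amplify (Q : Matrix (R × B) (R × B) ℂ) (L : OpMap A B)
    (ρ : Matrix (R × A) (R × A) ℂ) :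
    (Q * amplify R L ρ).trace = (link (swapTranspose ρ) Q * choi L).trace := by
  rw [amplify_apply]
  generalize choi L = J
  have h := Fintype.sum_equiv (ι := R × B × R × B × A × A) (κ := A × B × A × B × R × R)
    { toFun := fun x => (x.2.2.2.2.2, x.2.1, x.2.2.2.2.1, x.2.2.2.1, x.1, x.2.2.1)
      invFun := fun y => (y.2.2.2.2.1, y.2.1, y.2.2.2.2.2, y.2.2.2.1, y.2.2.1, y.1)
      left_inv := fun _ => rfl
      right_inv := fun _ => rfl }
    (fun ⟨r, b, r', b', a, a'⟩ => Q (r, b) (r', b') * (ρ (r', a) (r, a') * J (a, b') (a', b)))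
    (fun ⟨a', b, a, b', r, r'⟩ => ρ (r', a) (r, a') * Q (r, b) (r', b') * J (a, b') (a', b))
    (fun ⟨r, b, r', b', a, a'⟩ => by simp only [Equiv.coe_fn_mk]; ring)
  simp only [Fintype.sum_prod_type] at h
  simp only [Matrix.trace, Matrix.diag, Matrix.mul_apply, link, Matrix.of_apply, swapTranspose,
    Matrix.submatrix_apply, Matrix.transpose_apply, Fintype.sum_prod_type, Prod.swap_prod_mk,
    Finset.sum_mul, Finset.mul_sum]
  exact h

lemma link_one (Y : Matrix (A × R) (A × R) ℂ) :
    link Y (1 : Matrix (R × B) (R × B) ℂ) =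
      (∑ r, Y.submatrix (fun a => (a, r)) (fun a => (a, r))) ⊗ₖ (1 : Matrix B B ℂ) := by
  ext ⟨a, b⟩ ⟨a', b'⟩
  simp only [link, Matrix.of_apply, Matrix.one_apply, Prod.mk.injEq, Matrix.kroneckerMap_apply,
    Matrix.sum_apply, Matrix.submatrix_apply, Finset.sum_mul]
  refine Finset.sum_congr rfl fun r _ => ?_
  rw [Finset.sum_eq_single r] <;> simp +contextual [eq_comm]

lemma link_sub (Y : Matrix (R × A) (R × A) ℂ) (P Q : Matrix (A × B) (A × B) ℂ) :
    link Y (P - Q) = link Y P - link Y Q := by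
  ext p q
  simp [link, mul_sub, Finset.sum_sub_distrib]

/-- A test with an arbitrary reference system and an arbitrary state amounts to a tester. -/
lemma exists_tester {ρ : Matrix (R × A) (R × A) ℂ} (hρ : IsState ρ)
    {Q : Matrix (R × B) (R × B) ℂ} (hQ : Q.PosSemidef) (hQ' : (1 - Q).PosSemidef) :
    ∃ T : Matrix (A × B) (A × B) ℂ, IsTester T ∧
      ∀ L : OpMap A B, (Q * amplify R L ρ).trace = (T * choi L).trace := by
  have hY : (swapTranspose ρ).PosSemidef := hρ.1.transpose.submatrix _
  -- The state that dominates the tester is the transposed marginal of ρ on the input.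
  refine ⟨link (swapTranspose ρ) Q,
    ⟨∑ r, (swapTranspose ρ).submatrix (fun a => (a, r)) (fun a => (a, r)), ⟨?_, ?_⟩,
      link_posSemidef hY hQ, ?_⟩, fun L => trace_mul_amplify Q L ρ⟩
  · exact Matrix.posSemidef_sum _ fun r _ => hY.submatrix _
  · rw [← hρ.2, Matrix.trace_sum]
    simp [Matrix.trace, Fintype.sum_prod_type, swapTranspose]
  · rw [← link_one, ← link_sub]
    exact link_posSemidef hY hQ'

/-- N T N is (√T N)†(√T N), so its vanishing forces √T N = 0. -/
lemma mul_eq_zero_of_conj_eq_zero {T N : Matrix A A ℂ} (hT : T.PosSemidef) (hN : N.IsHermitian)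
    (h : N * T * N = 0) : T * N = 0 := by
  have hs : CFC.sqrt T * CFC.sqrt T = T := CFC.sqrt_mul_sqrt_self T hT.nonneg
  have h1 : (CFC.sqrt T * N)ᴴ * (CFC.sqrt T * N) = 0 := by
    rw [Matrix.conjTranspose_mul, hN.eq, (sqrt_posSemidef T).1.eq, ← h]
    simp only [Matrix.mul_assoc]
    rw [← Matrix.mul_assoc (CFC.sqrt T) (CFC.sqrt T), hs]
  rw [Matrix.conjTranspose_mul_self_eq_zero] at h1
  rw [← hs, Matrix.mul_assoc, h1, Matrix.mul_zero]

lemma continuousOn_spectrum (σ : Matrix A A ℂ) (f : ℝ → ℝ) : ContinuousOn f (spectrum ℝ σ) :=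
  (Matrix.finite_real_spectrum (A := σ)).continuousOn f

lemma cfc_mul_cfc (σ : Matrix A A ℂ) (f g : ℝ → ℝ) :
    cfc f σ * cfc g σ = cfc (fun x => f x * g x) σ :=
  (cfc_mul f g σ (continuousOn_spectrum σ f) (continuousOn_spectrum σ g)).symm

/-- With the amplitudes of the pure state given by S, the tester of an effect P is P sandwiched by S
⊗ 1. To realize a given T, take S = √σ and undo the sandwich. -/
lemma link_swapTranspose_pureOp {S : Matrix A A ℂ} (hS : S.IsHermitian)
    (P : Matrix (A × B) (A × B) ℂ) :
    link (swapTranspose (pureOp fun p : A × A => S p.1 p.2)) P =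
      (S ⊗ₖ (1 : Matrix B B ℂ)) * P * (S ⊗ₖ 1) := by
  ext ⟨a, b⟩ ⟨a', b'⟩
  have hS' : ∀ i j, star (S i j) = S j i := fun i j => by
    rw [← Matrix.conjTranspose_apply, hS.eq]
  simp only [link, swapTranspose, pureOp, Matrix.of_apply, Matrix.submatrix_apply,
    Matrix.transpose_apply, Matrix.vecMulVec_apply, Prod.swap_prod_mk, Pi.star_apply, hS',
    Matrix.mul_apply, Matrix.kroneckerMap_apply, Fintype.sum_prod_type, Matrix.one_apply,
    mul_ite, ite_mul, mul_one, mul_zero, zero_mul, Finset.sum_ite_eq, Finset.sum_ite_eq',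
    Finset.mem_univ, if_true, Finset.sum_mul]
  rw [Finset.sum_comm]
  exact Finset.sum_congr rfl fun _ _ => Finset.sum_congr rfl fun _ _ => by ring

/-- A tester is implemented by a pure state of a reference copy of the input with the input. -/
lemma IsTester.exists_test {T : Matrix (A × B) (A × B) ℂ} (hT : IsTester T) :
    ∃ (v : A × A → ℂ) (P : Matrix (A × B) (A × B) ℂ), IsUnitVec v ∧ P.PosSemidef ∧
      (1 - P).PosSemidef ∧
      ∀ L : OpMap A B, (P * amplify A L (pureOp v)).trace = (T * choi L).trace := by
  obtain ⟨σ, hσ, hT, hT'⟩ := hT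
  have hsa : IsSelfAdjoint σ := hσ.1.1
  -- S is the root of σ, G its pseudoinverse (the inverse of 0 is 0), and N the projection onto the
  -- kernel of σ; σ may be singular.
  set S := cfc Real.sqrt σ with hSdef
  set G := cfc (fun x => (Real.sqrt x)⁻¹) σ with hGdef
  set N := cfc (fun x => if x = 0 then (1 : ℝ) else 0) σ with hNdef
  have hspec : ∀ x ∈ spectrum ℝ σ, 0 ≤ x := fun x hx => spectrum_nonneg_of_nonneg hσ.1.nonneg hx
  have hSherm : S.IsHermitian := cfc_predicate Real.sqrt σ
  have hGherm : G.IsHermitian := cfc_predicate (fun x : ℝ => (Real.sqrt x)⁻¹) σ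
  have hNherm : N.IsHermitian := cfc_predicate (fun x : ℝ => if x = 0 then (1 : ℝ) else 0) σ
  have hSS : S * S = σ := by
    rw [hSdef, cfc_mul_cfc]
    conv_rhs => rw [← cfc_id ℝ σ hsa]
    exact cfc_congr fun x hx => Real.mul_self_sqrt (hspec x hx)
  have h1 : cfc (fun _ : ℝ => (1 : ℝ)) σ = 1 := cfc_const_one ℝ σ
  have hGS : G * S = 1 - N := by
    rw [hGdef, hSdef, hNdef, cfc_mul_cfc, ← h1, ← cfc_sub _ _ _ (continuousOn_spectrum _ _)
      (continuousOn_spectrum _ _)]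
    refine cfc_congr fun x hx => ?_
    by_cases hx0 : x = 0
    · simp [hx0]
    · have : Real.sqrt x ≠ 0 := (Real.sqrt_pos.mpr ((hspec x hx).lt_of_ne' hx0)).ne'
      simp [hx0, this]
  have hSG : S * G = 1 - N := by
    rw [← hGS, hGdef, hSdef, cfc_mul_cfc, cfc_mul_cfc]
    simp only [mul_comm]
  have hNN : N * N = N := by
    rw [hNdef, cfc_mul_cfc]
    refine cfc_congr fun x _ => ?_
    simp
  have hNσ : σ * N = 0 := by
    rw [hNdef]
    nth_rw 1 [← cfc_id ℝ σ hsa]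
    rw [cfc_mul_cfc, ← cfc_const_zero ℝ σ]
    refine cfc_congr fun x _ => ?_
    by_cases hx0 : x = 0 <;> simp [hx0]
  have hkh : ∀ {X : Matrix A A ℂ}, X.IsHermitian → (X ⊗ₖ (1 : Matrix B B ℂ))ᴴ = X ⊗ₖ 1 := by
    intro X hX
    rw [Matrix.conjTranspose_kronecker, hX.eq, Matrix.conjTranspose_one]
  have hkm : ∀ X Y : Matrix A A ℂ, (X ⊗ₖ (1 : Matrix B B ℂ)) * (Y ⊗ₖ 1) = (X * Y) ⊗ₖ 1 := by
    intro X Y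
    rw [← Matrix.mul_kronecker_mul, Matrix.mul_one]
  have hks : (1 - N) ⊗ₖ (1 : Matrix B B ℂ) = 1 - N ⊗ₖ (1 : Matrix B B ℂ) := by
    rw [eq_sub_iff_add_eq, ← Matrix.add_kronecker, sub_add_cancel, Matrix.one_kronecker_one]
  -- T ≤ σ ⊗ 1 forces T to vanish on the kernel of σ ⊗ 1, so nothing is lost by passing through the
  -- pseudoinverse.
  have hTN : T * (N ⊗ₖ (1 : Matrix B B ℂ)) = 0 := by
    refine mul_eq_zero_of_conj_eq_zero hT (hkh hNherm) ?_
    have h2 := hT.conjTranspose_mul_mul_same (N ⊗ₖ (1 : Matrix B B ℂ))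
    have h3 := hT'.conjTranspose_mul_mul_same (N ⊗ₖ (1 : Matrix B B ℂ))
    rw [hkh hNherm] at h2 h3
    rw [Matrix.mul_sub, Matrix.sub_mul, Matrix.mul_assoc _ (σ ⊗ₖ 1), hkm, hNσ,
      Matrix.zero_kronecker, Matrix.mul_zero, zero_sub] at h3
    refine le_antisymm ?_ h2.nonneg
    rw [Matrix.le_iff, zero_sub]
    exact h3
  have hNT : (N ⊗ₖ (1 : Matrix B B ℂ)) * T = 0 := by
    have := congrArg Matrix.conjTranspose hTN
    rwa [Matrix.conjTranspose_mul, hkh hNherm, hT.1.eq, Matrix.conjTranspose_zero] at this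
  have hlink : link (swapTranspose (pureOp fun p : A × A => S p.1 p.2))
      ((G ⊗ₖ (1 : Matrix B B ℂ)) * T * (G ⊗ₖ 1)) = T := by
    rw [link_swapTranspose_pureOp hSherm]
    calc S ⊗ₖ (1 : Matrix B B ℂ) * (G ⊗ₖ 1 * T * G ⊗ₖ 1) * S ⊗ₖ 1
        = (S ⊗ₖ (1 : Matrix B B ℂ) * G ⊗ₖ 1) * T * (G ⊗ₖ 1 * S ⊗ₖ 1) := by
          simp only [Matrix.mul_assoc]
      _ = T := by
          rw [hkm, hkm, hSG, hGS, hks, Matrix.sub_mul, Matrix.one_mul, hNT, sub_zero,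
            Matrix.mul_sub, Matrix.mul_one, hTN, sub_zero]
  refine ⟨fun p => S p.1 p.2, (G ⊗ₖ 1) * T * (G ⊗ₖ 1), ?_, ?_, ?_, fun L => ?_⟩
  · have h2 : (S * S).trace = ((∑ p : A × A, ‖S p.1 p.2‖ ^ 2 : ℝ) : ℂ) := by
      nth_rw 1 [← hSherm.eq]
      simp only [Matrix.trace, Matrix.diag, Matrix.mul_apply, Matrix.conjTranspose_apply,
        Fintype.sum_prod_type, Complex.star_def, Complex.conj_mul']
      rw [Finset.sum_comm]
      norm_cast
    rw [hSS, hσ.2] at h2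
    exact_mod_cast h2.symm
  · have := hT.conjTranspose_mul_mul_same (G ⊗ₖ (1 : Matrix B B ℂ))
    rwa [hkh hGherm] at this
  -- 1 - P is the sum of (G ⊗ 1)(σ ⊗ 1 - T)(G ⊗ 1) and N ⊗ 1.
  · have h2 := hT'.conjTranspose_mul_mul_same (G ⊗ₖ (1 : Matrix B B ℂ))
    rw [hkh hGherm, Matrix.mul_sub, Matrix.sub_mul, hkm, hkm, ← hSS, ← Matrix.mul_assoc, hGS,
      Matrix.mul_assoc, hSG, Matrix.mul_sub, Matrix.sub_mul, Matrix.sub_mul, hNN] at h2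
    simp only [Matrix.mul_one, Matrix.one_mul, sub_self, sub_zero] at h2
    have h3 : (N ⊗ₖ (1 : Matrix B B ℂ)).PosSemidef := by
      have h4 := (Matrix.PosSemidef.one (n := A × B) (R := ℂ)).conjTranspose_mul_mul_same
        (N ⊗ₖ (1 : Matrix B B ℂ))
      rwa [hkh hNherm, Matrix.mul_one, hkm, hNN] at h4
    convert h2.add h3 using 1
    rw [hks]
    abel
  · rw [trace_mul_amplify, hlink]

end Testers

/-! ### Hypothesis testing of channels and minimax. -/

section HypothesisTesting

variable {A B : Type*} [Fintype A] [DecidableEq A] [Fintype B] [DecidableEq B]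

lemma continuous_re_trace_mul (J : Matrix A A ℂ) :
    Continuous fun T : Matrix A A ℂ => (T * J).trace.re :=
  Complex.continuous_re.comp (by fun_prop)

lemma testers_nonempty [Nonempty A] {E : OpMap A B} (hE : IsChannel E) {δ : ℝ} (hδ : δ ≤ 1) :
    (testers (choi E) δ).Nonempty := by
  obtain ⟨v, hv⟩ := exists_isUnitVec (A := A × A)
  obtain ⟨T, hT, h⟩ := exists_tester (B := B) (pureOp_isState hv) Matrix.PosSemidef.one
    (by rw [sub_self]; exact Matrix.PosSemidef.zero)
  refine ⟨T, hT, ?_⟩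
  rw [← h, Matrix.one_mul, trace_amplify hE.2, pureOp_trace hv]
  simpa using hδ

lemma ofReal_le_inv_iff {k x : ℝ} (hk : 0 < k) :
    ENNReal.ofReal k ≤ (ENNReal.ofReal x)⁻¹ ↔ x ≤ 1 / k := by
  rw [ENNReal.le_inv_iff_le_inv, ← ENNReal.ofReal_inv_of_pos hk, one_div,
    ENNReal.ofReal_le_ofReal_iff (inv_nonneg.mpr hk.le)]

/-- States with effects and testers give the same acceptance probabilities. By compactness an
optimal tester exists for each M, so the supremum becomes an existence statement without loss in k.
-/
lemma le_hypTest_iff [Nonempty A] {E : OpMap A B} (hE : IsChannel E) {ε : ℝ} (hε : 0 ≤ ε)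
    (O : Set (OpMap A B)) {k : ℝ} (hk : 0 < k) :
    ENNReal.ofReal k ≤ hypTest ε O E ↔
      ∀ M ∈ O, ∃ T ∈ testers (choi E) (1 - ε), (T * choi M).trace.re ≤ 1 / k := by
  rw [hypTest, le_iInf₂_iff]
  refine forall₂_congr fun M _ => ⟨fun h => ?_, ?_⟩
  · obtain ⟨T, hT, hmin⟩ := (isCompact_testers (choi E) (1 - ε)).exists_isMinOn
      (testers_nonempty hE (by linarith)) (continuous_re_trace_mul (choi M)).continuousOn
    refine ⟨T, hT, ?_⟩
    rw [← ofReal_le_inv_iff hk]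
    refine h.trans (iSup₂_le fun v hv => iSup₂_le fun P hP => ?_)
    obtain ⟨T', hT', h'⟩ := exists_tester (B := B) (pureOp_isState hv) hP.1 hP.2.1
    rw [h', ENNReal.inv_le_inv]
    exact ENNReal.ofReal_le_ofReal (hmin ⟨hT', by rw [← h']; exact hP.2.2⟩)
  · rintro ⟨T, hT, hTM⟩
    obtain ⟨v, P, hv, hP, hP', h⟩ := hT.1.exists_test
    rw [← ofReal_le_inv_iff hk, ← h] at hTM
    refine hTM.trans ?_
    refine le_iSup₂_of_le v hv (le_iSup₂_of_le P ⟨hP, hP', ?_⟩ le_rfl)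
    rw [h]
    exact hT.2

/-- Minimax: tests that work for each single element of a convex set can be chosen uniformly. -/
lemma exists_uniform_of_forall_exists {K C : Set (Matrix A A ℂ)} (hK : IsCompact K)
    (hKc : Convex ℝ K) (hKn : K.Nonempty) (hC : Convex ℝ C) {c : ℝ}
    (h : ∀ J ∈ C, ∃ T ∈ K, (T * J).trace.re ≤ c) : ∃ T ∈ K, ∀ J ∈ C, (T * J).trace.re ≤ c := by
  by_contra! hcon
  have hcl : ∀ J : C, IsClosed {T : Matrix A A ℂ | (T * J.1).trace.re ≤ c} := fun J =>
    isClosed_le (continuous_re_trace_mul J.1) continuous_const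
  have hempty : K ∩ ⋂ J : C, {T : Matrix A A ℂ | (T * J.1).trace.re ≤ c} = ∅ := by
    rw [Set.eq_empty_iff_forall_notMem]
    rintro T ⟨hT, hT'⟩
    obtain ⟨J, hJ, hJT⟩ := hcon T hT
    exact absurd (Set.mem_iInter.mp hT' ⟨J, hJ⟩) (not_le.mpr hJT)
  obtain ⟨s, hs⟩ := hK.elim_finite_subfamily_closed _ hcl hempty
  have hfin : ∀ T ∈ K, ∃ J ∈ Subtype.val '' (s : Set C), c < (T * J).trace.re := by
    intro T hT
    by_contra! hno
    have : T ∈ K ∩ ⋂ J ∈ s, {T : Matrix A A ℂ | (T * J.1).trace.re ≤ c} :=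
      ⟨hT, Set.mem_iInter₂.mpr fun J hJ => hno J.1 ⟨J, hJ, rfl⟩⟩
    rw [hs] at this
    exact this
  have hcont : ∀ T : Matrix A A ℂ, Continuous fun J : Matrix A A ℂ => (T * J).trace.re := fun T =>
    Complex.continuous_re.comp (by fun_prop)
  have hlin : ∀ J : Matrix A A ℂ, IsLinearMap ℝ fun T : Matrix A A ℂ => (T * J).trace.re :=
    fun J => ⟨fun _ _ => by simp [Matrix.add_mul], fun _ _ => by simp⟩
  have hlin' : ∀ T : Matrix A A ℂ, IsLinearMap ℝ fun J : Matrix A A ℂ => (T * J).trace.re :=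
    fun T => ⟨fun _ _ => by simp [Matrix.mul_add], fun _ _ => by simp⟩
  -- Minimax for the bilinear pairing: if every T in K exceeds c on one of finitely many points, a
  -- single J in C makes every T exceed c.
  obtain ⟨J, hJ, hJ'⟩ := Sion.exists_lt_iInf_of_lt_iInf_of_finite
    (f := fun T J : Matrix A A ℂ => (T * J).trace.re) (X := K) (Y := C) hKn hK
    (fun J _ => (continuous_re_trace_mul J).lowerSemicontinuous.lowerSemicontinuousOn K)
    (fun J _ => (((hlin J).mk' _).convexOn hKc).quasiconvexOn) hC
    (fun T _ => (hcont T).upperSemicontinuous.upperSemicontinuousOn C)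
    (fun T _ => (((hlin' T).mk' _).concaveOn hC).quasiconcaveOn) hKc
    (s := Subtype.val '' (s : Set C)) (s.finite_toSet.image _)
    (by rintro _ ⟨J, -, rfl⟩; exact J.2) hfin
  obtain ⟨T, hT, hTJ⟩ := h J hJ
  exact absurd hTJ (not_le.mpr (hJ' T hT))

lemma convex_choi_image {O : Set (OpMap A B)} (hO : Convex ℝ O) : Convex ℝ (choi '' O) := by
  rintro _ ⟨L, hL, rfl⟩ _ ⟨M, hM, rfl⟩ s t hs ht hst
  exact ⟨s • L + t • M, hO hL hM hs ht hst, rfl⟩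

/-- A single test that separates a channel from all elements of a convex set. -/
lemma exists_uniform_tester [Nonempty A] {E : OpMap A B} (hE : IsChannel E) {ε : ℝ} (hε : 0 ≤ ε)
    {O : Set (OpMap A B)} (hO : Convex ℝ O) {k : ℝ} (hk : 0 < k)
    (h : ENNReal.ofReal k ≤ hypTest ε O E) :
    ∃ T ∈ testers (choi E) (1 - ε), ∀ M ∈ O, (T * choi M).trace.re ≤ 1 / k := by
  rw [le_hypTest_iff hE hε O hk] at h
  obtain ⟨T, hT, hT'⟩ := exists_uniform_of_forall_exists (isCompact_testers (choi E) (1 - ε))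
    (convex_testers _ _) (testers_nonempty hE (by linarith)) (convex_choi_image hO)
    (c := 1 / k) (by rintro _ ⟨M, hM, rfl⟩; exact h M hM)
  exact ⟨T, hT, fun M hM => hT' _ ⟨M, hM, rfl⟩⟩

end HypothesisTesting

/-! ### Codes that test their channel and act on the outcome. -/

section MeasurePrepare

variable {A B C D R M : Type*} [Fintype A] [Fintype B] [Fintype C] [Fintype D] [Fintype R]
  [Fintype M]

/-- Relabelling the basis of a system along an equivalence. -/
def relabel (e : A ≃ B) : OpMap A B where
  toFun X := X.submatrix e.symm e.symm
  map_add' _ _ := rfl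
  map_smul' _ _ := rfl

lemma isChannel_relabel (e : A ≃ B) : IsChannel (relabel e) := by
  refine ⟨fun n X hX => hX.submatrix (fun p : Fin n × B => (p.1, e.symm p.2)), fun X => ?_⟩
  exact e.symm.sum_comp fun a => X a a

lemma isSuperchannel_of_memory {Θ : OpMap A B → OpMap C D} (pre : OpMap C (M × A))
    (post : OpMap (M × B) D) (hpre : IsChannel pre) (hpost : IsChannel post)
    (h : ∀ L, Θ L = post ∘ₗ amplify M L ∘ₗ pre) : IsSuperchannel Θ := by
  let e := Fintype.equivFin M
  refine ⟨Fintype.card M, relabel (e.prodCongr (Equiv.refl A)) ∘ₗ pre,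
    post ∘ₗ relabel (e.symm.prodCongr (Equiv.refl B)), (isChannel_relabel _).comp hpre,
    hpost.comp (isChannel_relabel _), fun L => ?_⟩
  rw [h]
  refine LinearMap.ext fun X => congrArg post ?_
  ext ⟨m, b⟩ ⟨m', b'⟩
  simp [relabel, amplify]

/-- Appending a fixed state. -/
def appendState (C : Type*) (ρ : Matrix A A ℂ) : OpMap C (C × A) where
  toFun X := X ⊗ₖ ρ
  map_add' X Y := Matrix.add_kronecker X Y ρ
  map_smul' c X := Matrix.smul_kronecker c X ρ

lemma isChannel_appendState {ρ : Matrix A A ℂ} (hρ : IsState ρ) :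
    IsChannel (appendState C ρ) := by
  classical
  refine ⟨fun n X hX => (hX.kronecker hρ.1).submatrix
    (fun p : Fin n × C × A => ((p.1, p.2.1), p.2.2)), fun X => ?_⟩
  simp [appendState, Matrix.trace_kronecker, hρ.2]

/-- Measuring the effect `P` on the second system and keeping the first one. -/
def measureEffect (C : Type*) (P : Matrix B B ℂ) : OpMap (C × B) C where
  toFun X := Matrix.of fun c c' => ∑ b, ∑ b', X (c, b) (c', b') * P b' b
  map_add' X Y := by
    ext c c'
    simp [add_mul, Finset.sum_add_distrib]
  map_smul' z X := by
    ext c c'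
    simp [Finset.mul_sum, mul_assoc]

lemma isCP_measureEffect {P : Matrix B B ℂ} (hP : P.PosSemidef) : IsCP (measureEffect C P) := by
  intro n X hX
  exact (link_posSemidef (B := Unit) (hX.submatrix (Equiv.prodAssoc (Fin n) C B))
    (hP.transpose.submatrix Prod.fst)).submatrix (fun p : Fin n × C => (p, ()))

lemma measureEffect_add (P Q : Matrix B B ℂ) (X : Matrix (C × B) (C × B) ℂ) :
    measureEffect C (P + Q) X = measureEffect C P X + measureEffect C Q X := by
  ext c c'
  simp [measureEffect, mul_add, Finset.sum_add_distrib]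

lemma trace_measureEffect_one [DecidableEq B] (X : Matrix (C × B) (C × B) ℂ) :
    (measureEffect C (1 : Matrix B B ℂ) X).trace = X.trace := by
  simp [measureEffect, Matrix.trace, Fintype.sum_prod_type, Matrix.one_apply]

lemma measureEffect_kronecker (P ρ : Matrix B B ℂ) (X : Matrix C C ℂ) :
    measureEffect C P (X ⊗ₖ ρ) = (P * ρ).trace • X := by
  ext c c'
  simp only [measureEffect, LinearMap.coe_mk, AddHom.coe_mk, Matrix.of_apply,
    Matrix.kroneckerMap_apply, Matrix.smul_apply, smul_eq_mul, Matrix.trace, Matrix.diag,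
    Matrix.mul_apply, Finset.sum_mul]
  rw [Finset.sum_comm]
  exact Finset.sum_congr rfl fun _ _ => Finset.sum_congr rfl fun _ _ => by ring

/-- The code that tests its channel by the state `ρ` and the effect `P`, and applies `N₁` or `N₂`
according to the outcome. -/
def testCode [DecidableEq B] [DecidableEq R] (ρ : Matrix (R × A) (R × A) ℂ)
    (P : Matrix (R × B) (R × B) ℂ) (N₁ N₂ : OpMap C D) (L : OpMap A B) : OpMap C D :=
  (P * amplify R L ρ).trace • N₁ + ((1 - P) * amplify R L ρ).trace • N₂

/-- The memory stores the code's own input C together with the reference R. The encoder appends ρ;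
the decoder measures P on R × B and then applies N₁ or N₂ to the stored input. -/
lemma isSuperchannel_testCode [DecidableEq B] [DecidableEq R] {ρ : Matrix (R × A) (R × A) ℂ}
    (hρ : IsState ρ) {P : Matrix (R × B) (R × B) ℂ} (hP : P.PosSemidef) (hP' : (1 - P).PosSemidef)
    {N₁ N₂ : OpMap C D} (hN₁ : IsChannel N₁) (hN₂ : IsChannel N₂) :
    IsSuperchannel (testCode ρ P N₁ N₂) := by
  refine isSuperchannel_of_memory (M := C × R)
    (relabel (Equiv.prodAssoc C R A).symm ∘ₗ appendState C ρ)
    ((N₁ ∘ₗ measureEffect C P + N₂ ∘ₗ measureEffect C (1 - P)) ∘ₗ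
      relabel (Equiv.prodAssoc C R B))
    ((isChannel_relabel _).comp (isChannel_appendState hρ))
    (IsChannel.comp ⟨(hN₁.1.comp (isCP_measureEffect hP)).add
      (hN₂.1.comp (isCP_measureEffect hP')), fun X => ?_⟩ (isChannel_relabel _)) fun L => ?_
  · simp only [LinearMap.add_apply, LinearMap.comp_apply, Matrix.trace_add, hN₁.2, hN₂.2]
    rw [← Matrix.trace_add, ← measureEffect_add, add_sub_cancel, trace_measureEffect_one]
  · refine LinearMap.ext fun X => ?_
    have h : relabel (Equiv.prodAssoc C R B) (amplify (C × R) L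
        (relabel (Equiv.prodAssoc C R A).symm (appendState C ρ X))) = X ⊗ₖ amplify R L ρ := by
      ext ⟨c, r, b⟩ ⟨c', r', b'⟩
      have h2 : (Matrix.of fun a a' => (X ⊗ₖ ρ) (c, r, a) (c', r', a')) =
          X c c' • Matrix.of fun a a' => ρ (r, a) (r', a') := rfl
      change L (Matrix.of fun a a' => (X ⊗ₖ ρ) (c, r, a) (c', r', a')) b b' = _
      rw [h2, map_smul]
      rfl
    simp only [LinearMap.comp_apply, LinearMap.add_apply, h, measureEffect_kronecker, map_smul,
      testCode, LinearMap.smul_apply]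

lemma trace_eq_ofReal [DecidableEq A] {P ρ : Matrix A A ℂ} (hP : P.PosSemidef)
    (hρ : ρ.PosSemidef) : (P * ρ).trace = (((P * ρ).trace.re : ℝ) : ℂ) :=
  Complex.ext rfl (by simpa using (Complex.nonneg_iff.mp (trace_mul_nonneg hP hρ)).2.symm)

/-- On channels, `testCode` is a convex combination with real weights. -/
lemma testCode_apply [DecidableEq A] [DecidableEq B] [DecidableEq R]
    {ρ : Matrix (R × A) (R × A) ℂ} (hρ : IsState ρ) {P : Matrix (R × B) (R × B) ℂ}
    (hP : P.PosSemidef) (hP' : (1 - P).PosSemidef) (N₁ N₂ : OpMap C D) {L : OpMap A B}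
    (hL : IsChannel L) :
    0 ≤ (P * amplify R L ρ).trace.re ∧ (P * amplify R L ρ).trace.re ≤ 1 ∧
      testCode ρ P N₁ N₂ L =
        (P * amplify R L ρ).trace.re • N₁ + (1 - (P * amplify R L ρ).trace.re) • N₂ := by
  have hs := hL.amplify (R := R) |>.map_isState hρ
  have h1 := trace_eq_ofReal hP hs.1
  have h2 : ((1 - P) * amplify R L ρ).trace =
      ((1 - (P * amplify R L ρ).trace.re : ℝ) : ℂ) := by
    rw [Matrix.sub_mul, Matrix.one_mul, Matrix.trace_sub, hs.2]
    push_cast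
    rw [← h1]
  have h3 := trace_mul_nonneg hP hs.1
  have h4 := trace_mul_nonneg hP' hs.1
  refine ⟨(Complex.nonneg_iff.mp h3).1, ?_, ?_⟩
  · rw [h2] at h4
    have := Complex.zero_le_real.mp h4
    linarith
  · rw [testCode, h2]
    nth_rw 1 [h1]
    rfl

end MeasurePrepare

/-! ### The maximally entangled state and the overlap functional. -/

section MaxEntangled

variable {A B D : Type*} [Fintype A] [DecidableEq A] [Fintype B] [DecidableEq B]
  [Fintype D] [DecidableEq D]

/-- The maximally entangled unit vector. -/
def maxEnt (D : Type*) [Fintype D] [DecidableEq D] : D × D → ℂ :=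
  fun p => if p.1 = p.2 then (((Real.sqrt (Fintype.card D))⁻¹ : ℝ) : ℂ) else 0

lemma maxEnt_mul_star :
    ((((Real.sqrt (Fintype.card D))⁻¹ : ℝ) : ℂ)) * star (((Real.sqrt (Fintype.card D))⁻¹ : ℝ) : ℂ) =
      (Fintype.card D : ℂ)⁻¹ := by
  rw [Complex.star_def, Complex.conj_ofReal, ← Complex.ofReal_mul, ← mul_inv,
    Real.mul_self_sqrt (Nat.cast_nonneg _)]
  push_cast
  rfl

lemma isUnitVec_maxEnt [Nonempty D] : IsUnitVec (maxEnt D) := by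
  have hD : (Fintype.card D : ℝ) ≠ 0 := Nat.cast_ne_zero.mpr Fintype.card_ne_zero
  have h : ∀ p : D × D, ‖maxEnt D p‖ ^ 2 = if p.1 = p.2 then (Fintype.card D : ℝ)⁻¹ else 0 := by
    intro p
    unfold maxEnt
    split_ifs
    · rw [Complex.norm_real, Real.norm_eq_abs, sq_abs, inv_pow, Real.sq_sqrt (Nat.cast_nonneg _)]
    · simp
  unfold IsUnitVec
  simp only [h, Fintype.sum_prod_type, Finset.sum_ite_eq, Finset.mem_univ, if_true,
    Finset.sum_const, Finset.card_univ, nsmul_eq_mul]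
  exact mul_inv_cancel₀ hD

lemma amplify_maxEnt (L : OpMap D B) : amplify D L (pureOp (maxEnt D)) = choiState L := by
  rw [amplify_apply, choiState_eq]
  ext ⟨a, b⟩ ⟨a', b'⟩
  simp only [link, pureOp, maxEnt, Matrix.of_apply, Matrix.vecMulVec_apply, Pi.star_apply,
    Matrix.smul_apply, smul_eq_mul, apply_ite star, star_zero, ite_mul, zero_mul, mul_ite,
    mul_zero, Finset.sum_ite_eq, Finset.mem_univ, if_true, maxEnt_mul_star]

/-- The overlap of the Choi state with the maximally entangled state. -/
def overlap (L : OpMap D D) : ℝ := (pureOp (maxEnt D) * choiState L).trace.re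

lemma overlap_eq (L : OpMap D D) :
    overlap L = ((Fintype.card D : ℝ)⁻¹) * (∑ i, ∑ j, choiState L (i, i) (j, j)).re := by
  have h : (pureOp (maxEnt D) * choiState L).trace =
      (Fintype.card D : ℂ)⁻¹ * ∑ i, ∑ j, choiState L (i, i) (j, j) := by
    simp only [Matrix.trace, Matrix.diag, Matrix.mul_apply, pureOp, maxEnt,
      Matrix.vecMulVec_apply, Pi.star_apply, Fintype.sum_prod_type, apply_ite star, star_zero,
      ite_mul, zero_mul, mul_ite, mul_zero, Finset.sum_ite_eq, Finset.mem_univ, if_true,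
      maxEnt_mul_star, Finset.mul_sum]
    simp only [Finset.sum_ite_irrel, Finset.sum_const_zero, Finset.sum_ite_eq, Finset.mem_univ,
      if_true]
    exact Finset.sum_comm
  rw [overlap, h, ← Complex.ofReal_natCast, ← Complex.ofReal_inv, Complex.re_ofReal_mul]

lemma overlap_id [Nonempty D] : overlap (LinearMap.id : OpMap D D) = 1 := by
  rw [overlap, ← amplify_maxEnt, amplify_id, pureOp_mul_self isUnitVec_maxEnt,
    pureOp_trace isUnitVec_maxEnt, Complex.one_re]

lemma overlap_add (L M : OpMap D D) : overlap (L + M) = overlap L + overlap M := by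
  simp only [overlap, choiState_eq, choi_add, smul_add, Matrix.mul_add, Matrix.trace_add,
    Complex.add_re]

lemma overlap_smul (c : ℝ) (L : OpMap D D) : overlap (c • L) = c * overlap L := by
  rw [overlap, overlap, choiState_eq, choiState_eq, choi_real_smul, smul_comm, Matrix.mul_smul,
    Matrix.trace_smul, Complex.smul_re, smul_eq_mul]

lemma overlap_nonneg {L : OpMap D D} (hL : IsChannel L) : 0 ≤ overlap L := by
  rw [overlap, ← amplify_maxEnt]
  exact (Complex.nonneg_iff.mp (trace_mul_nonneg (pureOp_posSemidef _)
    (hL.1.amplify_posSemidef (pureOp_posSemidef _)))).1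

end MaxEntangled

/-! ### Linearity of superchannels and pullback of tests. -/

section Superchannel

variable {A B C D : Type*} [Fintype A] [Fintype B] [Fintype C] [Fintype D]

lemma amplify_add' (R : Type*) (L M : OpMap A B) :
    amplify R (L + M) = amplify R L + amplify R M := rfl

lemma amplify_real_smul' (R : Type*) (c : ℝ) (L : OpMap A B) :
    amplify R (c • L) = c • amplify R L := rfl

lemma IsSuperchannel.map_add {Θ : OpMap A B → OpMap C D} (hΘ : IsSuperchannel Θ)
    (L M : OpMap A B) : Θ (L + M) = Θ L + Θ M := by
  obtain ⟨r, pre, post, -, -, h⟩ := hΘ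
  simp only [h, amplify_add', LinearMap.add_comp, LinearMap.comp_add]

lemma IsSuperchannel.map_real_smul {Θ : OpMap A B → OpMap C D} (hΘ : IsSuperchannel Θ)
    (c : ℝ) (L : OpMap A B) : Θ (c • L) = c • Θ L := by
  obtain ⟨r, pre, post, -, -, h⟩ := hΘ
  simp only [h, amplify_real_smul']
  refine LinearMap.ext fun X => ?_
  simp only [LinearMap.comp_apply, LinearMap.smul_apply]
  exact map_smul (post.restrictScalars ℝ) c _

lemma IsSuperchannel.isChannel {Θ : OpMap A B → OpMap C D} (hΘ : IsSuperchannel Θ)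
    {L : OpMap A B} (hL : IsChannel L) : IsChannel (Θ L) := by
  obtain ⟨r, pre, post, hpre, hpost, h⟩ := hΘ
  rw [h]
  exact hpost.comp (hL.amplify.comp hpre)

variable [DecidableEq A] [DecidableEq B] [DecidableEq D]

/-- The operator paired with X is the Heisenberg adjoint of L at P, read off from the Choi matrix.
-/
lemma trace_mul_apply (L : OpMap A B) (P : Matrix B B ℂ) (X : Matrix A A ℂ) :
    (P * L X).trace = ((measureEffect A P (choi L))ᵀ * X).trace := by
  have h := Fintype.sum_equiv (ι := B × B × A × A) (κ := A × A × B × B)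
    { toFun := fun x => (x.2.2.2, x.2.2.1, x.2.1, x.1)
      invFun := fun y => (y.2.2.2, y.2.2.1, y.2.1, y.1)
      left_inv := fun _ => rfl
      right_inv := fun _ => rfl }
    (fun ⟨b', b, a, a'⟩ => P b' b * (X a a' * choi L (a, b) (a', b')))
    (fun ⟨a', a, b, b'⟩ => choi L (a, b) (a', b') * P b' b * X a a')
    (fun ⟨b', b, a, a'⟩ => by simp only [Equiv.coe_fn_mk]; ring)
  simp only [Fintype.sum_prod_type] at h
  simp only [Matrix.trace, Matrix.diag, Matrix.mul_apply, apply_eq_sum_choi L X, measureEffect,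
    LinearMap.coe_mk, AddHom.coe_mk, Matrix.transpose_apply, Matrix.of_apply, Finset.mul_sum,
    Finset.sum_mul]
  exact h

lemma measureEffect_one_choi {L : OpMap A B} (hL : IsChannel L) :
    measureEffect A (1 : Matrix B B ℂ) (choi L) = 1 := by
  ext a a'
  have h := hL.2 (Matrix.single a a' 1)
  simp only [measureEffect, LinearMap.coe_mk, AddHom.coe_mk, Matrix.of_apply, Matrix.one_apply,
    mul_ite, mul_one, mul_zero, Finset.sum_ite_eq', Finset.mem_univ, if_true]
  refine h.trans ?_
  split_ifs with h'
  · rw [h', Matrix.trace_single_eq_same]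
  · rw [Matrix.trace_single_eq_of_ne _ _ _ h']

/-- Effects can be pulled back along channels. -/
lemma IsChannel.exists_pullback {L : OpMap A B} (hL : IsChannel L) {P : Matrix B B ℂ}
    (hP : P.PosSemidef) (hP' : (1 - P).PosSemidef) :
    ∃ Q : Matrix A A ℂ, Q.PosSemidef ∧ (1 - Q).PosSemidef ∧
      ∀ X, (P * L X).trace = (Q * X).trace := by
  refine ⟨(measureEffect A P (choi L))ᵀ,
    ((isCP_measureEffect hP).map_posSemidef hL.1.choi_posSemidef).transpose, ?_,
    trace_mul_apply L P⟩
  have h : measureEffect A P (choi L) + measureEffect A (1 - P) (choi L) = 1 := by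
    rw [← measureEffect_add, add_sub_cancel, measureEffect_one_choi hL]
  have h2 := ((isCP_measureEffect (C := A) hP').map_posSemidef hL.1.choi_posSemidef).transpose
  rw [← eq_sub_iff_add_eq'] at h
  rwa [h, Matrix.transpose_sub, Matrix.transpose_one] at h2

lemma one_sub_pureOp_posSemidef {v : A → ℂ} (hv : IsUnitVec v) : (1 - pureOp v).PosSemidef := by
  have hH : (1 - pureOp v)ᴴ = 1 - pureOp v := by
    rw [Matrix.conjTranspose_sub, Matrix.conjTranspose_one, (pureOp_posSemidef v).1.eq]
  have h := Matrix.posSemidef_conjTranspose_mul_self (1 - pureOp v)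
  rw [hH, Matrix.mul_sub, Matrix.mul_one, Matrix.sub_mul, Matrix.one_mul, pureOp_mul_self hv,
    sub_self, sub_zero] at h
  exact h

/-- Testing the output of a code against the maximally entangled state is a test of its input. -/
lemma IsSuperchannel.exists_tester [Nonempty D] {Θ : OpMap A B → OpMap D D}
    (hΘ : IsSuperchannel Θ) :
    ∃ T : Matrix (A × B) (A × B) ℂ, IsTester T ∧
      ∀ L : OpMap A B, (T * choi L).trace.re = overlap (Θ L) := by
  obtain ⟨r, pre, post, hpre, hpost, h⟩ := hΘ
  have hv := isUnitVec_maxEnt (D := D)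
  -- The projection is pulled back through the decoder, the maximally entangled state is pushed
  -- through the encoder, and D together with the memory serves as the reference.
  obtain ⟨Q, hQ, hQ', hQ2⟩ := (hpost.amplify (R := D)).exists_pullback
    (pureOp_posSemidef (maxEnt D)) (one_sub_pureOp_posSemidef hv)
  set e := Equiv.prodAssoc D (Fin r) B
  set ρ := relabel (Equiv.prodAssoc D (Fin r) A).symm (amplify D pre (pureOp (maxEnt D)))
  have hρ : IsState ρ := (isChannel_relabel _).map_isState
    ((hpre.amplify (R := D)).map_isState (pureOp_isState hv))
  obtain ⟨T, hT, hT2⟩ := QComm.exists_tester (B := B) hρ (hQ.submatrix e)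
    (by
      have := hQ'.submatrix e
      rwa [Matrix.submatrix_sub, Pi.sub_apply, Pi.sub_apply, Matrix.submatrix_one_equiv] at this)
  refine ⟨T, hT, fun L => ?_⟩
  rw [← hT2, overlap, ← amplify_maxEnt, h, amplify_comp, amplify_comp, LinearMap.comp_apply,
    LinearMap.comp_apply, hQ2]
  have h3 : amplify (D × Fin r) L ρ = (amplify D (amplify (Fin r) L)
      (amplify D pre (pureOp (maxEnt D)))).submatrix e e := rfl
  rw [h3, Matrix.submatrix_mul_equiv]
  congr 1
  exact e.sum_comp fun i => (Q * amplify D (amplify (Fin r) L)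
      (amplify D pre (pureOp (maxEnt D)))) i i

end Superchannel

/-! ### Capacity: converse, achievability and finiteness. -/

section Capacity

variable {A B D : Type*} [Fintype A] [DecidableEq A] [Fintype B] [DecidableEq B]
  [Fintype D] [DecidableEq D]

/-- Converse part: evaluated at the maximally entangled input, the fidelity with id is the overlap
of Θ E, so the tester obtained from Θ accepts E with probability at least 1 - ε. -/
lemma IsSuperchannel.le_hypTest [Nonempty A] [Nonempty D] {Θ : OpMap A B → OpMap D D}
    (hΘ : IsSuperchannel Θ) {E : OpMap A B} (hE : IsChannel E) {ε : ℝ} (hε : 0 ≤ ε)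
    (hF : 1 - ε ≤ channelFidelity (Θ E) LinearMap.id) {O : Set (OpMap A B)} {k : ℝ} (hk : 0 < k)
    (hO : ∀ M ∈ O, overlap (Θ M) ≤ 1 / k) : ENNReal.ofReal k ≤ hypTest ε O E := by
  obtain ⟨T, hT, hT'⟩ := hΘ.exists_tester
  rw [le_hypTest_iff hE hε O hk]
  refine fun M hM => ⟨T, ⟨hT, ?_⟩, by rw [hT']; exact hO M hM⟩
  have hv := isUnitVec_maxEnt (D := D)
  have h1 := hF.trans (channelFidelity_le (Θ E) LinearMap.id (pureOp_isState hv))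
  rw [amplify_id, amplify_maxEnt, fidelity_pureOp _ hv] at h1
  · rw [hT']
    exact h1
  · rw [← amplify_maxEnt]
    exact (hΘ.isChannel hE).1.amplify_posSemidef (pureOp_posSemidef _)

/-- Achievability part: the code applies id if the test accepts and N otherwise, and the weight of
id bounds the fidelity from below. -/
lemma exists_code_of_tester [Nonempty D] {E : OpMap A B} (hE : IsChannel E) {δ : ℝ}
    {T : Matrix (A × B) (A × B) ℂ} (hT : T ∈ testers (choi E) δ) {N : OpMap D D}
    (hN : IsChannel N) :
    ∃ Θ : OpMap A B → OpMap D D, IsSuperchannel Θ ∧ δ ≤ channelFidelity (Θ E) LinearMap.id ∧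
      ∀ M, IsChannel M → 0 ≤ (T * choi M).trace.re ∧ (T * choi M).trace.re ≤ 1 ∧
        Θ M = (T * choi M).trace.re • LinearMap.id + (1 - (T * choi M).trace.re) • N := by
  obtain ⟨v, P, hv, hP, hP', h⟩ := hT.1.exists_test
  have h2 : ∀ M : OpMap A B, IsChannel M → 0 ≤ (T * choi M).trace.re ∧
      (T * choi M).trace.re ≤ 1 ∧ testCode (pureOp v) P LinearMap.id N M =
        (T * choi M).trace.re • LinearMap.id + (1 - (T * choi M).trace.re) • N := by
    intro M hM
    rw [← h]
    exact testCode_apply (pureOp_isState hv) hP hP' LinearMap.id N hM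
  refine ⟨testCode (pureOp v) P LinearMap.id N,
    isSuperchannel_testCode (pureOp_isState hv) hP hP' isChannel_id hN, ?_, h2⟩
  obtain ⟨h3, h4, h5⟩ := h2 E hE
  rw [h5]
  exact hT.2.trans (le_channelFidelity_mix isChannel_id hN h3 (sub_nonneg.mpr h4))

/-- The trivial effect 1 suffices. Only trace preservation is asked of O, as elements of an affine
hull need not be positive. -/
lemma one_le_hypTest [Nonempty A] {E : OpMap A B} (hE : IsChannel E) {ε : ℝ} (hε : 0 ≤ ε)
    {O : Set (OpMap A B)} (hO : ∀ M ∈ O, ∀ X, (M X).trace = X.trace) : 1 ≤ hypTest ε O E := by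
  have h := le_hypTest_iff hE hε O one_pos
  rw [ENNReal.ofReal_one] at h
  rw [h]
  intro M hM
  obtain ⟨v, hv⟩ := exists_isUnitVec (A := A × A)
  obtain ⟨T, hT, hT'⟩ := exists_tester (B := B) (pureOp_isState hv) Matrix.PosSemidef.one
    (by rw [sub_self]; exact Matrix.PosSemidef.zero)
  refine ⟨T, ⟨hT, ?_⟩, ?_⟩
  · rw [← hT', Matrix.one_mul, trace_amplify hE.2, pureOp_trace hv]
    simpa using hε
  · rw [← hT', Matrix.one_mul, trace_amplify (hO M hM), pureOp_trace hv]
    simp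

/-- The completely depolarizing channel. -/
def depol (A B : Type*) [Fintype A] [Fintype B] [DecidableEq B] : OpMap A B where
  toFun X := (X.trace * (Fintype.card B : ℂ)⁻¹) • (1 : Matrix B B ℂ)
  map_add' X Y := by rw [Matrix.trace_add, add_mul, add_smul]
  map_smul' c X := by
    rw [Matrix.trace_smul, smul_eq_mul, mul_assoc, mul_smul]
    rfl

lemma choi_depol : choi (depol A B) = (Fintype.card B : ℂ)⁻¹ • (1 : Matrix (A × B) (A × B) ℂ) := by
  ext ⟨a, b⟩ ⟨a', b'⟩
  by_cases h : a = a'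
  · subst h
    simp [choi, depol, Matrix.one_apply]
  · simp [choi, depol, Matrix.one_apply, h]

lemma isChannel_depol [Nonempty B] : IsChannel (depol A B) := by
  refine ⟨isCP_of_choi ?_, fun X => ?_⟩
  · rw [choi_depol]
    exact Matrix.PosSemidef.one.smul (by simp)
  · have : (Fintype.card B : ℂ) ≠ 0 := Nat.cast_ne_zero.mpr Fintype.card_ne_zero
    simp only [depol, LinearMap.coe_mk, AddHom.coe_mk, Matrix.trace_smul, Matrix.trace_one,
      smul_eq_mul]
    field_simp

lemma re_trace_mul_le {T J : Matrix A A ℂ} (hT : T.PosSemidef) :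
    (T * J).trace.re ≤ T.trace.re * ∑ i, ∑ j, ‖J j i‖ := by
  refine (Complex.re_le_norm _).trans ?_
  simp only [Matrix.trace, Matrix.diag, Matrix.mul_apply]
  rw [Finset.mul_sum]
  refine (norm_sum_le _ _).trans (Finset.sum_le_sum fun i _ => ?_)
  rw [Finset.mul_sum]
  refine (norm_sum_le _ _).trans (Finset.sum_le_sum fun j _ => ?_)
  rw [norm_mul]
  exact mul_le_mul_of_nonneg_right (PosSemidef.norm_apply_le_trace hT i j) (norm_nonneg _)

/-- The depolarizing channel is accepted with probability Tr T / |B|. If this were arbitrarily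
small, so would be the acceptance of E, against the bound 1 - ε > 0. -/
lemma hypTest_ne_top [Nonempty A] [Nonempty B] {E : OpMap A B} (hE : IsChannel E) {ε : ℝ}
    (hε : 0 ≤ ε) (hε1 : ε < 1) {O : Set (OpMap A B)} (hO : depol A B ∈ O) :
    hypTest ε O E ≠ ⊤ := by
  intro htop
  set c := ∑ i, ∑ j, ‖choi E j i‖ with hc
  have hc0 : 0 ≤ c := Finset.sum_nonneg fun i _ => Finset.sum_nonneg fun j _ => norm_nonneg _
  have hB : (0 : ℝ) < Fintype.card B := Nat.cast_pos.mpr Fintype.card_pos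
  have h1 : 0 < 1 - ε := by linarith
  -- For this k the acceptance of E is at most (1 - ε) c|B| / (c|B| + 1), which is below 1 - ε.
  have hk : 0 < (c * Fintype.card B + 1) / (1 - ε) := by positivity
  obtain ⟨T, hT, hT'⟩ := (le_hypTest_iff hE hε O hk).mp (htop ▸ le_top) _ hO
  have hTp : T.PosSemidef := hT.1.choose_spec.2.1
  have h2 := hT.2.trans (re_trace_mul_le hTp)
  rw [choi_depol, Matrix.mul_smul, Matrix.mul_one, Matrix.trace_smul, ← Complex.ofReal_natCast,
    ← Complex.ofReal_inv, smul_eq_mul, Complex.re_ofReal_mul, one_div, inv_div,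
    inv_mul_le_iff₀ hB] at hT'
  have h3 : 1 - ε ≤ (Fintype.card B * ((1 - ε) / (c * Fintype.card B + 1))) * c :=
    h2.trans (mul_le_mul_of_nonneg_right hT' hc0)
  have h4 : (0 : ℝ) < c * Fintype.card B + 1 := by positivity
  have h5 : (Fintype.card B * ((1 - ε) / (c * Fintype.card B + 1))) * c =
      (1 - ε) * (c * Fintype.card B) / (c * Fintype.card B + 1) := by ring
  rw [h5, le_div_iff₀ h4] at h3
  linarith

end Capacity

/-! ### Simulation cost: smoothed robustness, attainment and codes. -/

section Cost

variable {A B D : Type*} [Fintype A] [DecidableEq A] [Fintype B] [DecidableEq B]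
  [Fintype D] [DecidableEq D]

lemma choi_injective : Function.Injective (choi : OpMap A B → Matrix (A × B) (A × B) ℂ) := by
  intro L M h
  rw [← ofChoi_choi L, h, ofChoi_choi]

lemma choi_image_eq (O : Set (OpMap A B)) : choi '' O = {J | ofChoi J ∈ O} := by
  ext J
  constructor
  · rintro ⟨L, hL, rfl⟩
    rwa [Set.mem_ofPred_eq, ofChoi_choi]
  · intro h
    exact ⟨_, h, choi_ofChoi J⟩

lemma trace_choi {L : OpMap A B} (hL : ∀ X, (L X).trace = X.trace) :
    (choi L).trace = Fintype.card A := by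
  have h : (choi L).trace = ∑ a, (L (Matrix.single a a 1)).trace := by
    simp only [Matrix.trace, Matrix.diag, Fintype.sum_prod_type]
    rfl
  simp [h, hL]

lemma isCompact_choi_channels : IsCompact (choi '' allChannels A B) := by
  refine (isCompact_posSemidef_trace_le (A := A × B) (Fintype.card A)).of_isClosed_subset ?_ ?_
  · have : choi '' allChannels A B = {J : Matrix (A × B) (A × B) ℂ | J.PosSemidef} ∩
        ⋂ X : Matrix A A ℂ, {J | (ofChoi J X).trace = X.trace} := by
      rw [choi_image_eq]
      ext J
      simp [allChannels, IsChannel, isCP_iff_choi, choi_ofChoi]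
    rw [this]
    refine isClosed_posSemidef.inter (isClosed_iInter fun X => isClosed_eq ?_ continuous_const)
    simp only [Matrix.trace, Matrix.diag, ofChoi_apply]
    fun_prop
  · rintro _ ⟨L, hL, rfl⟩
    exact ⟨hL.1.choi_posSemidef, by simp [trace_choi hL.2]⟩

/-- A superchannel is linear, so it carries the decomposition of id to one of Θ(id), which is an
admissible smoothing of E. -/
lemma IsSuperchannel.smoothRobustness_le {Θ : OpMap D D → OpMap A B} (hΘ : IsSuperchannel Θ)
    {E : OpMap A B} {ε : ℝ} (hF : 1 - ε ≤ channelFidelity (Θ LinearMap.id) E)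
    {O O' : Set (OpMap A B)} {k : ℝ} (hk : 1 ≤ k) {N Z : OpMap D D}
    (hNZ : LinearMap.id + (k - 1) • N = k • Z) (hN : Θ N ∈ O') (hZ : Θ Z ∈ O) :
    smoothRobustness ε O O' E ≤ ENNReal.ofReal k := by
  refine iInf₂_le_of_le (Θ LinearMap.id) ⟨hΘ.isChannel isChannel_id, hF⟩ ?_
  refine iInf₂_le_of_le (k - 1) ⟨by linarith, Θ N, hN, ?_⟩ (by rw [add_sub_cancel])
  rw [← hΘ.map_real_smul, ← hΘ.map_add, hNZ, hΘ.map_real_smul, add_sub_cancel, smul_smul,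
    inv_mul_cancel₀ (by linarith), one_smul]
  exact hZ

/-- A decomposition with weight r < k - 1 is padded to weight exactly k - 1 by adding (k - 1 - r) Z
on both sides; the added part is absorbed into M by convexity of O' ⊇ O. -/
lemma exists_of_smoothRobustness_lt {E : OpMap A B} {ε : ℝ} {O O' : Set (OpMap A B)}
    (hOO' : O ⊆ O') (hO' : Convex ℝ O') {k : ℝ} (hk : 1 < k)
    (h : smoothRobustness ε O O' E < ENNReal.ofReal k) :
    ∃ E', (IsChannel E' ∧ 1 - ε ≤ channelFidelity E' E) ∧ ∃ M ∈ O', ∃ Z ∈ O,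
      E' + (k - 1) • M = k • Z := by
  simp only [smoothRobustness, robustness, iInf_lt_iff] at h
  obtain ⟨E', hE', r, ⟨hr, M, hM, hZ⟩, hrk⟩ := h
  have hrk' : 1 + r < k := (ENNReal.ofReal_lt_ofReal_iff (by linarith)).mp hrk
  have hk0 : 0 < k - 1 := by linarith
  set Z := (1 + r)⁻¹ • (E' + r • M)
  refine ⟨E', hE', (r / (k - 1)) • M + ((k - 1 - r) / (k - 1)) • Z,
    hO' hM (hOO' hZ) (by positivity) (div_nonneg (by linarith) hk0.le) ?_, Z, hZ, ?_⟩
  · rw [← add_div, add_sub_cancel, div_self hk0.ne']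
  · have h1 : E' + r • M = (1 + r) • Z := by
      rw [smul_smul, mul_inv_cancel₀ (by linarith), one_smul]
    rw [smul_add, smul_smul, smul_smul, mul_div_cancel₀ _ hk0.ne', mul_div_cancel₀ _ hk0.ne',
      ← add_assoc, h1, ← add_smul]
    congr 1
    ring

lemma continuous_link {R : Type*} [Fintype R] (ρ : Matrix (R × A) (R × A) ℂ) :
    Continuous fun J : Matrix (A × B) (A × B) ℂ => link ρ J := by
  refine continuous_matrix fun p q => ?_
  simp only [link, Matrix.of_apply]
  fun_prop

/-- The infimum in the definition of the smooth robustness is attained. -/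
lemma exists_of_smoothRobustness_le [Nonempty A] {E : OpMap A B}
    {ε : ℝ} {O O' : Set (OpMap A B)} (hOO' : O ⊆ O') (hOc : O' ⊆ allChannels A B)
    (hO' : Convex ℝ O') (hcl : IsClosed (choi '' O)) (hcl' : IsClosed (choi '' O'))
    {k : ℝ} (hk : 1 ≤ k) (h : smoothRobustness ε O O' E ≤ ENNReal.ofReal k) :
    ∃ E', (IsChannel E' ∧ 1 - ε ≤ channelFidelity E' E) ∧ ∃ M ∈ O', ∃ Z ∈ O,
      E' + (k - 1) • M = k • Z := by
  -- Decompositions exist for every number above k. They are taken at k + 1/(n+1), and a subsequence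
  -- of their Choi matrices converges.
  have hstep : ∀ n : ℕ, ∃ x : Matrix (A × B) (A × B) ℂ × Matrix (A × B) (A × B) ℂ ×
      Matrix (A × B) (A × B) ℂ, (x.1 ∈ choi '' allChannels A B ∧ x.2.1 ∈ choi '' O' ∧
        x.2.2 ∈ choi '' O) ∧ 1 - ε ≤ channelFidelity (ofChoi x.1) E ∧
        x.1 + (k + 1 / ((n : ℝ) + 1) - 1) • x.2.1 - (k + 1 / ((n : ℝ) + 1)) • x.2.2 = 0 := by
    intro n
    have hn : (0 : ℝ) < 1 / ((n : ℝ) + 1) := by positivity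
    obtain ⟨E', hE', M, hM, Z, hZ, heq⟩ := exists_of_smoothRobustness_lt hOO' hO'
      (k := k + 1 / ((n : ℝ) + 1)) (by linarith)
      (h.trans_lt ((ENNReal.ofReal_lt_ofReal_iff (by linarith)).mpr (by linarith)))
    refine ⟨(choi E', choi M, choi Z), ⟨⟨_, hE'.1, rfl⟩, ⟨_, hM, rfl⟩, ⟨_, hZ, rfl⟩⟩, ?_, ?_⟩
    · rw [ofChoi_choi]
      exact hE'.2
    · rw [sub_eq_zero]
      exact congrArg choi heq
  choose x hx hxF hxeq using hstep
  have hK : IsCompact (choi '' allChannels A B) := isCompact_choi_channels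
  have hK' := hK.of_isClosed_subset hcl' (Set.image_mono hOc)
  have hK'' := hK.of_isClosed_subset hcl (Set.image_mono (hOO'.trans hOc))
  have : FirstCountableTopology (Matrix (A × B) (A × B) ℂ) :=
    inferInstanceAs (FirstCountableTopology (A × B → A × B → ℂ))
  obtain ⟨y, hy, φ, hφ, hlim⟩ := (hK.prod (hK'.prod hK'')).tendsto_subseq
    (x := x) (fun n => ⟨(hx n).1, (hx n).2.1, (hx n).2.2⟩)
  obtain ⟨⟨E', hE', hE'y⟩, ⟨M, hM, hMy⟩, ⟨Z, hZ, hZy⟩⟩ := hy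
  have hl1 : Tendsto (fun n => (x (φ n)).1) atTop (𝓝 (choi E')) := by
    rw [hE'y]
    exact (continuous_fst.tendsto y).comp hlim
  have hl2 : Tendsto (fun n => (x (φ n)).2.1) atTop (𝓝 (choi M)) := by
    rw [hMy]
    exact ((continuous_fst.comp continuous_snd).tendsto y).comp hlim
  have hl3 : Tendsto (fun n => (x (φ n)).2.2) atTop (𝓝 (choi Z)) := by
    rw [hZy]
    exact ((continuous_snd.comp continuous_snd).tendsto y).comp hlim
  have hlk : Tendsto (fun n => k + 1 / (((φ n : ℕ) : ℝ) + 1)) atTop (𝓝 k) := by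
    simpa using (tendsto_one_div_add_atTop_nhds_zero_nat.comp hφ.tendsto_atTop).const_add k
  refine ⟨E', ⟨hE', ?_⟩, M, hM, Z, hZ, ?_⟩
  -- The constraint is passed to the limit separately for each ρ, so continuity of the state
  -- fidelity is enough.
  · refine le_channelFidelity fun ρ hρ => ?_
    have hch : ∀ n, IsChannel (ofChoi (x n).1) := fun n => by
      obtain ⟨L, hL, hL'⟩ := (hx n).1
      rw [← hL', ofChoi_choi]
      exact hL
    have h1 : ∀ n, 1 - ε ≤ fidelity (link ρ (x (φ n)).1) (amplify A E ρ) := fun n => by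
      have := (hxF (φ n)).trans (channelFidelity_le _ _ hρ)
      rwa [amplify_apply, choi_ofChoi] at this
    have hp : ∀ n, (link ρ (x (φ n)).1).PosSemidef := fun n => by
      have := (hch (φ n)).1.amplify_posSemidef hρ.1
      rwa [amplify_apply, choi_ofChoi] at this
    have hpE : (amplify A E' ρ).PosSemidef := hE'.1.amplify_posSemidef hρ.1
    have hlim' : Tendsto (fun n => link ρ (x (φ n)).1) atTop
        (𝓝[{X | X.PosSemidef}] (amplify A E' ρ)) := by
      refine tendsto_nhdsWithin_iff.mpr ⟨?_, Eventually.of_forall hp⟩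
      rw [amplify_apply]
      exact ((continuous_link ρ).tendsto _).comp hl1
    exact ge_of_tendsto' ((continuousOn_fidelity (amplify A E ρ) _ hpE).tendsto.comp hlim') h1
  · refine choi_injective (sub_eq_zero.mp ?_)
    have h2 := (hl1.add ((hlk.sub_const 1).smul hl2)).sub (hlk.smul hl3)
    simp only [hxeq] at h2
    exact (tendsto_nhds_unique h2 tendsto_const_nhds)

/-- The code tests the Choi state of its channel for maximal entanglement and applies E' on success,
M on failure; id passes with certainty. -/
lemma exists_code_of_decomposition [Nonempty A] [Nonempty D] {E' M : OpMap A B}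
    (hE' : IsChannel E') (hM : IsChannel M) :
    ∃ Θ : OpMap D D → OpMap A B, IsSuperchannel Θ ∧ Θ LinearMap.id = E' ∧
      ∀ L, IsChannel L → Θ L = overlap L • E' + (1 - overlap L) • M := by
  have hv := isUnitVec_maxEnt (D := D)
  have h : ∀ L : OpMap D D, IsChannel L →
      testCode (pureOp (maxEnt D)) (pureOp (maxEnt D)) E' M L =
        overlap L • E' + (1 - overlap L) • M := by
    intro L hL
    rw [(testCode_apply (pureOp_isState hv) (pureOp_posSemidef _)
      (one_sub_pureOp_posSemidef hv) E' M hL).2.2, amplify_maxEnt]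
    rfl
  refine ⟨_, isSuperchannel_testCode (pureOp_isState hv) (pureOp_posSemidef _)
      (one_sub_pureOp_posSemidef hv) hE' hM, ?_, h⟩
  rw [h _ isChannel_id, overlap_id, one_smul, sub_self, zero_smul, add_zero]

lemma one_le_robustness (O O' : Set (OpMap A B)) (E : OpMap A B) : 1 ≤ robustness O O' E :=
  le_iInf₂ fun r hr => by
    rw [← ENNReal.ofReal_one]
    exact ENNReal.ofReal_le_ofReal (by linarith [hr.1])

lemma one_le_smoothRobustness (ε : ℝ) (O O' : Set (OpMap A B)) (E : OpMap A B) :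
    1 ≤ smoothRobustness ε O O' E :=
  le_iInf₂ fun _ _ => one_le_robustness _ _ _

lemma smoothRobustness_le_of_decomposition [Nonempty A] {E : OpMap A B} (hE : IsChannel E)
    {ε : ℝ} (hε : 0 ≤ ε) {O O' : Set (OpMap A B)} {k : ℝ} (hk : 1 ≤ k) {M Z : OpMap A B}
    (h : E + (k - 1) • M = k • Z) (hM : M ∈ O') (hZ : Z ∈ O) :
    smoothRobustness ε O O' E ≤ ENNReal.ofReal k := by
  refine iInf₂_le_of_le E ⟨hE, by linarith [one_le_channelFidelity_self hE]⟩ ?_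
  refine iInf₂_le_of_le (k - 1) ⟨by linarith, M, hM, ?_⟩ (by rw [add_sub_cancel])
  rw [h, add_sub_cancel, smul_smul, inv_mul_cancel₀ (by linarith), one_smul]
  exact hZ

end Cost

/-! ### The resource measures of the identity channel. -/

section Benchmark

variable {D : Type*} [Fintype D] [DecidableEq D]

lemma supportProj_pureOp {v : D → ℂ} (hv : IsUnitVec v) : supportProj (pureOp v) = pureOp v := by
  have hp : IsSelfAdjoint (pureOp v) := (pureOp_posSemidef v).1
  have hi : IsIdempotentElem (pureOp v) := pureOp_mul_self hv
  have hs : spectrum ℝ (pureOp v) ⊆ {0, 1} := hi.spectrum_subset ℝ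
  unfold supportProj
  conv_rhs => rw [← cfc_id ℝ (pureOp v) hp]
  refine cfc_congr fun x hx => ?_
  rcases hs hx with rfl | rfl <;> simp

/-- For every pure ψ the decomposition makes k (id ⊗ Z)(ψ) ≥ ψ, so Z alone limits the measure to k;
the maximally entangled ψ reaches k by the overlap bound. -/
lemma minMeasure_id_eq [Nonempty D] {O : Set (OpMap D D)} {k : ℝ} (hk : 1 ≤ k) {N Z : OpMap D D}
    (hNZ : LinearMap.id + (k - 1) • N = k • Z) (hN : IsChannel N) (hZ : Z ∈ O)
    (hO : ∀ M ∈ O, overlap M ≤ 1 / k) :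
    minMeasure O (LinearMap.id : OpMap D D) = ENNReal.ofReal k := by
  have hk0 : 0 < k := by linarith
  refine le_antisymm (iSup₂_le fun v hv => iInf₂_le_of_le Z hZ ?_) ?_
  · rw [amplify_id, supportProj_pureOp hv, ENNReal.inv_le_iff_inv_le,
      ← ENNReal.ofReal_inv_of_pos hk0]
    refine ENNReal.ofReal_le_ofReal ?_
    have h1 : k • amplify D Z (pureOp v) = pureOp v + (k - 1) • amplify D N (pureOp v) := by
      rw [← amplify_real_smul, ← hNZ, amplify_add, amplify_id, amplify_real_smul]
    have h2 := congrArg (fun X => (pureOp v * X).trace.re) h1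
    simp only [Matrix.mul_smul, Matrix.mul_add, Matrix.trace_smul, Matrix.trace_add,
      Complex.smul_re, Complex.add_re, pureOp_mul_self hv, pureOp_trace hv, Complex.one_re,
      smul_eq_mul] at h2
    have h3 := (Complex.nonneg_iff.mp (trace_mul_nonneg (pureOp_posSemidef v)
      (hN.1.amplify_posSemidef (pureOp_posSemidef v)))).1
    rw [inv_le_iff_one_le_mul₀' hk0, h2]
    have : 0 ≤ k - 1 := by linarith
    nlinarith [mul_nonneg this h3]
  · refine le_iSup₂_of_le (maxEnt D) isUnitVec_maxEnt (le_iInf₂ fun M hM => ?_)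
    rw [amplify_id, supportProj_pureOp isUnitVec_maxEnt, amplify_maxEnt, ofReal_le_inv_iff hk0]
    exact hO M hM

/-- Lower bound: (id + rM)/(1+r) has overlap at least 1/(1+r), and at most 1/k if it is free. -/
lemma robustness_id_eq [Nonempty D] {O O' : Set (OpMap D D)} {k : ℝ} (hk : 1 ≤ k)
    {N Z : OpMap D D} (hNZ : LinearMap.id + (k - 1) • N = k • Z) (hN : N ∈ O') (hZ : Z ∈ O)
    (hO' : O' ⊆ allChannels D D) (hO : ∀ M ∈ O, overlap M ≤ 1 / k) :
    robustness O O' (LinearMap.id : OpMap D D) = ENNReal.ofReal k := by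
  have hk0 : 0 < k := by linarith
  refine le_antisymm ?_ (le_iInf₂ fun r hr => ENNReal.ofReal_le_ofReal ?_)
  · refine iInf₂_le_of_le (k - 1) ⟨by linarith, N, hN, ?_⟩ (by rw [add_sub_cancel])
    rw [hNZ, add_sub_cancel, smul_smul, inv_mul_cancel₀ (by linarith), one_smul]
    exact hZ
  · obtain ⟨hr0, M, hM, h⟩ := hr
    have h1 := hO _ h
    have h2 := overlap_nonneg (hO' hM)
    rw [overlap_smul, overlap_add, overlap_smul, overlap_id,
      inv_mul_le_iff₀ (by linarith), mul_one_div, le_div_iff₀ hk0] at h1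
    nlinarith [mul_nonneg hr0 h2]

end Benchmark

/-! ### Carathéodory and compact convex hulls. -/

section ConvexHull

lemma sum_eq_of_embedding {ι κ W : Type*} [Fintype ι] [Fintype κ] [AddCommMonoid W] (e : ι ↪ κ)
    (g : κ → W) (f : ι → W) (h1 : ∀ i, g (e i) = f i) (h2 : ∀ j, (¬∃ i, e i = j) → g j = 0) :
    ∑ j, g j = ∑ i, f i := by
  rw [← Finset.sum_subset (Finset.subset_univ (Finset.univ.map e)), Finset.sum_map]
  · exact Finset.sum_congr rfl fun i _ => h1 i
  · intro j _ hj
    exact h2 j (by simpa using hj)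

/-- Convex hulls of compact sets in finite dimension are compact. -/
lemma isCompact_convexHull {V : Type*} [AddCommGroup V] [Module ℝ V] [TopologicalSpace V]
    [ContinuousAdd V] [ContinuousSMul ℝ V] [FiniteDimensional ℝ V] {s : Set V}
    (hs : IsCompact s) : IsCompact (convexHull ℝ s) := by
  rcases s.eq_empty_or_nonempty with rfl | ⟨s₀, hs₀⟩
  · simp
  -- Carathéodory's bound on the number of points. Shorter combinations are padded with weight 0 at
  -- s₀, so the hull is the image of a simplex times a power of s.
  let n := Module.finrank ℝ V + 1
  have hK : IsCompact (stdSimplex ℝ (Fin n) ×ˢ (Set.pi Set.univ fun _ : Fin n => s)) :=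
    (isCompact_stdSimplex ℝ (Fin n)).prod (isCompact_univ_pi fun _ => hs)
  have hcont : Continuous fun x : (Fin n → ℝ) × (Fin n → V) => ∑ i, x.1 i • x.2 i := by fun_prop
  convert hK.image hcont using 1
  ext x
  constructor
  · intro hx
    obtain ⟨ι, _, z, w, hz, hzi, hw, hw1, rfl⟩ := eq_pos_convex_span_of_mem_convexHull hx
    have hcard : Fintype.card ι ≤ Fintype.card (Fin n) := by
      rw [Fintype.card_fin]
      exact hzi.card_le_finrank_succ.trans
        (Nat.succ_le_succ (Submodule.finrank_le _))
    obtain ⟨e⟩ := Function.Embedding.nonempty_of_card_le hcard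
    have hw0 : ∀ j, (¬∃ i, e i = j) → Function.extend e w 0 j = 0 := fun j hj => by
      rw [Function.extend_apply' _ _ _ hj, Pi.zero_apply]
    refine ⟨(Function.extend e w 0, Function.extend e z fun _ => s₀), ⟨⟨fun j => ?_, ?_⟩, ?_⟩, ?_⟩
    · by_cases hj : ∃ i, e i = j
      · obtain ⟨i, rfl⟩ := hj
        change 0 ≤ Function.extend e w 0 (e i)
        rw [e.injective.extend_apply]
        exact (hw i).le
      · exact (hw0 j hj).ge
    · rw [← hw1]
      exact sum_eq_of_embedding e _ _ (fun i => e.injective.extend_apply _ _ _) hw0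
    · intro j _
      by_cases hj : ∃ i, e i = j
      · obtain ⟨i, rfl⟩ := hj
        simp only [e.injective.extend_apply]
        exact hz ⟨i, rfl⟩
      · simp only [Function.extend_apply' _ _ _ hj]
        exact hs₀
    · refine sum_eq_of_embedding e _ _ (fun i => ?_) fun j hj => ?_
      · simp only [e.injective.extend_apply]
      · simp only [hw0 j hj, zero_smul]
  · rintro ⟨⟨w, z⟩, ⟨hw, hz⟩, rfl⟩
    exact (convex_convexHull ℝ s).sum_mem (fun i _ => hw.1 i) hw.2
      fun i _ => subset_convexHull ℝ s (hz i trivial)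

end ConvexHull

/-! ### Separable and PPT channels. -/

section Separable

variable {A B C D : Type*} [Fintype A] [DecidableEq A] [Fintype B] [DecidableEq B]
  [Fintype C] [DecidableEq C] [Fintype D] [DecidableEq D]

lemma isSeparable_of_fintype {ι : Type*} [Fintype ι] {p : ι → ℝ} {α : ι → Matrix A A ℂ}
    {β : ι → Matrix B B ℂ} (hp : ∀ k, 0 ≤ p k) (hp1 : ∑ k, p k = 1) (hα : ∀ k, IsState (α k))
    (hβ : ∀ k, IsState (β k)) : IsSeparable (∑ k, p k • (α k ⊗ₖ β k)) := by
  let e := (Fintype.equivFin ι).symm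
  refine ⟨Fintype.card ι, p ∘ e, α ∘ e, β ∘ e, fun k => hp _, ?_, fun k => hα _, fun k => hβ _, ?_⟩
  · rw [← hp1]
    exact e.sum_comp p
  · exact (e.sum_comp fun k => p k • (α k ⊗ₖ β k)).symm

/-- Product states. -/
def productStates (A B : Type*) [Fintype A] [Fintype B] : Set (Matrix (A × B) (A × B) ℂ) :=
  (fun x : Matrix A A ℂ × Matrix B B ℂ => x.1 ⊗ₖ x.2) '' ({ρ | IsState ρ} ×ˢ {σ | IsState σ})

/-- `IsSeparable` puts no bound on the number of terms; as the convex hull of a compact set, the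
separable states are nevertheless seen to be closed. -/
lemma setOf_isSeparable :
    {X : Matrix (A × B) (A × B) ℂ | IsSeparable X} = convexHull ℝ (productStates A B) := by
  ext X
  constructor
  · rintro ⟨n, p, α, β, hp, hp1, hα, hβ, rfl⟩
    exact (convex_convexHull ℝ _).sum_mem (fun i _ => hp i) hp1 fun i _ =>
      subset_convexHull ℝ _ ⟨(α i, β i), ⟨hα i, hβ i⟩, rfl⟩
  · intro hX
    obtain ⟨ι, _, z, w, hz, -, hw, hw1, rfl⟩ := eq_pos_convex_span_of_mem_convexHull hX
    choose x hx hxz using fun i => hz ⟨i, rfl⟩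
    simp only [← hxz]
    exact isSeparable_of_fintype (fun i => (hw i).le) hw1 (fun i => (hx i).1) fun i => (hx i).2

lemma convex_isSeparable : Convex ℝ {X : Matrix (A × B) (A × B) ℂ | IsSeparable X} := by
  rw [setOf_isSeparable]
  exact convex_convexHull ℝ _

lemma isClosed_isSeparable : IsClosed {X : Matrix (A × B) (A × B) ℂ | IsSeparable X} := by
  rw [setOf_isSeparable]
  refine (isCompact_convexHull (IsCompact.image (isCompact_states.prod isCompact_states)
    (continuous_matrix fun p q => ?_))).isClosed
  simp only [Matrix.kroneckerMap_apply]
  fun_prop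

lemma IsSeparable.posSemidef {X : Matrix (A × B) (A × B) ℂ} (hX : IsSeparable X) :
    X.PosSemidef := by
  obtain ⟨n, p, α, β, hp, -, hα, hβ, rfl⟩ := hX
  exact Matrix.posSemidef_sum _ fun k _ => ((hα k).1.kronecker (hβ k).1).smul (hp k)

lemma partialTranspose_add (X Y : Matrix (A × B) (A × B) ℂ) :
    partialTranspose (X + Y) = partialTranspose X + partialTranspose Y := rfl

lemma partialTranspose_smul (c : ℝ) (X : Matrix (A × B) (A × B) ℂ) :
    partialTranspose (c • X) = c • partialTranspose X := rfl

lemma IsSeparable.partialTranspose_posSemidef {X : Matrix (A × B) (A × B) ℂ}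
    (hX : IsSeparable X) : (partialTranspose X).PosSemidef := by
  obtain ⟨n, p, α, β, hp, -, hα, hβ, rfl⟩ := hX
  have h : partialTranspose (∑ k, p k • (α k ⊗ₖ β k)) = ∑ k, p k • (α k ⊗ₖ (β k)ᵀ) := by
    ext i j
    simp [partialTranspose, Matrix.sum_apply]
  rw [h]
  exact Matrix.posSemidef_sum _ fun k _ => ((hα k).1.kronecker (hβ k).1.transpose).smul (hp k)

lemma choiState_add (L M : OpMap A B) : choiState (L + M) = choiState L + choiState M := by
  rw [choiState_eq, choi_add, smul_add]
  rfl

lemma choiState_smul (c : ℝ) (L : OpMap A B) : choiState (c • L) = c • choiState L := by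
  rw [choiState_eq, choi_real_smul, smul_comm]
  rfl

lemma sepChannels_subset_ppt : sepChannels A B ⊆ pptChannels A B :=
  fun _ hL => ⟨hL.1, hL.2.partialTranspose_posSemidef⟩

lemma sepChannels_subset : sepChannels A B ⊆ allChannels A B := fun _ hL => hL.1

lemma pptChannels_subset : pptChannels A B ⊆ allChannels A B := fun _ hL => hL.1

lemma convex_sepChannels : Convex ℝ (sepChannels A B) := by
  intro L hL M hM s t hs ht hst
  refine ⟨hL.1.convex_comb hM.1 hs ht hst, ?_⟩
  rw [choiState_add, choiState_smul, choiState_smul]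
  exact convex_isSeparable hL.2 hM.2 hs ht hst

lemma convex_pptChannels : Convex ℝ (pptChannels A B) := by
  intro L hL M hM s t hs ht hst
  refine ⟨hL.1.convex_comb hM.1 hs ht hst, ?_⟩
  rw [choiState_add, choiState_smul, choiState_smul, partialTranspose_add, partialTranspose_smul,
    partialTranspose_smul]
  exact (hL.2.smul hs).add (hM.2.smul ht)

lemma choi_image_and (P : Matrix (A × B) (A × B) ℂ → Prop) :
    choi '' {L : OpMap A B | IsChannel L ∧ P (choiState L)} =
      choi '' allChannels A B ∩ {J | P ((Fintype.card A : ℂ)⁻¹ • J)} := by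
  rw [choi_image_eq, choi_image_eq]
  ext J
  simp [allChannels, choiState_eq, choi_ofChoi]

lemma isClosed_choi_sepChannels : IsClosed (choi '' sepChannels A B) := by
  rw [sepChannels, choi_image_and]
  exact isCompact_choi_channels.isClosed.inter
    (isClosed_isSeparable.preimage (continuous_const_smul _))

lemma isClosed_choi_pptChannels : IsClosed (choi '' pptChannels A B) := by
  rw [pptChannels, choi_image_and fun X => (partialTranspose X).PosSemidef]
  refine isCompact_choi_channels.isClosed.inter
    (isClosed_posSemidef.preimage (continuous_matrix fun p q => ?_))
  simp only [partialTranspose, Matrix.of_apply, Matrix.smul_apply]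
  fun_prop

lemma isState_maxMixed [Nonempty A] : IsState ((Fintype.card A : ℂ)⁻¹ • (1 : Matrix A A ℂ)) := by
  refine ⟨Matrix.PosSemidef.one.smul (by simp), ?_⟩
  rw [Matrix.trace_smul, Matrix.trace_one, smul_eq_mul, inv_mul_cancel₀]
  exact Nat.cast_ne_zero.mpr Fintype.card_ne_zero

lemma depol_mem_sepChannels [Nonempty A] [Nonempty B] : depol A B ∈ sepChannels A B := by
  refine ⟨isChannel_depol, ?_⟩
  have h := isSeparable_of_fintype (ι := Unit) (p := fun _ => 1) (fun _ => zero_le_one) (by simp)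
    (fun _ => isState_maxMixed (A := A)) (fun _ => isState_maxMixed (A := B))
  convert h using 1
  rw [choiState_eq, choi_depol, ← Matrix.one_kronecker_one]
  simp only [Finset.univ_unique, Finset.sum_const, Finset.card_singleton, one_smul,
    Matrix.smul_kronecker, Matrix.kronecker_smul]
  exact smul_comm _ _ _

/-- E acts on the second tensor factors only. Composing E with a decomposition of the identity on
its input thus shows that E has finite robustness. -/
lemma IsChannel.comp_mem_sepChannels [Nonempty A] {E : OpMap B C} (hE : IsChannel E)
    {N : OpMap A B} (hN : N ∈ sepChannels A B) : E ∘ₗ N ∈ sepChannels A C := by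
  refine ⟨hE.comp hN.1, ?_⟩
  obtain ⟨n, p, α, β, hp, hp1, hα, hβ, h⟩ := hN.2
  refine ⟨n, p, α, fun k => E (β k), hp, hp1, hα, fun k => hE.map_isState (hβ k), ?_⟩
  have h1 : ∀ (X : Matrix A A ℂ) (Y : Matrix B B ℂ), QComm.amplify A E (X ⊗ₖ Y) = X ⊗ₖ E Y := by
    intro X Y
    ext ⟨a, c⟩ ⟨a', c'⟩
    have h2 : (Matrix.of fun b b' => (X ⊗ₖ Y) (a, b) (a', b')) = X a a' • Y := rfl
    change E (Matrix.of fun b b' => (X ⊗ₖ Y) (a, b) (a', b')) c c' = _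
    rw [h2, map_smul]
    rfl
  rw [← amplify_maxEnt, amplify_comp, LinearMap.comp_apply, amplify_maxEnt, h, map_sum]
  refine Finset.sum_congr rfl fun k _ => ?_
  rw [← h1]
  exact map_smul ((QComm.amplify A E).restrictScalars ℝ) (p k) _

lemma mem_sepChannels_of_trace [Nonempty A] {L : OpMap A B} (hL : ∀ X, (L X).trace = X.trace)
    (h : IsSeparable (choiState L)) : L ∈ sepChannels A B := by
  refine ⟨⟨isCP_of_choi ?_, hL⟩, h⟩
  have h1 : choi L = (Fintype.card A : ℂ) • choiState L := by
    rw [choiState_eq, smul_smul, mul_inv_cancel₀, one_smul]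
    exact Nat.cast_ne_zero.mpr Fintype.card_ne_zero
  rw [h1]
  exact h.posSemidef.smul (by simp)

/-- Partial transposition turns the maximally entangled projection into the swap operator divided by
d. The swap is at most 1, which is checked on the vectors e_ij - e_ji, and the transposed Choi state
G is positive of trace 1. -/
lemma overlap_le_of_ppt [Nonempty D] {L : OpMap D D} (hL : L ∈ pptChannels D D) :
    overlap L ≤ 1 / Fintype.card D := by
  have hD : (0 : ℝ) < Fintype.card D := Nat.cast_pos.mpr Fintype.card_pos
  rw [overlap_eq, one_div]
  refine mul_le_of_le_one_right (by positivity) ?_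
  set G := partialTranspose (choiState L) with hG
  have htr : G.trace = 1 := by
    have h1 : G.trace = (choiState L).trace := rfl
    rw [h1, choiState_eq, Matrix.trace_smul, trace_choi hL.1.2, smul_eq_mul, inv_mul_cancel₀]
    exact Nat.cast_ne_zero.mpr Fintype.card_ne_zero
  have hpair : ∀ i j, (G (i, j) (j, i)).re + (G (j, i) (i, j)).re ≤
      (G (i, j) (i, j)).re + (G (j, i) (j, i)).re := by
    intro i j
    have h2 := (hL.2.submatrix ![(i, j), (j, i)]).re_dotProduct_nonneg ![1, -1]
    simp [Matrix.mulVec, dotProduct, Fin.sum_univ_two] at h2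
    linarith
  have hsum := Finset.sum_le_sum fun i (_ : i ∈ (Finset.univ : Finset D)) =>
    Finset.sum_le_sum fun j (_ : j ∈ (Finset.univ : Finset D)) => hpair i j
  simp only [Finset.sum_add_distrib] at hsum
  rw [Finset.sum_comm (f := fun i j => (G (j, i) (i, j)).re),
    Finset.sum_comm (f := fun i j => (G (j, i) (j, i)).re)] at hsum
  have h3 : (∑ i, ∑ j, G (i, j) (i, j)).re = 1 := by
    rw [← Fintype.sum_prod_type' (fun i j => G (i, j) (i, j))]
    exact congrArg Complex.re htr
  simp only [Complex.re_sum] at h3 ⊢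
  have h4 : ∀ i j, choiState L (i, i) (j, j) = G (i, j) (j, i) := fun i j => rfl
  simp only [h4]
  linarith

end Separable

/-! ### The identity as a difference of multiples of separable channels. -/

section Decomposition

variable {D : Type*} [Fintype D] [DecidableEq D]

/-- The map `X ↦ Tr(X) 1 - Δ(X)`, with `Δ` the completely dephasing map. -/
def offDiag (D : Type*) [Fintype D] [DecidableEq D] : OpMap D D where
  toFun X := X.trace • 1 - Matrix.diagonal X.diag
  map_add' X Y := by
    ext i j
    by_cases h : i = j
    · subst h
      simp [add_sub_add_comm]
    · simp [h]
  map_smul' c X := by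
    ext i j
    by_cases h : i = j
    · subst h
      simp [mul_sub]
    · simp [h]

lemma trace_offDiag (X : Matrix D D ℂ) :
    (offDiag D X).trace = ((Fintype.card D : ℂ) - 1) * X.trace := by
  have h : (Matrix.diagonal X.diag).trace = X.trace := by simp [Matrix.trace]
  simp only [offDiag, LinearMap.coe_mk, AddHom.coe_mk, Matrix.trace_sub, h, Matrix.trace_smul,
    Matrix.trace_one, smul_eq_mul]
  ring

lemma choi_offDiag (a b a' b' : D) : choi (offDiag D) (a, b) (a', b') =
    if a = a' ∧ b = b' ∧ a ≠ b then 1 else 0 := by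
  simp only [choi, offDiag, LinearMap.coe_mk, AddHom.coe_mk, Matrix.of_apply, Matrix.sub_apply,
    Matrix.smul_apply, Matrix.diagonal_apply, Matrix.diag_apply, smul_eq_mul, Matrix.one_apply,
    Matrix.single_apply]
  by_cases h1 : a = a'
  · subst h1
    by_cases h2 : b = b'
    · subst h2
      by_cases h3 : a = b <;> simp [h3]
    · simp [h2]
  · have : ¬(a = b ∧ a' = b) := fun h => h1 (h.1.trans h.2.symm)
    simp [h1, this]

lemma isState_single (i : D) : IsState (Matrix.single i i (1 : ℂ)) := by
  have h : Matrix.single i i (1 : ℂ) = pureOp (Pi.single i 1) := by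
    ext j k
    simp only [pureOp, Matrix.vecMulVec_apply, Pi.star_apply, Pi.single_apply, Matrix.single_apply]
    by_cases h1 : i = j
    · subst h1
      by_cases h2 : i = k
      · simp [h2]
      · simp [h2, Ne.symm h2]
    · simp [h1, Ne.symm h1]
  rw [h]
  refine pureOp_isState ?_
  unfold IsUnitVec
  rw [Finset.sum_eq_single i] <;> simp +contextual

/-- Its Choi state is the uniform mixture of the product basis states e_i ⊗ e_j with i ≠ j. -/
lemma offDiag_mem_sepChannels (hD : 1 < Fintype.card D) :
    ((Fintype.card D : ℝ) - 1)⁻¹ • offDiag D ∈ sepChannels D D := by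
  have hD1 : (1 : ℝ) < Fintype.card D := by exact_mod_cast hD
  have hne : Nonempty D := Fintype.card_pos_iff.mp (by omega)
  have hd0 : (Fintype.card D : ℝ) - 1 ≠ 0 := by linarith
  have hd1 : (Fintype.card D : ℝ) ≠ 0 := by linarith
  refine mem_sepChannels_of_trace (fun X => ?_) ?_
  · rw [LinearMap.smul_apply, Matrix.trace_smul, trace_offDiag, Complex.real_smul, ← mul_assoc]
    push_cast
    rw [inv_mul_cancel₀, one_mul]
    exact_mod_cast hd0
  · set c : ℝ := (Fintype.card D : ℝ)⁻¹ * ((Fintype.card D : ℝ) - 1)⁻¹ with hc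
    have h := isSeparable_of_fintype (p := fun p : D × D => if p.1 = p.2 then (0 : ℝ) else c)
      (α := fun p => Matrix.single p.1 p.1 (1 : ℂ)) (β := fun p => Matrix.single p.2 p.2 (1 : ℂ))
      (fun p => by
        split_ifs
        · exact le_rfl
        · exact mul_nonneg (by positivity) (inv_nonneg.mpr (by linarith)))
      (by
        have : ∀ i j : D, (if i = j then (0 : ℝ) else c) = c - if i = j then c else 0 := by
          intro i j
          split_ifs <;> simp
        simp only [Fintype.sum_prod_type, this, Finset.sum_sub_distrib, Finset.sum_const,
          Finset.card_univ, Finset.sum_ite_eq, Finset.mem_univ, if_true, nsmul_eq_mul]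
        rw [hc, Fintype.card_prod]
        field_simp
        push_cast
        ring)
      (fun p => isState_single p.1) (fun p => isState_single p.2)
    convert h using 1
    ext ⟨a, b⟩ ⟨a', b'⟩
    rw [choiState_smul, choiState_eq]
    simp only [Matrix.smul_apply, choi_offDiag, Matrix.sum_apply, Matrix.kroneckerMap_apply,
      Fintype.sum_prod_type]
    rw [Finset.sum_eq_single a, Finset.sum_eq_single b]
    · by_cases h1 : a = b
      · simp [h1]
      · by_cases h2 : a = a' <;> by_cases h3 : b = b' <;>
          simp [h1, h2, h3, hc, mul_comm]
    · intro j _ hj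
      simp [Matrix.single_apply, hj]
    · simp
    · intro i _ hi
      simp [Matrix.single_apply, hi]
    · simp

/-- The summand is a character of f, so the sum vanishes unless f a - f a' - f b + f b' is
identically 0. Order 3 matters: modulo 2 the case a = b', a' = b would cancel as well. -/
lemma sum_stdAddChar (a a' b b' : D) :
    ∑ f : D → ZMod 3, (ZMod.stdAddChar (f a) * ZMod.stdAddChar (-f a') *
      (ZMod.stdAddChar (-f b) * ZMod.stdAddChar (f b')) : ℂ) =
      if (a = b ∧ a' = b') ∨ (a = a' ∧ b = b') then (Fintype.card (D → ZMod 3) : ℂ) else 0 := by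
  classical
  let g : (D → ZMod 3) →+ ZMod 3 :=
    Pi.evalAddMonoidHom (fun _ : D => ZMod 3) a - Pi.evalAddMonoidHom (fun _ : D => ZMod 3) a' -
    Pi.evalAddMonoidHom (fun _ : D => ZMod 3) b + Pi.evalAddMonoidHom (fun _ : D => ZMod 3) b'
  have hg : ∀ f, g f = f a - f a' - f b + f b' := fun f => rfl
  let χ : AddChar (D → ZMod 3) ℂ := (ZMod.stdAddChar (N := 3)).compAddMonoidHom g
  have h := AddChar.sum_eq_ite χ
  have h1 : ∀ f, χ f = ZMod.stdAddChar (f a) * ZMod.stdAddChar (-f a') *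
      (ZMod.stdAddChar (-f b) * ZMod.stdAddChar (f b')) := by
    intro f
    rw [← AddChar.map_add_eq_mul, ← AddChar.map_add_eq_mul, ← AddChar.map_add_eq_mul]
    change ZMod.stdAddChar (g f) = _
    rw [hg]
    congr 1
    ring
  simp only [h1] at h
  rw [h]
  refine if_congr ⟨fun h0 => ?_, fun hab => ?_⟩ rfl rfl
  · have h2 : ∀ f, g f = 0 := by
      intro f
      have h3 : χ f = 1 := by rw [h0]; rfl
      refine ZMod.injective_stdAddChar (N := 3) ?_
      rw [AddChar.map_zero_eq_one]
      exact h3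
    by_contra hcon
    push Not at hcon
    by_cases hab : a = b
    · subst hab
      have h4 := h2 (Pi.single b' 1)
      rw [hg] at h4
      simp [Pi.single_apply, hcon.1 rfl] at h4
    · by_cases haa : a = a'
      · subst haa
        have h4 := h2 (Pi.single b' 1)
        rw [hg] at h4
        simp [Pi.single_apply, hcon.2 rfl] at h4
      · have h4 := h2 (Pi.single a 1)
        rw [hg] at h4
        by_cases hba : b' = a <;>
          simp [Ne.symm hab, Ne.symm haa, hba] at h4
        exact absurd h4 (by decide)
  · ext f
    rw [h1]
    simp only [AddChar.zero_apply, ← AddChar.map_add_eq_mul]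
    rw [← AddChar.map_zero_eq_one (ZMod.stdAddChar (N := 3))]
    congr 1
    rcases hab with ⟨rfl, rfl⟩ | ⟨rfl, rfl⟩ <;> ring

lemma norm_stdAddChar (x : ZMod 3) : ‖(ZMod.stdAddChar x : ℂ)‖ = 1 := by
  rw [ZMod.stdAddChar_apply]
  exact Circle.norm_coe _

lemma star_stdAddChar (x : ZMod 3) : star (ZMod.stdAddChar x : ℂ) = ZMod.stdAddChar (-x) := by
  have h : (ZMod.stdAddChar x : ℂ) * ZMod.stdAddChar (-x) = 1 := by
    rw [← AddChar.map_add_eq_mul, add_neg_cancel, AddChar.map_zero_eq_one]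
  have h2 : (ZMod.stdAddChar x : ℂ) * star (ZMod.stdAddChar x : ℂ) = 1 := by
    rw [Complex.star_def, Complex.mul_conj', norm_stdAddChar]
    norm_num
  have h0 : (ZMod.stdAddChar x : ℂ) ≠ 0 := fun h0 => by simp [h0] at h
  exact mul_left_cancel₀ h0 (h2.trans h.symm)

/-- The flat vector with phases given by `f`. -/
def phaseVec (f : D → ZMod 3) : D → ℂ :=
  fun i => (((Real.sqrt (Fintype.card D))⁻¹ : ℝ) : ℂ) * ZMod.stdAddChar (f i)

lemma isUnitVec_phaseVec [Nonempty D] (f : D → ZMod 3) : IsUnitVec (phaseVec f) := by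
  have hD : (Fintype.card D : ℝ) ≠ 0 := Nat.cast_ne_zero.mpr Fintype.card_ne_zero
  simp only [IsUnitVec, phaseVec, norm_mul, norm_stdAddChar, mul_one, Complex.norm_real,
    Real.norm_eq_abs, sq_abs, inv_pow, Real.sq_sqrt (Nat.cast_nonneg (Fintype.card D)),
    Finset.sum_const, Finset.card_univ, nsmul_eq_mul]
  exact mul_inv_cancel₀ hD

lemma pureOp_phaseVec (f : D → ZMod 3) (i j : D) : pureOp (phaseVec f) i j =
    (Fintype.card D : ℂ)⁻¹ * (ZMod.stdAddChar (f i) * ZMod.stdAddChar (-f j)) := by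
  rw [← maxEnt_mul_star, pureOp, Matrix.vecMulVec_apply, Pi.star_apply, phaseVec, phaseVec,
    star_mul', star_stdAddChar]
  ring

/-- The Choi state is the average over all phases f of the product of the flat vector with phases f
and the one with phases -f; the averaging kills all other entries. -/
lemma id_add_offDiag_mem_sepChannels [Nonempty D] :
    (Fintype.card D : ℝ)⁻¹ • (LinearMap.id + offDiag D) ∈ sepChannels D D := by
  have hD : (Fintype.card D : ℂ) ≠ 0 := Nat.cast_ne_zero.mpr Fintype.card_ne_zero
  refine mem_sepChannels_of_trace (fun X => ?_) ?_
  · rw [LinearMap.smul_apply, Matrix.trace_smul, LinearMap.add_apply, Matrix.trace_add,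
      trace_offDiag, Complex.real_smul, LinearMap.id_apply]
    push_cast
    field_simp
    ring
  · have hK : (Fintype.card (D → ZMod 3) : ℝ) ≠ 0 := Nat.cast_ne_zero.mpr Fintype.card_ne_zero
    have h := isSeparable_of_fintype (ι := D → ZMod 3)
      (p := fun _ => (Fintype.card (D → ZMod 3) : ℝ)⁻¹)
      (α := fun f => pureOp (phaseVec f)) (β := fun f => pureOp (phaseVec (-f)))
      (fun _ => by positivity)
      (by
        rw [Finset.sum_const, Finset.card_univ, nsmul_eq_mul, mul_inv_cancel₀ hK])
      (fun f => pureOp_isState (isUnitVec_phaseVec f))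
      (fun f => pureOp_isState (isUnitVec_phaseVec (-f)))
    convert h using 1
    ext ⟨a, b⟩ ⟨a', b'⟩
    have h1 : ∀ f : D → ZMod 3, (pureOp (phaseVec f) ⊗ₖ pureOp (phaseVec (-f))) (a, b) (a', b') =
        ((Fintype.card D : ℂ)⁻¹ * (Fintype.card D : ℂ)⁻¹) *
        (ZMod.stdAddChar (f a) * ZMod.stdAddChar (-f a') *
          (ZMod.stdAddChar (-f b) * ZMod.stdAddChar (f b'))) := by
      intro f
      rw [Matrix.kroneckerMap_apply, pureOp_phaseVec, pureOp_phaseVec, Pi.neg_apply, Pi.neg_apply,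
        neg_neg]
      ring
    rw [← Finset.smul_sum, Matrix.smul_apply, Matrix.sum_apply]
    simp only [h1]
    rw [← Finset.mul_sum, sum_stdAddChar, choiState_smul, choiState_eq, choi_add]
    have hK' : (Fintype.card (D → ZMod 3) : ℂ) ≠ 0 := Nat.cast_ne_zero.mpr Fintype.card_ne_zero
    have h2 : choi (LinearMap.id : OpMap D D) (a, b) (a', b') =
        if a = b ∧ a' = b' then 1 else 0 := by
      simp [choi, Matrix.single_apply]
    -- The two alternatives meet when all four indices agree; the condition a ≠ b in `choi_offDiag`
    -- prevents counting that entry twice.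
    have h3 : (if (a = b ∧ a' = b') ∨ (a = a' ∧ b = b') then (Fintype.card (D → ZMod 3) : ℂ)
        else 0) = (Fintype.card (D → ZMod 3) : ℂ) * ((if a = b ∧ a' = b' then 1 else 0) +
          if a = a' ∧ b = b' ∧ a ≠ b then 1 else 0) := by
      by_cases h4 : a = b
      · subst h4
        by_cases h5 : a' = b'
        · simp [h5]
        · have : ¬(a = a' ∧ a = b') := fun h => h5 (h.1.symm.trans h.2)
          simp [h5, this]
      · simp [h4]
    rw [h3, Matrix.smul_apply, Matrix.smul_apply, Matrix.add_apply, h2, choi_offDiag,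
      Complex.real_smul, Complex.real_smul, smul_eq_mul]
    push_cast
    field_simp

/-- The identity channel is the difference of multiples of two separable channels. -/
lemma exists_sep_decomposition [Nonempty D] :
    ∃ N ∈ sepChannels D D, ∃ Z ∈ sepChannels D D,
      LinearMap.id + ((Fintype.card D : ℝ) - 1) • N = (Fintype.card D : ℝ) • Z := by
  have hD : (Fintype.card D : ℝ) ≠ 0 := Nat.cast_ne_zero.mpr Fintype.card_ne_zero
  have hZ := id_add_offDiag_mem_sepChannels (D := D)
  rcases (Nat.succ_le_of_lt (Fintype.card_pos (α := D))).eq_or_lt with h | h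
  · have h' : Fintype.card D = 1 := h.symm
    -- For d = 1 the weight d - 1 vanishes, and any separable channel may serve as N.
    refine ⟨_, hZ, _, hZ, ?_⟩
    have : Subsingleton D := Fintype.card_le_one_iff_subsingleton.mp h'.le
    have h0 : offDiag D = 0 := by
      refine LinearMap.ext fun X => ?_
      ext i j
      obtain rfl := Subsingleton.elim i j
      have : X.trace = X i i := by
        rw [Matrix.trace, Fintype.sum_eq_single i fun j hj => absurd (Subsingleton.elim j i) hj]
        rfl
      simp [offDiag, this]
    simp [h', h0]
  · have hd : (Fintype.card D : ℝ) - 1 ≠ 0 := by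
      have : (1 : ℝ) < Fintype.card D := by exact_mod_cast h
      linarith
    refine ⟨_, offDiag_mem_sepChannels h, _, hZ, ?_⟩
    rw [smul_smul, smul_smul, mul_inv_cancel₀ hd, mul_inv_cancel₀ hD, one_smul, one_smul]

end Decomposition

/-! ### Replacement channels and their affine hull. -/

section Replacement

variable {A B C D : Type*} [Fintype A] [DecidableEq A] [Fintype B] [DecidableEq B]
  [Fintype C] [DecidableEq C] [Fintype D] [DecidableEq D]

lemma choi_replacement {L : OpMap A B} {σ : Matrix B B ℂ} (hL : ∀ X, L X = X.trace • σ) :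
    choi L = (1 : Matrix A A ℂ) ⊗ₖ σ := by
  ext ⟨a, b⟩ ⟨a', b'⟩
  by_cases h : a = a'
  · subst h
    simp [choi, hL]
  · simp [choi, hL, h]

lemma replacementChannels_subset : replacementChannels A B ⊆ allChannels A B := by
  rintro L ⟨σ, hσ, hL⟩
  refine ⟨isCP_of_choi ?_, fun X => ?_⟩
  · rw [choi_replacement hL]
    exact Matrix.PosSemidef.one.kronecker hσ.1
  · rw [hL, Matrix.trace_smul, hσ.2, smul_eq_mul, mul_one]

lemma isClosed_choi_replacementChannels : IsClosed (choi '' replacementChannels A B) := by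
  have h : choi '' replacementChannels A B =
      (fun σ : Matrix B B ℂ => (1 : Matrix A A ℂ) ⊗ₖ σ) '' {σ | IsState σ} := by
    ext J
    constructor
    · rintro ⟨L, ⟨σ, hσ, hL⟩, rfl⟩
      exact ⟨σ, hσ, (choi_replacement hL).symm⟩
    · rintro ⟨σ, hσ, rfl⟩
      let L : OpMap A B := (LinearMap.toSpanSingleton ℂ _ σ) ∘ₗ Matrix.traceLinearMap A ℂ ℂ
      exact ⟨L, ⟨σ, hσ, fun X => rfl⟩, choi_replacement (L := L) fun X => rfl⟩
  rw [h]
  refine (isCompact_states.image (continuous_matrix fun p q => ?_)).isClosed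
  simp only [Matrix.kroneckerMap_apply]
  fun_prop

lemma depol_apply (X : Matrix A A ℂ) :
    depol A B X = X.trace • ((Fintype.card B : ℂ)⁻¹ • (1 : Matrix B B ℂ)) := by
  rw [smul_smul]
  rfl

lemma depol_mem_replacementChannels [Nonempty B] : depol A B ∈ replacementChannels A B :=
  ⟨_, isState_maxMixed, depol_apply⟩

lemma IsChannel.comp_mem_replacementChannels {E : OpMap B C} (hE : IsChannel E) {L : OpMap A B}
    (hL : L ∈ replacementChannels A B) : E ∘ₗ L ∈ replacementChannels A C := by
  obtain ⟨σ, hσ, h⟩ := hL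
  exact ⟨E σ, hE.map_isState hσ, fun X => by rw [LinearMap.comp_apply, h, map_smul]⟩

/-- The Choi state is 1/d ⊗ σ, and the reduced maximally entangled state is 1/d. Since this is an
equality for every σ, it extends to the affine hull. -/
lemma overlap_replacement {L : OpMap D D} (hL : L ∈ replacementChannels D D) :
    overlap L = 1 / (Fintype.card D : ℝ) ^ 2 := by
  obtain ⟨σ, hσ, h⟩ := hL
  have h1 : ∑ i, ∑ j, choiState L (i, i) (j, j) = ((Fintype.card D : ℝ)⁻¹ : ℝ) := by
    simp only [choiState_eq, choi_replacement h, Matrix.smul_apply, Matrix.kroneckerMap_apply,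
      Matrix.one_apply, ite_mul, one_mul, zero_mul, smul_eq_mul, mul_ite, mul_zero,
      Finset.sum_ite_eq, Finset.mem_univ, if_true, ← Finset.mul_sum]
    have h2 : ∑ i, σ i i = 1 := hσ.2
    rw [h2]
    push_cast
    ring
  rw [overlap_eq, h1, Complex.ofReal_re]
  ring

lemma choi_id : choi (LinearMap.id : OpMap D D) =
    (Fintype.card D : ℂ) • pureOp (maxEnt D) := by
  rcases isEmpty_or_nonempty D with hD | hD
  · exact Matrix.ext fun p => hD.elim p.1
  have h : (Fintype.card D : ℂ) ≠ 0 := Nat.cast_ne_zero.mpr Fintype.card_ne_zero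
  rw [← amplify_id (pureOp (maxEnt D)), amplify_maxEnt, choiState_eq, smul_smul,
    mul_inv_cancel₀ h, one_smul]

/-- The completely depolarizing channel as a mixture of the identity and another channel. -/
lemma exists_depol_decomposition [Nonempty D] :
    ∃ N : OpMap D D, IsChannel N ∧
      LinearMap.id + ((Fintype.card D : ℝ) ^ 2 - 1) • N = (Fintype.card D : ℝ) ^ 2 • depol D D := by
  have hD : (Fintype.card D : ℝ) ≠ 0 := Nat.cast_ne_zero.mpr Fintype.card_ne_zero
  rcases (Nat.succ_le_of_lt (Fintype.card_pos (α := D))).eq_or_lt with h | h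
  · have h' : Fintype.card D = 1 := h.symm
    refine ⟨_, isChannel_depol, ?_⟩
    have : Subsingleton D := Fintype.card_le_one_iff_subsingleton.mp h'.le
    have h0 : (LinearMap.id : OpMap D D) = depol D D := by
      refine LinearMap.ext fun X => ?_
      ext i j
      obtain rfl := Subsingleton.elim i j
      have : X.trace = X i i := by
        rw [Matrix.trace, Fintype.sum_eq_single i fun j hj => absurd (Subsingleton.elim j i) hj]
        rfl
      simp [depol_apply, this, h']
    simp [h', h0]
  · have hD1 : (1 : ℝ) < Fintype.card D := by exact_mod_cast h
    have hk : 0 < (Fintype.card D : ℝ) ^ 2 - 1 := by nlinarith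
    -- N is forced by the equation. It is completely positive since d² times the depolarizing
    -- channel minus id has Choi matrix d times the complement of the maximally entangled
    -- projection.
    refine ⟨((Fintype.card D : ℝ) ^ 2 - 1)⁻¹ •
      ((Fintype.card D : ℝ) ^ 2 • depol D D - LinearMap.id), ⟨?_, fun X => ?_⟩, ?_⟩
    · refine IsCP.real_smul (isCP_of_choi ?_) (inv_nonneg.mpr hk.le)
      have h1 : choi ((Fintype.card D : ℝ) ^ 2 • depol D D - LinearMap.id) =
          (Fintype.card D : ℂ) • (1 - pureOp (maxEnt D)) := by
        have h2 : choi ((Fintype.card D : ℝ) ^ 2 • depol D D - LinearMap.id) =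
          (Fintype.card D : ℝ) ^ 2 • choi (depol D D) - choi LinearMap.id := rfl
        have h3 : (Fintype.card D : ℂ) ≠ 0 := Nat.cast_ne_zero.mpr Fintype.card_ne_zero
        rw [h2, choi_id, choi_depol, smul_sub]
        congr 1
        ext i j
        simp only [Matrix.smul_apply, Complex.real_smul, smul_eq_mul]
        push_cast
        field_simp
      rw [h1]
      exact (one_sub_pureOp_posSemidef isUnitVec_maxEnt).smul (by simp)
    · rw [LinearMap.smul_apply, LinearMap.sub_apply, LinearMap.smul_apply, Matrix.trace_smul,
        Matrix.trace_sub, Matrix.trace_smul, isChannel_depol.2, LinearMap.id_apply]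
      nth_rw 2 [← one_smul ℝ X.trace]
      rw [← sub_smul, smul_smul, inv_mul_cancel₀ hk.ne', one_smul]
    · rw [smul_smul, mul_inv_cancel₀ hk.ne', one_smul, add_sub_cancel]

lemma trace_of_mem_aff {M : OpMap A B} (hM : M ∈ aff (replacementChannels A B))
    (X : Matrix A A ℂ) : (M X).trace = X.trace := by
  refine affineSpan_induction (p := fun M : OpMap A B => (M X).trace = X.trace) hM
    (fun L hL => (replacementChannels_subset hL).2 X) fun c u v w hu hv hw => ?_
  simp only [vsub_eq_sub, vadd_eq_add, LinearMap.add_apply, LinearMap.smul_apply,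
    LinearMap.sub_apply, Matrix.trace_add, Matrix.trace_smul, Matrix.trace_sub, hu, hv, hw,
    sub_self, smul_zero, zero_add]

lemma overlap_of_mem_aff {Θ : OpMap A B → OpMap D D} (hΘ : Θ ∈ nsCodes A B D D)
    {M : OpMap A B} (hM : M ∈ aff (replacementChannels A B)) :
    overlap (Θ M) = 1 / (Fintype.card D : ℝ) ^ 2 := by
  refine affineSpan_induction (p := fun M : OpMap A B =>
    overlap (Θ M) = 1 / (Fintype.card D : ℝ) ^ 2) hM
    (fun L hL => overlap_replacement (hΘ.2 L hL)) fun c u v w hu hv hw => ?_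
  have h : c • (u -ᵥ v) +ᵥ w = (c • u + (-c) • v) + w := by
    rw [vsub_eq_sub, vadd_eq_add]
    module
  rw [h, hΘ.1.map_add, hΘ.1.map_add, hΘ.1.map_real_smul, hΘ.1.map_real_smul, overlap_add,
    overlap_add, overlap_smul, overlap_smul, hu, hv, hw]
  ring

lemma convex_allChannels : Convex ℝ (allChannels A B) := fun _ hL _ hM _ _ hs ht hst =>
  IsChannel.convex_comb hL hM hs ht hst

lemma convex_aff (O : Set (OpMap A B)) : Convex ℝ (aff O) := (affineSpan ℝ O).convex

lemma subset_aff (O : Set (OpMap A B)) : O ⊆ aff O := subset_affineSpan ℝ O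

/-- An affine functional that is bounded above on an affine hull is constant. -/
lemma re_trace_mul_choi_eq_of_bounded {O : Set (OpMap A B)} {T : Matrix (A × B) (A × B) ℂ} {c : ℝ}
    (h : ∀ M ∈ aff O, (T * choi M).trace.re ≤ c) {L M : OpMap A B} (hL : L ∈ O) (hM : M ∈ O) :
    (T * choi L).trace.re = (T * choi M).trace.re := by
  by_contra hne
  have hne' : (T * choi L).trace.re - (T * choi M).trace.re ≠ 0 := sub_ne_zero.mpr hne
  -- Chosen so that the functional takes the value c + 1 at the point t L + (1 - t) M of the line
  -- through L and M.
  set t := (c + 1 - (T * choi M).trace.re) /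
    ((T * choi L).trace.re - (T * choi M).trace.re) with ht
  have hmem : t • L + (1 - t) • M ∈ aff O := by
    have h1 := AffineMap.lineMap_mem t (subset_affineSpan ℝ O hM) (subset_affineSpan ℝ O hL)
    rw [AffineMap.lineMap_apply_module] at h1
    rwa [add_comm]
  have h2 := h _ hmem
  have h3 : choi (t • L + (1 - t) • M) = t • choi L + (1 - t) • choi M := rfl
  rw [h3, re_trace_mul_convex'] at h2
  have h4 : t * ((T * choi L).trace.re - (T * choi M).trace.re) =
      c + 1 - (T * choi M).trace.re := div_mul_cancel₀ _ hne'
  nlinarith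

end Replacement

/-! ### From integer thresholds to logarithmic rates. -/

section Rates

variable {b : ℝ}

lemma isGreatest_rates (hb : 1 < b) {Q : ℕ → Prop} {d₀ : ℕ} (h0 : 1 ≤ d₀)
    (h : ∀ d, 1 ≤ d → (Q d ↔ d ≤ d₀)) :
    IsGreatest {x | ∃ d : ℕ, 1 ≤ d ∧ x = Real.logb b d ∧ Q d} (Real.logb b d₀) := by
  refine ⟨⟨d₀, h0, rfl, (h d₀ h0).mpr le_rfl⟩, ?_⟩
  rintro _ ⟨d, hd, rfl, hQ⟩
  exact Real.logb_le_logb_of_le hb (Nat.cast_pos.mpr hd) (Nat.cast_le.mpr ((h d hd).mp hQ))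

lemma isLeast_rates (hb : 1 < b) {Q : ℕ → Prop} {d₀ : ℕ} (h0 : 1 ≤ d₀)
    (h : ∀ d, 1 ≤ d → (Q d ↔ d₀ ≤ d)) :
    IsLeast {x | ∃ d : ℕ, 1 ≤ d ∧ x = Real.logb b d ∧ Q d} (Real.logb b d₀) := by
  refine ⟨⟨d₀, h0, rfl, (h d₀ h0).mpr le_rfl⟩, ?_⟩
  rintro _ ⟨d, hd, rfl, hQ⟩
  exact Real.logb_le_logb_of_le hb (Nat.cast_pos.mpr h0) (Nat.cast_le.mpr ((h d hd).mp hQ))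

lemma squareFloor_eq {x : ℝ} (hx : 1 ≤ x) : squareFloor x = (⌊Real.sqrt x⌋₊ : ℝ) ^ 2 := by
  have h0 : 1 ≤ ⌊Real.sqrt x⌋₊ := Nat.le_floor (by simpa using hx)
  refine IsGreatest.csSup_eq ⟨⟨_, h0, rfl, ?_⟩, ?_⟩
  · exact (Real.le_sqrt (Nat.cast_nonneg _) (by linarith)).mp (Nat.floor_le (Real.sqrt_nonneg x))
  · rintro _ ⟨d, hd, rfl, hdx⟩
    have : d ≤ ⌊Real.sqrt x⌋₊ := Nat.le_floor (Real.le_sqrt_of_sq_le hdx)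
    gcongr

lemma squareCeil_eq {x : ℝ} (hx : 1 ≤ x) : squareCeil x = (⌈Real.sqrt x⌉₊ : ℝ) ^ 2 := by
  have h0 : 1 ≤ ⌈Real.sqrt x⌉₊ := Nat.one_le_ceil_iff.mpr (Real.sqrt_pos.mpr (by linarith))
  refine IsLeast.csInf_eq ⟨⟨_, h0, rfl, ?_⟩, ?_⟩
  · exact (Real.sqrt_le_left (Nat.cast_nonneg _)).mp (Nat.le_ceil _)
  · rintro _ ⟨d, hd, rfl, hdx⟩
    have : ⌈Real.sqrt x⌉₊ ≤ d := Nat.ceil_le.mpr ((Real.sqrt_le_left (Nat.cast_nonneg _)).mpr hdx)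
    gcongr

lemma half_logb_sq (n : ℕ) : 1 / 2 * Real.logb b ((n : ℝ) ^ 2) = Real.logb b n := by
  rw [Real.logb_pow]
  push_cast
  ring

lemma one_le_toReal {x : ℝ≥0∞} (hx : x ≠ ⊤) (h : 1 ≤ x) : 1 ≤ x.toReal := by
  rwa [← ENNReal.toReal_one, ENNReal.toReal_le_toReal ENNReal.one_ne_top hx]

end Rates

/-! ### Assembly of the capacity and cost formulas. -/

section Main

variable {A B D : Type*} [Fintype A] [DecidableEq A] [Fintype B] [DecidableEq B]
  [Fintype D] [DecidableEq D]

/-- The pivot of both directions of conversion: for 0 ≤ p ≤ 1/k a mixture of L and N is a mixture of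
Z and N, and at p = 1/k it is Z itself. -/
lemma mix_eq {L N Z : OpMap A B} {k : ℝ} (h : L + (k - 1) • N = k • Z) (p : ℝ) :
    p • L + (1 - p) • N = (p * k) • Z + (1 - p * k) • N := by
  have h1 : L = k • Z - (k - 1) • N := eq_sub_of_add_eq h
  rw [h1]
  module

lemma mix_mem {O : Set (OpMap A B)} (hO : Convex ℝ O) {L N Z : OpMap A B} {k : ℝ} (hk : 0 < k)
    (h : L + (k - 1) • N = k • Z) (hN : N ∈ O) (hZ : Z ∈ O) {p : ℝ} (hp : 0 ≤ p)
    (hpk : p ≤ 1 / k) : p • L + (1 - p) • N ∈ O := by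
  rw [mix_eq h]
  rw [le_div_iff₀ hk] at hpk
  exact hO hZ hN (by positivity) (by linarith) (by ring)

lemma exists_code_iff_le_hypTest [Nonempty A] [Nonempty D] {E : OpMap A B} (hE : IsChannel E)
    {ε : ℝ} (hε : 0 ≤ ε) {O : Set (OpMap A B)} (hO : Convex ℝ O) (hOc : O ⊆ allChannels A B)
    {O' : Set (OpMap D D)} (hO' : Convex ℝ O') (hOc' : O' ⊆ allChannels D D) {k : ℝ} (hk : 0 < k)
    (hov : ∀ M ∈ O', overlap M ≤ 1 / k) {N Z : OpMap D D} (hN : N ∈ O') (hZ : Z ∈ O')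
    (hNZ : LinearMap.id + (k - 1) • N = k • Z) :
    (∃ Θ ∈ freeSuperchannels O O', 1 - ε ≤ channelFidelity (Θ E) LinearMap.id) ↔
      ENNReal.ofReal k ≤ hypTest ε O E := by
  constructor
  · rintro ⟨Θ, hΘ, hF⟩
    exact hΘ.1.le_hypTest hE hε hF hk fun M hM => hov _ (hΘ.2 M hM)
  · intro h
    obtain ⟨T, hT, hT'⟩ := exists_uniform_tester hE hε hO hk h
    obtain ⟨Θ, hΘ, hF, hΘM⟩ := exists_code_of_tester hE hT (hOc' hN)
    refine ⟨Θ, ⟨hΘ, fun M hM => ?_⟩, hF⟩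
    obtain ⟨h1, h2, h3⟩ := hΘM M (hOc hM)
    rw [h3]
    exact mix_mem hO' hk hNZ hN hZ h1 (hT' M hM)

/-- Replacement channels must be sent exactly to a replacement channel. The test accepts all of them
with the same probability c, being bounded on the affine hull, and the rejection branch raises the
weight of id from c to 1/k, where the output is depolarizing. -/
lemma exists_nsCode_iff_le_hypTest [Nonempty A] [Nonempty B] [Nonempty D] {E : OpMap A B}
    (hE : IsChannel E) {ε : ℝ} (hε : 0 ≤ ε) :
    (∃ Θ ∈ nsCodes A B D D, 1 - ε ≤ channelFidelity (Θ E) LinearMap.id) ↔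
      ENNReal.ofReal ((Fintype.card D : ℝ) ^ 2) ≤ hypTest ε (aff (replacementChannels A B)) E := by
  have hD : (1 : ℝ) ≤ Fintype.card D := by exact_mod_cast Fintype.card_pos
  have hk : 0 < (Fintype.card D : ℝ) ^ 2 := by positivity
  constructor
  · rintro ⟨Θ, hΘ, hF⟩
    exact hΘ.1.le_hypTest hE hε hF hk fun M hM => (overlap_of_mem_aff hΘ hM).le
  · intro h
    obtain ⟨N, hN, hNZ⟩ := exists_depol_decomposition (D := D)
    obtain ⟨T, hT, hT'⟩ := exists_uniform_tester hE hε (convex_aff _) hk h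
    set k := (Fintype.card D : ℝ) ^ 2
    have hdep : depol A B ∈ replacementChannels A B := depol_mem_replacementChannels
    set c := (T * choi (depol A B)).trace.re
    have hc : c ≤ 1 / k := hT' _ (subset_aff _ hdep)
    -- s is the weight of id in the rejection branch. If c = 1, then 1/k = 1 and the equation holds
    -- for every s.
    obtain ⟨s, hs0, hs1, hs⟩ : ∃ s : ℝ, 0 ≤ s ∧ s ≤ 1 ∧ c + (1 - c) * s = 1 / k := by
      have hk1 : 1 / k ≤ 1 := by
        rw [div_le_one hk]
        exact one_le_pow₀ hD
      rcases (hc.trans hk1).eq_or_lt with h1 | h1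
      · exact ⟨0, le_rfl, zero_le_one, by linarith⟩
      · have h2 : 0 < 1 - c := by linarith
        refine ⟨(1 / k - c) / (1 - c), div_nonneg (by linarith) h2.le, ?_, ?_⟩
        · rw [div_le_one h2]
          linarith
        · rw [mul_div_cancel₀ _ h2.ne']
          ring
    obtain ⟨Θ, hΘ, hF, hΘM⟩ := exists_code_of_tester hE hT
      ((isChannel_id (A := D)).convex_comb hN hs0 (sub_nonneg.mpr hs1) (by ring))
    refine ⟨Θ, ⟨hΘ, fun M hM => ?_⟩, hF⟩
    obtain ⟨-, -, h3⟩ := hΘM M (replacementChannels_subset hM)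
    rw [re_trace_mul_choi_eq_of_bounded hT' hM hdep] at h3
    have h4 : Θ M = (1 / k) • (LinearMap.id : OpMap D D) + (1 - 1 / k) • N := by
      rw [h3, ← hs]
      change c • _ + (1 - c) • _ = _
      module
    rw [h4, mix_eq hNZ, div_mul_cancel₀ _ hk.ne', sub_self, one_smul, zero_smul, add_zero]
    exact depol_mem_replacementChannels

/-- O' = O gives the standard robustness, O' = all channels the generalized one. The hypotheses `hN`
and `hmix` isolate what the two cases prove differently. -/
lemma exists_code_iff_smoothRobustness_le [Nonempty A] [Nonempty D] {E : OpMap A B} {ε : ℝ}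
    {O O' : Set (OpMap A B)} (hOO' : O ⊆ O') (hOc : O' ⊆ allChannels A B)
    (hO' : Convex ℝ O') (hcl : IsClosed (choi '' O)) (hcl' : IsClosed (choi '' O'))
    {OD : Set (OpMap D D)} (hODc : OD ⊆ allChannels D D) {k : ℝ} (hk : 1 ≤ k)
    {N Z : OpMap D D} (hZ : Z ∈ OD) (hNZ : LinearMap.id + (k - 1) • N = k • Z)
    (hN : ∀ Θ ∈ freeSuperchannels OD O, Θ N ∈ O')
    (hmix : ∀ L ∈ OD, ∀ E' : OpMap A B, ∀ M ∈ O', ∀ Z' ∈ O, E' + (k - 1) • M = k • Z' →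
      overlap L • E' + (1 - overlap L) • M ∈ O) :
    (∃ Θ ∈ freeSuperchannels OD O, 1 - ε ≤ channelFidelity (Θ LinearMap.id) E) ↔
      smoothRobustness ε O O' E ≤ ENNReal.ofReal k := by
  constructor
  · rintro ⟨Θ, hΘ, hF⟩
    exact hΘ.1.smoothRobustness_le hF hk hNZ (hN Θ hΘ) (hΘ.2 Z hZ)
  · intro h
    obtain ⟨E', hE', M, hM, Z', hZ', heq⟩ :=
      exists_of_smoothRobustness_le hOO' hOc hO' hcl hcl' hk h
    obtain ⟨Θ, hΘ, hid, hL⟩ := exists_code_of_decomposition (D := D) hE'.1 (hOc hM)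
    refine ⟨Θ, ⟨hΘ, fun L hLO => ?_⟩, by rw [hid]; exact hE'.2⟩
    rw [hL L (hODc hLO)]
    exact hmix L hLO E' M hM Z' hZ' heq

lemma comp_decomposition {E : OpMap A B} {N Z : OpMap A A} {k : ℝ}
    (h : LinearMap.id + (k - 1) • N = k • Z) : E + (k - 1) • (E ∘ₗ N) = k • (E ∘ₗ Z) := by
  refine LinearMap.ext fun X => ?_
  have h1 := congrArg E (LinearMap.congr_fun h X)
  simp only [LinearMap.add_apply, LinearMap.smul_apply, LinearMap.id_apply, map_add] at h1
  have h2 : ∀ (c : ℝ) (Y : Matrix A A ℂ), E (c • Y) = c • E Y :=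
    fun c Y => map_smul (E.restrictScalars ℝ) c Y
  rw [h2, h2] at h1
  exact h1

/-- Benchmarks, capacity and cost for a convex closed theory of free channels in which the
identity channel on `ℂ^d` has standard robustness `d`. -/
theorem capacity_and_cost_of_standard [Nonempty A] [Nonempty B] {E : OpMap A B}
    (hE : IsChannel E) {b : ℝ} (hb : 1 < b) {ε : ℝ} (hε0 : 0 ≤ ε) {O : Set (OpMap A B)}
    (hO : Convex ℝ O) (hOc : O ⊆ allChannels A B) (hcl : IsClosed (choi '' O))
    (hsep : sepChannels A B ⊆ O) {OD : (d : ℕ) → Set (OpMap (Fin d) (Fin d))}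
    (hOD : ∀ d, Convex ℝ (OD d)) (hODc : ∀ d, OD d ⊆ allChannels (Fin d) (Fin d))
    (hODs : ∀ d, sepChannels (Fin d) (Fin d) ⊆ OD d)
    (hov : ∀ d, 1 ≤ d → ∀ M ∈ OD d, overlap M ≤ 1 / d) :
    (∀ d : ℕ, 1 ≤ d → minMeasure (OD d) (idCh d) = d ∧ stdRobustness (OD d) (idCh d) = d) ∧
      (ε < 1 →
        hypTest ε O E ≠ ⊤ ∧
        IsGreatest (capacityRates b (fun d => freeSuperchannels O (OD d)) ε E)
          (oneShotCapacity b (fun d => freeSuperchannels O (OD d)) ε E) ∧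
        oneShotCapacity b (fun d => freeSuperchannels O (OD d)) ε E =
          Real.logb b ⌊(hypTest ε O E).toReal⌋₊) ∧
      smoothStdRobustness ε O E ≠ ⊤ ∧
      IsLeast (costRates b (fun d => freeSuperchannels (OD d) O) ε E)
        (oneShotCost b (fun d => freeSuperchannels (OD d) O) ε E) ∧
      oneShotCost b (fun d => freeSuperchannels (OD d) O) ε E =
        Real.logb b ⌈(smoothStdRobustness ε O E).toReal⌉₊ := by
  have hdec : ∀ d : ℕ, 1 ≤ d → ∃ N ∈ OD d, ∃ Z ∈ OD d,
      (LinearMap.id : OpMap (Fin d) (Fin d)) + ((d : ℝ) - 1) • N = (d : ℝ) • Z := by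
    intro d hd
    have : Nonempty (Fin d) := ⟨⟨0, hd⟩⟩
    obtain ⟨N, hN, Z, hZ, h⟩ := exists_sep_decomposition (D := Fin d)
    rw [Fintype.card_fin] at h
    exact ⟨N, hODs d hN, Z, hODs d hZ, h⟩
  refine ⟨fun d hd => ?_, fun hε1 => ?_, ?_⟩
  · have : Nonempty (Fin d) := ⟨⟨0, hd⟩⟩
    have hd1 : (1 : ℝ) ≤ d := by exact_mod_cast hd
    obtain ⟨N, hN, Z, hZ, h⟩ := hdec d hd
    rw [← ENNReal.ofReal_natCast]
    exact ⟨minMeasure_id_eq hd1 h (hODc d hN) hZ (hov d hd),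
      robustness_id_eq hd1 h hN hZ (hODc d) (hov d hd)⟩
  · have htop := hypTest_ne_top hE hε0 hε1 (hsep depol_mem_sepChannels)
    have h1 := one_le_toReal htop (one_le_hypTest hE hε0 fun M hM => (hOc hM).2)
    have hG : IsGreatest (capacityRates b (fun d => freeSuperchannels O (OD d)) ε E)
        (Real.logb b ⌊(hypTest ε O E).toReal⌋₊) := by
      refine isGreatest_rates hb (Nat.one_le_floor_iff _ |>.mpr h1) fun d hd => ?_
      have : Nonempty (Fin d) := ⟨⟨0, hd⟩⟩
      obtain ⟨N, hN, Z, hZ, h⟩ := hdec d hd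
      have hd0 : (0 : ℝ) < d := by exact_mod_cast hd
      rw [Nat.le_floor_iff (by linarith), ← ENNReal.ofReal_le_iff_le_toReal htop]
      exact exists_code_iff_le_hypTest hE hε0 hO hOc (hOD d) (hODc d) hd0 (hov d hd) hN hZ h
    have hsup : oneShotCapacity b (fun d => freeSuperchannels O (OD d)) ε E = _ := hG.csSup_eq
    rw [hsup]
    exact ⟨htop, hG, rfl⟩
  · have htop : smoothStdRobustness ε O E ≠ ⊤ := by
      -- Finiteness: composing E with the decomposition of the identity on A bounds the robustness
      -- by |A|.
      obtain ⟨N, hN, Z, hZ, h⟩ := exists_sep_decomposition (D := A)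
      have hA : (1 : ℝ) ≤ Fintype.card A := by exact_mod_cast Fintype.card_pos
      exact ne_top_of_le_ne_top ENNReal.ofReal_ne_top
        (smoothRobustness_le_of_decomposition hE hε0 hA (comp_decomposition h)
          (hsep (hE.comp_mem_sepChannels hN)) (hsep (hE.comp_mem_sepChannels hZ)))
    have h1 := one_le_toReal htop (one_le_smoothRobustness ε O O E)
    have hL : IsLeast (costRates b (fun d => freeSuperchannels (OD d) O) ε E)
        (Real.logb b ⌈(smoothStdRobustness ε O E).toReal⌉₊) := by
      refine isLeast_rates hb (Nat.one_le_ceil_iff.mpr (by linarith)) fun d hd => ?_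
      have : Nonempty (Fin d) := ⟨⟨0, hd⟩⟩
      obtain ⟨N, hN, Z, hZ, h⟩ := hdec d hd
      have hd1 : (1 : ℝ) ≤ d := by exact_mod_cast hd
      rw [Nat.ceil_le, ← ENNReal.le_ofReal_iff_toReal_le htop (by linarith)]
      refine exists_code_iff_smoothRobustness_le subset_rfl hOc hO hcl hcl (hODc d) hd1 hZ h
        (fun Θ hΘ => hΘ.2 N hN) fun L hL E' M hM Z' hZ' heq => ?_
      exact mix_mem hO (by linarith) heq hM hZ' (overlap_nonneg (hODc d hL)) (hov d hd L hL)
    have hinf : oneShotCost b (fun d => freeSuperchannels (OD d) O) ε E = _ := hL.csInf_eq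
    rw [hinf]
    exact ⟨htop, hL, rfl⟩

/-- Here k = d², which causes the factor 1/2 and the roundings to squares; N is only known to be a
channel, hence the generalized robustness. -/
theorem capacity_and_cost_noSignalling [Nonempty A] [Nonempty B] {E : OpMap A B}
    (hE : IsChannel E) {b : ℝ} (hb : 1 < b) {ε : ℝ} (hε0 : 0 ≤ ε) :
    (∀ d : ℕ, 1 ≤ d →
        minMeasure (aff (replacementChannels (Fin d) (Fin d))) (idCh d) = (d : ℝ≥0∞) ^ 2 ∧
        maxRobustness (replacementChannels (Fin d) (Fin d)) (idCh d) = (d : ℝ≥0∞) ^ 2) ∧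
      (ε < 1 →
        hypTest ε (aff (replacementChannels A B)) E ≠ ⊤ ∧
        IsGreatest (capacityRates b (fun d => nsCodes A B (Fin d) (Fin d)) ε E)
          (oneShotCapacity b (fun d => nsCodes A B (Fin d) (Fin d)) ε E) ∧
        oneShotCapacity b (fun d => nsCodes A B (Fin d) (Fin d)) ε E =
          1 / 2 * Real.logb b
            (squareFloor (hypTest ε (aff (replacementChannels A B)) E).toReal)) ∧
      smoothMaxRobustness ε (replacementChannels A B) E ≠ ⊤ ∧
      IsLeast (costRates b (fun d => nsCodes (Fin d) (Fin d) A B) ε E)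
        (oneShotCost b (fun d => nsCodes (Fin d) (Fin d) A B) ε E) ∧
      oneShotCost b (fun d => nsCodes (Fin d) (Fin d) A B) ε E =
        1 / 2 * Real.logb b
          (squareCeil (smoothMaxRobustness ε (replacementChannels A B) E).toReal) := by
  have hdec : ∀ d : ℕ, 1 ≤ d → ∃ N : OpMap (Fin d) (Fin d), IsChannel N ∧
      LinearMap.id + ((d : ℝ) ^ 2 - 1) • N = (d : ℝ) ^ 2 • depol (Fin d) (Fin d) := by
    intro d hd
    have : Nonempty (Fin d) := ⟨⟨0, hd⟩⟩
    simpa only [Fintype.card_fin] using exists_depol_decomposition (D := Fin d)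
  have hov : ∀ d : ℕ, ∀ M ∈ replacementChannels (Fin d) (Fin d), overlap M = 1 / (d : ℝ) ^ 2 := by
    intro d M hM
    simpa only [Fintype.card_fin] using overlap_replacement hM
  refine ⟨fun d hd => ?_, fun hε1 => ?_, ?_⟩
  · have : Nonempty (Fin d) := ⟨⟨0, hd⟩⟩
    have hd1 : (1 : ℝ) ≤ (d : ℝ) ^ 2 := one_le_pow₀ (by exact_mod_cast hd)
    obtain ⟨N, hN, h⟩ := hdec d hd
    have hdep : depol (Fin d) (Fin d) ∈ replacementChannels (Fin d) (Fin d) :=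
      depol_mem_replacementChannels
    rw [← ENNReal.ofReal_natCast, ← ENNReal.ofReal_pow (Nat.cast_nonneg d)]
    -- The trivial code is no-signalling, so `overlap_of_mem_aff` applies to the elements of the
    -- affine hull themselves.
    have hid : (fun L : OpMap (Fin d) (Fin d) => L) ∈
        nsCodes (Fin d) (Fin d) (Fin d) (Fin d) :=
      ⟨isSuperchannel_of_memory (M := Unit) (relabel (Equiv.punitProd (Fin d)).symm)
        (relabel (Equiv.punitProd (Fin d))) (isChannel_relabel _) (isChannel_relabel _)
        fun L => rfl, fun _ hM => hM⟩
    refine ⟨minMeasure_id_eq hd1 h hN (subset_aff _ hdep) fun M hM => ?_,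
      robustness_id_eq hd1 h hN hdep subset_rfl fun M hM => (hov d M hM).le⟩
    have := overlap_of_mem_aff hid hM
    rw [Fintype.card_fin] at this
    exact this.le
  · have htop := hypTest_ne_top hE hε0 hε1
      (subset_aff _ (depol_mem_replacementChannels (A := A) (B := B)))
    have h1 := one_le_toReal htop (one_le_hypTest hE hε0 fun M hM => trace_of_mem_aff hM)
    have hG : IsGreatest (capacityRates b (fun d => nsCodes A B (Fin d) (Fin d)) ε E)
        (Real.logb b
          ⌊Real.sqrt (hypTest ε (aff (replacementChannels A B)) E).toReal⌋₊) := by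
      refine isGreatest_rates hb (Nat.one_le_floor_iff _ |>.mpr (Real.one_le_sqrt.mpr h1))
        fun d hd => ?_
      have : Nonempty (Fin d) := ⟨⟨0, hd⟩⟩
      rw [Nat.le_floor_iff (Real.sqrt_nonneg _), Real.le_sqrt (Nat.cast_nonneg d) (by linarith),
        ← ENNReal.ofReal_le_iff_le_toReal htop]
      have := exists_nsCode_iff_le_hypTest (D := Fin d) hE hε0
      rwa [Fintype.card_fin] at this
    have hsup : oneShotCapacity b (fun d => nsCodes A B (Fin d) (Fin d)) ε E = _ := hG.csSup_eq
    rw [hsup, squareFloor_eq h1, half_logb_sq]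
    exact ⟨htop, hG, rfl⟩
  · have htop : smoothMaxRobustness ε (replacementChannels A B) E ≠ ⊤ := by
      obtain ⟨N, hN, h⟩ := exists_depol_decomposition (D := A)
      have hA : (1 : ℝ) ≤ (Fintype.card A : ℝ) ^ 2 :=
        one_le_pow₀ (by exact_mod_cast Fintype.card_pos)
      exact ne_top_of_le_ne_top ENNReal.ofReal_ne_top
        (smoothRobustness_le_of_decomposition hE hε0 hA (comp_decomposition h)
          (hE.comp hN) (hE.comp_mem_replacementChannels depol_mem_replacementChannels))
    have h1 := one_le_toReal htop
      (one_le_smoothRobustness ε (replacementChannels A B) (allChannels A B) E)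
    have hL : IsLeast (costRates b (fun d => nsCodes (Fin d) (Fin d) A B) ε E)
        (Real.logb b
          ⌈Real.sqrt (smoothMaxRobustness ε (replacementChannels A B) E).toReal⌉₊) := by
      refine isLeast_rates hb (Nat.one_le_ceil_iff.mpr (Real.sqrt_pos.mpr (by linarith)))
        fun d hd => ?_
      have : Nonempty (Fin d) := ⟨⟨0, hd⟩⟩
      obtain ⟨N, hN, h⟩ := hdec d hd
      have hd1 : (1 : ℝ) ≤ (d : ℝ) ^ 2 := one_le_pow₀ (by exact_mod_cast hd)
      rw [Nat.ceil_le, Real.sqrt_le_left (Nat.cast_nonneg d),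
        ← ENNReal.le_ofReal_iff_toReal_le htop (by linarith)]
      refine exists_code_iff_smoothRobustness_le replacementChannels_subset subset_rfl
        convex_allChannels isClosed_choi_replacementChannels isCompact_choi_channels.isClosed
        replacementChannels_subset hd1 depol_mem_replacementChannels h
        (fun Θ hΘ => hΘ.1.isChannel hN) fun L hL E' M hM Z' hZ' heq => ?_
      -- The overlap equals 1/d² exactly, so M drops out and the mixture is Z'.
      rw [mix_eq heq, hov d L hL, div_mul_cancel₀ _ (by linarith), sub_self, one_smul, zero_smul,
        add_zero]
      exact hZ'
    have hinf : oneShotCost b (fun d => nsCodes (Fin d) (Fin d) A B) ε E = _ := hL.csInf_eq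
    rw [hinf, squareCeil_eq h1, half_logb_sq]
    exact ⟨htop, hL, rfl⟩

end Main

end

end QComm

open QComm
theorem mainTheorem6 {A B : Type*} [Fintype A] [DecidableEq A] [Nonempty A]
    [Fintype B] [DecidableEq B] [Nonempty B]
    (E : OpMap A B) (hE : IsChannel E) (b : ℝ) (hb : 1 < b)
    (ε : ℝ) (hε0 : 0 ≤ ε) (hε1 : ε ≤ 1) :
    -- separability-preserving codes
    ((∀ d : ℕ, 1 ≤ d →
        minMeasure (sepChannels (Fin d) (Fin d)) (idCh d) = d ∧
        stdRobustness (sepChannels (Fin d) (Fin d)) (idCh d) = d) ∧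
      (ε < 1 →
        hypTest ε (sepChannels A B) E ≠ ⊤ ∧
        IsGreatest (capacityRates b (fun d => sepCodes A B (Fin d) (Fin d)) ε E)
          (oneShotCapacity b (fun d => sepCodes A B (Fin d) (Fin d)) ε E) ∧
        oneShotCapacity b (fun d => sepCodes A B (Fin d) (Fin d)) ε E =
          Real.logb b ⌊(hypTest ε (sepChannels A B) E).toReal⌋₊) ∧
      smoothStdRobustness ε (sepChannels A B) E ≠ ⊤ ∧
      IsLeast (costRates b (fun d => sepCodes (Fin d) (Fin d) A B) ε E)
        (oneShotCost b (fun d => sepCodes (Fin d) (Fin d) A B) ε E) ∧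
      oneShotCost b (fun d => sepCodes (Fin d) (Fin d) A B) ε E =
        Real.logb b ⌈(smoothStdRobustness ε (sepChannels A B) E).toReal⌉₊) ∧
    -- PPT-preserving codes
    ((∀ d : ℕ, 1 ≤ d →
        minMeasure (pptChannels (Fin d) (Fin d)) (idCh d) = d ∧
        stdRobustness (pptChannels (Fin d) (Fin d)) (idCh d) = d) ∧
      (ε < 1 →
        hypTest ε (pptChannels A B) E ≠ ⊤ ∧
        IsGreatest (capacityRates b (fun d => pptCodes A B (Fin d) (Fin d)) ε E)
          (oneShotCapacity b (fun d => pptCodes A B (Fin d) (Fin d)) ε E) ∧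
        oneShotCapacity b (fun d => pptCodes A B (Fin d) (Fin d)) ε E =
          Real.logb b ⌊(hypTest ε (pptChannels A B) E).toReal⌋₊) ∧
      smoothStdRobustness ε (pptChannels A B) E ≠ ⊤ ∧
      IsLeast (costRates b (fun d => pptCodes (Fin d) (Fin d) A B) ε E)
        (oneShotCost b (fun d => pptCodes (Fin d) (Fin d) A B) ε E) ∧
      oneShotCost b (fun d => pptCodes (Fin d) (Fin d) A B) ε E =
        Real.logb b ⌈(smoothStdRobustness ε (pptChannels A B) E).toReal⌉₊) ∧
    -- no-signalling codes
    ((∀ d : ℕ, 1 ≤ d →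
        minMeasure (aff (replacementChannels (Fin d) (Fin d))) (idCh d) = (d : ℝ≥0∞) ^ 2 ∧
        maxRobustness (replacementChannels (Fin d) (Fin d)) (idCh d) = (d : ℝ≥0∞) ^ 2) ∧
      (ε < 1 →
        hypTest ε (aff (replacementChannels A B)) E ≠ ⊤ ∧
        IsGreatest (capacityRates b (fun d => nsCodes A B (Fin d) (Fin d)) ε E)
          (oneShotCapacity b (fun d => nsCodes A B (Fin d) (Fin d)) ε E) ∧
        oneShotCapacity b (fun d => nsCodes A B (Fin d) (Fin d)) ε E =
          1 / 2 * Real.logb b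
            (squareFloor (hypTest ε (aff (replacementChannels A B)) E).toReal)) ∧
      smoothMaxRobustness ε (replacementChannels A B) E ≠ ⊤ ∧
      IsLeast (costRates b (fun d => nsCodes (Fin d) (Fin d) A B) ε E)
        (oneShotCost b (fun d => nsCodes (Fin d) (Fin d) A B) ε E) ∧
      oneShotCost b (fun d => nsCodes (Fin d) (Fin d) A B) ε E =
        1 / 2 * Real.logb b
          (squareCeil (smoothMaxRobustness ε (replacementChannels A B) E).toReal)) := by
  refine ⟨?_, ?_, capacity_and_cost_noSignalling hE hb hε0⟩
  · refine capacity_and_cost_of_standard hE hb hε0 convex_sepChannels sepChannels_subset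
      isClosed_choi_sepChannels subset_rfl (fun _ => convex_sepChannels)
      (fun _ => sepChannels_subset) (fun _ => subset_rfl) fun d hd M hM => ?_
    have : Nonempty (Fin d) := ⟨⟨0, hd⟩⟩
    simpa only [Fintype.card_fin] using overlap_le_of_ppt (sepChannels_subset_ppt hM)
  · refine capacity_and_cost_of_standard hE hb hε0 convex_pptChannels pptChannels_subset
      isClosed_choi_pptChannels sepChannels_subset_ppt (fun _ => convex_pptChannels)
      (fun _ => pptChannels_subset) (fun _ => sepChannels_subset_ppt) fun d hd M hM => ?_
    have : Nonempty (Fin d) := ⟨⟨0, hd⟩⟩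
    simpa only [Fintype.card_fin] using overlap_le_of_ppt hM
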